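/- **Setting.** Consider a finite two-player extensive-form game with perfect recall and without chance moves (every decision node belongs to one information set of one player, all nodes of an information set $I$ have the same nonempty finite action set $A_I$; perfect recall means that at all nodes of an information set the acting player has the same history of own information sets and own actions). Let $\mathcal I_i$ be the set of information sets of Player $i$ and $\Sigma_i=\{(I,a): I\in\mathcal I_i,\ a\in A_I\}\cup\{\varnothing\}$ the set of sequences; the parent sequence $\sigma(I)\in\Sigma_i$ of $I\in\mathcal I_i$ is the last pair of Player $i$ on the path from the root to any node of $I$, or $\varnothing$ if there is none. Write $\tau\succeq\tau'$ if $\tau=\tau'$, or $\tau=(I,a)$ and $\sigma(I)\succeq\tau'$; and $\tau\succ\tau'$ if moreover $\tau\ne\tau'$. Information sets $I_1\in\mathcal I_1$, $I_2\in\mathcal I_2$ are connected, $I_1\rightleftharpoons I_2$, if some $u\in I_1$ and $v\in I_2$ lie on a common path from the root. A pair $(\sigma_1,\sigma_2)\in\Sigma_1\times\Sigma_2$ is relevant if $\sigma_1=\varnothing$ or $\sigma_2=\varnothing$ or $\sigma_j=(I_j,a_j)$ with $I_1\rightleftharpoons I_2$; a sequence $\sigma$ of one player is relevant to an information set $J$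 of the other player, $\sigma\bowtie J$, if $\sigma=\varnothing$ or $\sigma=(I,a)$ with $I\rightleftharpoons J$. The polytope $\Xi$ of correlation plans is the set of nonnegative vectors $\xi$ indexed by the relevant sequence pairs such that $\xi[\varnothing,\varnothing]=1$, $\sum_{a\in A_I}\xi[(I,a),\sigma_2]=\xi[\sigma(I),\sigma_2]$ for all $I\in\mathcal I_1$, $\sigma_2\in\Sigma_2$ with $\sigma_2\bowtie I$, and $\sum_{a\in A_J}\xi[\sigma_1,(J,a)]=\xi[\sigma_1,\sigma(J)]$ for all $J\in\mathcal I_2$, $\sigma_1\in\Sigma_1$ with $\sigma_1\bowtie J$. For nonempty compact convex sets $X,Y$ and an affine $h:X\to\mathbb R_{\ge0}$, the scaled extension is $X\mathbin{\mathrm{ext}^h}Y=\{(x,y): x\in X,\ y\in h(x)Y\}$. Let $\Delta^s\subset\mathbb R^s$ be the simplex of nonnegative vectors with sum $1$. **Algorithm Decompose.** The algorithm keeps a chain of scaled extensions $\mathcal D$ whose coordinates are indexed by relevant sequence pairs; it starts with $\mathcal D=\{1\}$, indexed by $(\varnothing,\varnothing)$, and with the call at $(\varnothing,\varnothing)$.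 In a call at $(\sigma_1,\sigma_2)$ it chooses a critical player $i$, that is, one with at most one information set $I^*\in\mathcal I_i$ such that $\sigma(I^*)=\sigma_i$ and $I^*\rightleftharpoons K$ for some opponent information set $K$ with $\sigma(K)=\sigma_{-i}$. Say $i=1$ (the case $i=2$ is symmetric). (a) For each $I\in\mathcal I_1$ with $\sigma(I)=\sigma_1$ and $\sigma_2\bowtie I$, it replaces $\mathcal D$ by $\mathcal D\mathbin{\mathrm{ext}^h}\Delta^{|A_I|}$ with $h(\xi)=\xi[\sigma_1,\sigma_2]$, the new coordinates being indexed by $((I,a),\sigma_2)$, $a\in A_I$, and then calls itself at $((I,a),\sigma_2)$ for each $a\in A_I$. (b) Then for each $J\in\mathcal I_2$ with $\sigma(J)\succeq\sigma_2$ and $\sigma_1\bowtie J$, in top-down order ($J$ before $J'$ whenever $\sigma(J')\succ\sigma(J)$): if $I^*$ exists and $I^*\rightleftharpoons J$, then for each $a\in A_J$ it replaces $\mathcal D$ by $\mathcal D\mathbin{\mathrm{ext}^h}\{1\}$ with $h(\xi)=\sum_{a^*\in A_{I^*}}\xi[(I^*,a^*),(J,a)]$, the new coordinate being indexed by $(\sigma_1,(J,a))$;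 otherwise it replaces $\mathcal D$ by $\mathcal D\mathbin{\mathrm{ext}^h}\Delta^{|A_J|}$ with $h(\xi)=\xi[\sigma_1,\sigma(J)]$, the new coordinates being indexed by $(\sigma_1,(J,a))$, $a\in A_J$. **Theorem.** For every such game: 1. There are $n\ge0$, sets $X_1,\dots,X_n$, each of which is a simplex $\Delta^{s_i}$ or the singleton $\{1\}$, and linear functions $h_i=\langle a_i,\cdot\rangle$ (with $a_i$ a vector of natural numbers) such that, up to an ordering of the coordinates (the relevant sequence pairs), $$\Xi=\{1\}\mathbin{\mathrm{ext}^{h_1}}X_1\mathbin{\mathrm{ext}^{h_2}}X_2\cdots\mathbin{\mathrm{ext}^{h_n}}X_n$$ (associated to the left), where all the scaled extensions are well defined: each $h_i$ is nonnegative on the set that it extends, and all the sets involved are nonempty, compact and convex. 2. The algorithm Decompose has a complete run, and every complete run (for any choice of critical players and of admissible iteration orders) ends with an expression for $\Xi$ as in 1. 3. Such an expression can be computed exactly in polynomial time by Decompose: there are a program and a polynomial $P$ such that, for every such game, the program, given a table of the nodes of the game tree (in any order) and of its information sets, halts after at most $P(N+k)$ steps, where $N$ is the number of nodes of the game tree and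 $k$ the number of action names, and outputs the result of a complete run of Decompose, namely the order of the coordinates and all the $(a_i,X_i)$. (Programs are WHILE programs over binary trees with one step per elementary operation; numbers are written in unary.) -/

import Mathlib

/-! ## Two-player extensive-form games without chance moves -/

/-- The two players. -/
inductive Player where
  | one
  | two
  deriving DecidableEq

/-- The opponent of a player. -/
def Player.opp : Player → Player
  | .one => .two
  | .two => .one

/-- A finite two-player extensive-form game tree without chance moves, with information sets named
by `I` and actions named by `A` (payoffs play no role for correlation plans and are left out).
A node is the list of the actions that lead to it from the root, the most recent action first. So
the root is `[]`, the parent of `a :: h` is `h`, and `u` lies on the path from the root to `v` if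
and only if `u` is a suffix of `v`. -/
structure EFG (I A : Type*) where
  nodes : Finset (List A)
  root_mem : [] ∈ nodes
  /-- the information set of a decision node, and `none` at a terminal node -/
  infoset : List A → Option I
  infoset_mem : ∀ h J, infoset h = some J → h ∈ nodes
  infoset_nonempty : ∀ J, ∃ h, infoset h = some J
  /-- the player who acts at an information set -/
  player : I → Player
  /-- the actions available at (all the nodes of) an information set -/
  actions : I → Finset A
  actions_nonempty : ∀ J, (actions J).Nonempty
  cons_mem_iff : ∀ a h, a :: h ∈ nodes ↔ ∃ J, infoset h = some J ∧ a ∈ actions J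

/-- `none` is the empty sequence `∅`, and `some (J, a)` is the sequence `(J, a)`. -/
abbrev Sequence (I A : Type*) := Option (I × A)

/-- A pair `(σ₁, σ₂)` of a sequence of Player 1 and a sequence of Player 2. -/
abbrev SeqPair (I A : Type*) := Sequence I A × Sequence I A

/-- The sequence pair in which player `i` has the sequence `own`, and the opponent of `i` has the
sequence `other`. -/
def mkPair {I A : Type*} : Player → Sequence I A → Sequence I A → SeqPair I A
  | .one, own, other => (own, other)
  | .two, own, other => (other, own)

namespace EFG

variable {I A : Type*} (G : EFG I A)

/-- The pairs (information set, action) of player `i` on the path from the root to a node, the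
most recent pair first. -/
def ownHistory (i : Player) : List A → List (I × A)
  | [] => []
  | a :: h =>
    match G.infoset h with
    | some J => if G.player J = i then (J, a) :: ownHistory i h else ownHistory i h
    | none => ownHistory i h

/-- Perfect recall: at all the nodes of an information set, the acting player has seen the same
own information sets and taken the same own actions, in the same order. -/
def PerfectRecall : Prop :=
  ∀ (J : I) (u v : List A), G.infoset u = some J → G.infoset v = some J →
    G.ownHistory (G.player J) u = G.ownHistory (G.player J) v

/-- The parent sequence `σ(J)`: the last pair of the acting player on the path from the root to a
node of `J`, or `∅` if there is none (under perfect recall the choice of the node is irrelevant). -/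
noncomputable def parentSeq (J : I) : Sequence I A :=
  (G.ownHistory (G.player J) (G.infoset_nonempty J).choose).head?

/-- `σ ∈ Σ_i`. -/
def IsSequence (i : Player) : Sequence I A → Prop
  | none => True
  | some (J, a) => G.player J = i ∧ a ∈ G.actions J

/-- `G.Descends τ τ'` is `τ ⪰ τ'`. -/
inductive Descends : Sequence I A → Sequence I A → Prop
  | refl (τ : Sequence I A) : Descends τ τ
  | step (J : I) (a : A) (τ : Sequence I A) : Descends (G.parentSeq J) τ → Descends (some (J, a)) τ

/-- Connected information sets, `J ⇌ K`. -/
def Connected (J K : I) : Prop :=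
  ∃ u v, G.infoset u = some J ∧ G.infoset v = some K ∧ (u <:+ v ∨ v <:+ u)

/-- The relation `σ ⋈ J` between a sequence `σ` of one player and an information set `J` of the
other player. -/
def SeqInfosetRelevant : Sequence I A → I → Prop
  | none, _ => True
  | some (K, _), J => G.Connected K J

/-- Relevant sequence pairs, `σ₁ ⋈ σ₂`. -/
def Relevant (p : SeqPair I A) : Prop :=
  G.IsSequence .one p.1 ∧ G.IsSequence .two p.2 ∧
    ∀ J a K b, p.1 = some (J, a) → p.2 = some (K, b) → G.Connected J K

/-- The type of the relevant sequence pairs. -/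
abbrev RelevantPair := {p : SeqPair I A // G.Relevant p}

open Classical in
/-- The entry `ξ[p]`; only entries at relevant sequence pairs `p` are ever used. -/
noncomputable def entry (ξ : G.RelevantPair → ℝ) (p : SeqPair I A) : ℝ :=
  if h : G.Relevant p then ξ ⟨p, h⟩ else 0

/-- The polytope `Ξ` of correlation plans. -/
def correlationPlans : Set (G.RelevantPair → ℝ) :=
  {ξ | (∀ p, 0 ≤ ξ p) ∧
    G.entry ξ (none, none) = 1 ∧
    (∀ (J : I) (σ₂ : Sequence I A), G.player J = .one → G.IsSequence .two σ₂ →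
      G.SeqInfosetRelevant σ₂ J →
        ∑ a ∈ G.actions J, G.entry ξ (some (J, a), σ₂) = G.entry ξ (G.parentSeq J, σ₂)) ∧
    (∀ (J : I) (σ₁ : Sequence I A), G.player J = .two → G.IsSequence .one σ₁ →
      G.SeqInfosetRelevant σ₁ J →
        ∑ a ∈ G.actions J, G.entry ξ (σ₁, some (J, a)) = G.entry ξ (σ₁, G.parentSeq J))}

/-- For the sequence pair in which player `i` has the sequence `s` and the opponent has `t`: the
information set `J` of player `i`, with `σ(J) = s`, is critical for `t`. -/
def Critical (i : Player) (s t : Sequence I A) (J : I) : Prop :=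
  G.player J = i ∧ G.parentSeq J = s ∧
    ∃ K, G.player K = i.opp ∧ G.parentSeq K = t ∧ G.Connected J K

end EFG

/-! ## Scaled extensions -/

/-- The linear function `⟨a, ·⟩`. -/
def dotNat {d : ℕ} (a : Fin d → ℕ) (x : Fin d → ℝ) : ℝ := ∑ j, (a j : ℝ) * x j

/-- The scaled extension of `X` with `Y` via `h`, that is `{(x, y) : x ∈ X, y ∈ h(x) Y}`. -/
def scaledExtension {m n : ℕ} (X : Set (Fin m → ℝ)) (h : (Fin m → ℝ) → ℝ) (Y : Set (Fin n → ℝ)) :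
    Set (Fin (m + n) → ℝ) :=
  {z | ∃ x ∈ X, ∃ y ∈ Y, z = Fin.append x (h x • y)}

/-- The requirements under which the scaled extension of `X` with `Y` via a linear function `h`
is defined. -/
structure ScaledExtensionDefined {m n : ℕ} (X : Set (Fin m → ℝ)) (h : (Fin m → ℝ) → ℝ)
    (Y : Set (Fin n → ℝ)) : Prop where
  left_nonempty : X.Nonempty
  left_compact : IsCompact X
  left_convex : Convex ℝ X
  right_nonempty : Y.Nonempty
  right_compact : IsCompact Y
  right_convex : Convex ℝ Y
  nonneg : ∀ x ∈ X, 0 ≤ h x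

/-- The sets allowed in a chain: a simplex `Δ^s` with `s` coordinates, or the singleton `{1}`. -/
inductive Factor where
  | simplex (s : ℕ)
  | singleton

/-- The number of coordinates of a factor. -/
@[reducible] def Factor.dim : Factor → ℕ
  | .simplex s => s
  | .singleton => 1

/-- The set that a factor stands for. -/
def Factor.toSet : (X : Factor) → Set (Fin X.dim → ℝ)
  | .simplex s => stdSimplex ℝ (Fin s)
  | .singleton => {fun _ => 1}

/-- Expressions `{1} ext^{h₁} X₁ ext^{h₂} ⋯ ext^{hₙ} Xₙ`, associated to the left, with factors `Xᵢ`
and linear functions `hᵢ = ⟨aᵢ, ·⟩`. The vectors `aᵢ` have natural number entries, so that an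
expression is a finite object. The index is the number of coordinates. -/
inductive ScaledChain : ℕ → Type
  | base : ScaledChain 1
  | ext {d : ℕ} (C : ScaledChain d) (a : Fin d → ℕ) (X : Factor) : ScaledChain (d + X.dim)

/-- The set that an expression denotes. -/
def ScaledChain.toSet : {d : ℕ} → ScaledChain d → Set (Fin d → ℝ)
  | _, .base => {fun _ => 1}
  | _, .ext C a X => scaledExtension C.toSet (dotNat a) X.toSet

/-- All the scaled extensions in an expression are defined. -/
def ScaledChain.WellDefined : {d : ℕ} → ScaledChain d → Prop
  | _, .base => True
  | _, .ext C a X => C.WellDefined ∧ ScaledExtensionDefined C.toSet (dotNat a) X.toSet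

/-- An expression for a set of vectors, together with the sequence pairs that index the
coordinates, in the order in which they are filled in. -/
structure IndexedChain (I A : Type*) where
  dim : ℕ
  chain : ScaledChain dim
  index : Fin dim → SeqPair I A

/-- The expression `{1}`, whose only coordinate is indexed by `(∅, ∅)`. -/
def IndexedChain.init (I A : Type*) : IndexedChain I A where
  dim := 1
  chain := .base
  index := fun _ => (none, none)

open Classical in
/-- Fill in the entries `new` by splitting the entry `source`: the scaled extension with a simplex
via `ξ ↦ ξ[source]`. -/
noncomputable def IndexedChain.split {I A : Type*} (D : IndexedChain I A)
    (source : SeqPair I A) (new : List (SeqPair I A)) : IndexedChain I A where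
  dim := D.dim + new.length
  chain := D.chain.ext (fun j => if D.index j = source then 1 else 0) (.simplex new.length)
  index := Fin.append D.index new.get

open Classical in
/-- Fill in the entry `new` with the sum of the entries `sources`: the scaled extension with `{1}`
via `ξ ↦ ∑ ξ[source]`. -/
noncomputable def IndexedChain.sum {I A : Type*} (D : IndexedChain I A)
    (sources : List (SeqPair I A)) (new : SeqPair I A) : IndexedChain I A where
  dim := D.dim + 1
  chain := D.chain.ext (fun j => if D.index j ∈ sources then 1 else 0) .singleton
  index := Fin.append D.index (fun _ : Fin 1 => new)

/-- The expression `D` is a chain of (defined) scaled extensions, its coordinates are in bijection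
with the relevant sequence pairs, and under this identification it denotes exactly `Ξ`. -/
def IsDecomposition {I A : Type*} (G : EFG I A) (D : IndexedChain I A) : Prop :=
  D.chain.WellDefined ∧
    ∃ e : Fin D.dim ≃ G.RelevantPair, (∀ j, (e j : SeqPair I A) = D.index j) ∧
      D.chain.toSet = (fun ξ : G.RelevantPair → ℝ => ξ ∘ e) '' G.correlationPlans

/-! ## The algorithm `Decompose` -/

/-- The operations of the algorithm: a (recursive) call at a sequence pair, and the two ways of
filling in entries. -/
inductive Operation (I A : Type*) where
  | call (p : SeqPair I A)
  | split (source : SeqPair I A) (new : List (SeqPair I A))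
  | sum (sources : List (SeqPair I A)) (new : SeqPair I A)

/-- `ord J` lists the actions at `J`, in some order. -/
def IsActionOrder {I A : Type*} (G : EFG I A) (ord : I → List A) : Prop :=
  ∀ J, (ord J).Nodup ∧ ∀ a, a ∈ ord J ↔ a ∈ G.actions J

/-- First phase of a call at the pair with critical player `i`, whose sequence is `s`, while the
opponent's sequence is `t`; `J` is an information set of player `i` with `σ(J) = s`, `t ⋈ J`. -/
def ownTasks {I A : Type*} (ord : I → List A) (i : Player) (s t : Sequence I A) (J : I) :
    List (Operation I A) :=
  .split (mkPair i s t) ((ord J).map fun a => mkPair i (some (J, a)) t) ::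
    (ord J).map fun a => .call (mkPair i (some (J, a)) t)

open Classical in
/-- Second phase of such a call; `K` is an information set of the opponent with `σ(K) ⪰ t`,
`s ⋈ K`, and `star` is the critical information set of player `i` for `t`, if there is one. -/
noncomputable def opponentTasks {I A : Type*} (G : EFG I A) (ord : I → List A) (i : Player)
    (s : Sequence I A) (star : Option I) (K : I) : List (Operation I A) :=
  match star with
  | some J =>
    if G.Connected J K then
      (ord K).map fun b =>
        .sum ((ord J).map fun a => mkPair i (some (J, a)) (some (K, b))) (mkPair i s (some (K, b)))
    else [.split (mkPair i s (G.parentSeq K)) ((ord K).map fun b => mkPair i s (some (K, b)))]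
  | none => [.split (mkPair i s (G.parentSeq K)) ((ord K).map fun b => mkPair i s (some (K, b)))]

/-- `body` is the list of the operations that a call at `p` performs, for some choice of a critical
player `i` (one with at most one critical information set) and of the iteration orders. The second
loop is in top-down order: no `K` comes after a `J` with `σ(J) ≻ σ(K)`. -/
def IsBody {I A : Type*} (G : EFG I A) (ord : I → List A) (p : SeqPair I A)
    (body : List (Operation I A)) : Prop :=
  ∃ (i : Player) (s t : Sequence I A) (star : Option I) (Js Ks : List I),
    p = mkPair i s t ∧
    (∀ J, star = some J ↔ G.Critical i s t J) ∧
    Js.Nodup ∧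
    (∀ J, J ∈ Js ↔ G.player J = i ∧ G.parentSeq J = s ∧ G.SeqInfosetRelevant t J) ∧
    Ks.Nodup ∧
    (∀ K, K ∈ Ks ↔
      G.player K = i.opp ∧ G.Descends (G.parentSeq K) t ∧ G.SeqInfosetRelevant s K) ∧
    Ks.Pairwise (fun J K =>
      ¬ (G.Descends (G.parentSeq J) (G.parentSeq K) ∧ G.parentSeq J ≠ G.parentSeq K)) ∧
    body = Js.flatMap (ownTasks ord i s t) ++ Ks.flatMap (opponentTasks G ord i s star)

/-- `Executes G ord ts D D'`: performing the operations `ts` in turn, with `D` filled in at the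
beginning, can end with `D'` filled in. -/
inductive Executes {I A : Type*} (G : EFG I A) (ord : I → List A) :
    List (Operation I A) → IndexedChain I A → IndexedChain I A → Prop
  | nil (D : IndexedChain I A) : Executes G ord [] D D
  | split {source : SeqPair I A} {new : List (SeqPair I A)} {ts : List (Operation I A)}
      {D D' : IndexedChain I A} :
      Executes G ord ts (D.split source new) D' → Executes G ord (.split source new :: ts) D D'
  | sum {sources : List (SeqPair I A)} {new : SeqPair I A} {ts : List (Operation I A)}
      {D D' : IndexedChain I A} :
      Executes G ord ts (D.sum sources new) D' → Executes G ord (.sum sources new :: ts) D D'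
  | call {p : SeqPair I A} {body ts : List (Operation I A)} {D D' D'' : IndexedChain I A} :
      IsBody G ord p body → Executes G ord body D D' → Executes G ord ts D' D'' →
        Executes G ord (.call p :: ts) D D''

/-- `D` is a possible result of `Decompose` on the whole game: the call at `(∅, ∅)`, started when
only the entry at `(∅, ∅)` is filled in, with the value 1. -/
def DecomposeResult {I A : Type*} (G : EFG I A) (D : IndexedChain I A) : Prop :=
  ∃ ord, IsActionOrder G ord ∧ Executes G ord [.call (none, none)] (IndexedChain.init I A) D

/-! ## A machine model with a step count: WHILE programs on binary trees -/

/-- The data of WHILE programs. -/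
inductive Data where
  | nil
  | cons (x y : Data)

/-- WHILE programs, in variable-free form. -/
inductive Prog where
  | id
  | nil
  | head
  | tail
  | cons (p q : Prog)
  | seq (p q : Prog)
  | cond (c p q : Prog)
  | loop (c p : Prog)

/-- `Eval p x y t`: on the input `x`, the program `p` halts after `t` steps with the output `y`.
All elementary operations take one step; `nil` is the truth value false. `seq p q` runs `p` first,
and `loop c p` is `while c do p`. -/
inductive Eval : Prog → Data → Data → ℕ → Prop
  | id (x : Data) : Eval .id x x 1
  | nil (x : Data) : Eval .nil x .nil 1
  | head_nil : Eval .head .nil .nil 1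
  | head_cons (x y : Data) : Eval .head (.cons x y) x 1
  | tail_nil : Eval .tail .nil .nil 1
  | tail_cons (x y : Data) : Eval .tail (.cons x y) y 1
  | cons {p q : Prog} {x y z : Data} {s t : ℕ} :
      Eval p x y s → Eval q x z t → Eval (.cons p q) x (.cons y z) (s + t + 1)
  | seq {p q : Prog} {x y z : Data} {s t : ℕ} :
      Eval p x y s → Eval q y z t → Eval (.seq p q) x z (s + t + 1)
  | cond_true {c p q : Prog} {x y b b' : Data} {s t : ℕ} :
      Eval c x (.cons b b') s → Eval p x y t → Eval (.cond c p q) x y (s + t + 1)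
  | cond_false {c p q : Prog} {x y : Data} {s t : ℕ} :
      Eval c x .nil s → Eval q x y t → Eval (.cond c p q) x y (s + t + 1)
  | loop_true {c p : Prog} {x y z b b' : Data} {r s t : ℕ} :
      Eval c x (.cons b b') r → Eval p x y s → Eval (.loop c p) y z t →
        Eval (.loop c p) x z (r + s + t + 1)
  | loop_false {c p : Prog} {x : Data} {s : ℕ} :
      Eval c x .nil s → Eval (.loop c p) x x (s + 1)

/-! Encodings of the input and of the output; numbers are in unary. -/

/-- Encoding of numbers. -/
def encodeNat : ℕ → Data
  | 0 => .nil
  | n + 1 => .cons .nil (encodeNat n)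

/-- Encoding of lists. -/
def encodeList {α : Type*} (f : α → Data) : List α → Data
  | [] => .nil
  | x :: l => .cons (f x) (encodeList f l)

/-- Encoding of optional values. -/
def encodeOption {α : Type*} (f : α → Data) : Option α → Data
  | none => .nil
  | some x => .cons (f x) .nil

/-- Encoding of names. -/
def encodeFin {n : ℕ} (x : Fin n) : Data := encodeNat x

/-- Encoding of players. -/
def encodePlayer : Player → Data
  | .one => .nil
  | .two => .cons .nil .nil

/-- `L` lists the nodes of `G`, in some order. -/
def IsNodeList {I A : Type*} (G : EFG I A) (L : List (List A)) : Prop :=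
  L.Nodup ∧ ∀ h, h ∈ L ↔ h ∈ G.nodes

/-- Encoding of a game whose nodes are listed as `L`: a table of the nodes with their information
sets, and a table of the information sets with their players and actions. -/
def encodeGame {m k : ℕ} (G : EFG (Fin m) (Fin k)) (L : List (List (Fin k))) : Data :=
  .cons
    (encodeList
      (fun h => .cons (encodeList encodeFin h) (encodeOption encodeFin (G.infoset h))) L)
    (encodeList
      (fun J => .cons (encodePlayer (G.player J))
        (encodeList encodeFin ((List.finRange k).filter fun a => a ∈ G.actions J)))
      (List.finRange m))

/-- Encoding of sequences. -/
def encodeSequence {m k : ℕ} : Sequence (Fin m) (Fin k) → Data :=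
  encodeOption fun q => .cons (encodeFin q.1) (encodeFin q.2)

/-- Encoding of factors. -/
def encodeFactor : Factor → Data
  | .simplex s => .cons .nil (encodeNat s)
  | .singleton => .nil

/-- Encoding of expressions: the list of all `(aᵢ, Xᵢ)`, with the last extension first. -/
def encodeChain : {d : ℕ} → ScaledChain d → Data
  | _, .base => .nil
  | _, .ext C a X =>
    .cons (.cons (encodeList encodeNat (List.ofFn a)) (encodeFactor X)) (encodeChain C)

/-- Encoding of expressions with their coordinates. -/
def encodeIndexedChain {m k : ℕ} (D : IndexedChain (Fin m) (Fin k)) : Data :=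
  .cons
    (encodeList (fun p => .cons (encodeSequence p.1) (encodeSequence p.2)) (List.ofFn D.index))
    (encodeChain D.chain)

/-! ## The structure of games with perfect recall -/

/-! Everything rests on the analysis of one call at `(s, t)`, where `s` belongs to the chosen player
`i`. Join the information sets of `i` with parent `s` to those of the opponent with parent `t`
whenever they are connected. This bipartite graph has no two disjoint edges
(`no_disjoint_connections`): each edge lies on a path from the root, and if two such paths separate
at a decision node, the player acting there would have different histories at two information sets
with the same parent sequence; nested paths are excluded similarly. A bipartite graph without
disjoint edges is a star, so one side has at most one non-isolated vertex, and a critical player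
exists (`exists_critical_player`).

The relevant pairs strictly below `(s, t)` fall into those whose `i`-sequence is strictly below `s`,
which the first loop and its recursive calls fill in, and the pairs `(s, τ)` with `τ` strictly below
`t`, which the second loop fills in. An information set of `i` with parent `s` that is connected
with a member of the second loop must be the critical one, `I*`. Hence the constraints of `i` at `s`
that involve the second loop are those of `I*`, and they determine the entries `ξ[s, (K, b)]` as
sums. The opponent's constraint at such a `K` then comes for free by exchanging two sums. If `K` is
not connected with `I*`, only the opponent's constraint is left, and it is a scaled simplex. So the
operations of a call impose exactly the constraints below its pair (`equations_call_of_callBody` and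
its converse), and they fill in every entry below it once, from entries already known.

A scaled extension by a simplex or by `{1}` says precisely that the new entries satisfy the
equations of a split or of a sum. Induction over a run (`Executes.spec`) shows that the final chain
denotes the solutions of the constraints below `(∅, ∅)`, normalized to 1 there, which is the
polytope.

A stack machine flattens the recursion. There are at most `N²` relevant pairs, and a weight counting
the entries still to be filled in decreases at each step, so the machine stops after polynomially
many steps with states of polynomial size. A calculus of polynomial-time computable families
(`Comp`) turns one machine step into a WHILE program: the relations between sequences and
information sets are decided by searching the table of nodes, and perfect recall makes the choice of
a representative node of an information set immaterial. -/

@[simp] theorem Player.opp_opp (i : Player) : i.opp.opp = i := by cases i <;> rfl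

theorem Player.eq_or_eq_opp (i j : Player) : i = j ∨ i = j.opp := by
  cases i <;> cases j <;> simp [Player.opp]

theorem mkPair_opp {I A : Type*} (i : Player) (s t : Sequence I A) :
    mkPair i.opp s t = mkPair i t s := by cases i <;> rfl

theorem mkPair_inj {I A : Type*} {i : Player} {s t s' t' : Sequence I A} :
    mkPair i s t = mkPair i s' t' ↔ s = s' ∧ t = t' := by
  cases i <;> simp [mkPair, and_comm]

theorem exists_eq_mkPair {I A : Type*} (i : Player) (p : SeqPair I A) :
    ∃ s t, p = mkPair i s t := by
  cases i
  · exact ⟨p.1, p.2, rfl⟩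
  · exact ⟨p.2, p.1, rfl⟩

/-- Read as paths from the root, two nodes are comparable or part at a last common node `x` by
different actions. This is where two paths get compared in `no_disjoint_connections`. -/
theorem List.suffix_or_suffix_or_diverge {α : Type*} (l₁ l₂ : List α) :
    l₁ <:+ l₂ ∨ l₂ <:+ l₁ ∨ ∃ x c₁ c₂, c₁ ≠ c₂ ∧ c₁ :: x <:+ l₁ ∧ c₂ :: x <:+ l₂ := by
  induction l₁ with
  | nil => exact Or.inl (List.nil_suffix)
  | cons a l ih =>
    rcases ih with h | h | ⟨x, c₁, c₂, hne, h₁, h₂⟩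
    · rcases h with ⟨r, rfl⟩
      rcases List.eq_nil_or_concat r with rfl | ⟨r', b, rfl⟩
      · exact Or.inr (Or.inl (by simp))
      · by_cases hab : a = b
        · exact Or.inl ⟨r', by simp [hab]⟩
        · exact Or.inr (Or.inr ⟨l, a, b, hab, List.suffix_rfl, ⟨r', by simp⟩⟩)
    · exact Or.inr (Or.inl (h.trans (List.suffix_cons a l)))
    · exact Or.inr (Or.inr ⟨x, c₁, c₂, hne, h₁.trans (List.suffix_cons a l), h₂⟩)

theorem List.IsSuffix.eq_or_cons {α : Type*} {l₁ l₂ : List α} (h : l₁ <:+ l₂) :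
    l₁ = l₂ ∨ ∃ a, a :: l₁ <:+ l₂ := by
  rcases h with ⟨r, rfl⟩
  rcases List.eq_nil_or_concat r with rfl | ⟨r', b, rfl⟩
  · simp
  · exact Or.inr ⟨b, r', by simp⟩

namespace EFG

variable {I A : Type*} {G : EFG I A}

theorem mem_nodes_of_suffix {u v : List A} (h : u <:+ v) (hv : v ∈ G.nodes) : u ∈ G.nodes := by
  induction v with
  | nil => rw [List.suffix_nil.1 h]; exact hv
  | cons a v ih =>
    rcases List.suffix_cons_iff.1 h with rfl | h
    · exact hv
    · obtain ⟨J, hJ, -⟩ := (G.cons_mem_iff a v).1 hv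
      exact ih h (G.infoset_mem v J hJ)

theorem exists_infoset_of_cons_suffix {a : A} {u v : List A} (h : a :: u <:+ v)
    (hv : v ∈ G.nodes) : ∃ J, G.infoset u = some J ∧ a ∈ G.actions J :=
  (G.cons_mem_iff a u).1 (mem_nodes_of_suffix h hv)

/-- The most recent own pair marks the last own node on the path, and what is left of the history is
the history at that node. -/
theorem exists_of_ownHistory_eq_cons {i : Player} {u : List A} {K : I} {a : A}
    {r : List (I × A)} (h : G.ownHistory i u = (K, a) :: r) :
    ∃ v, a :: v <:+ u ∧ G.infoset v = some K ∧ G.player K = i ∧ G.ownHistory i v = r := by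
  induction u with
  | nil => simp [ownHistory] at h
  | cons b u ih =>
    have lift : G.ownHistory i u = (K, a) :: r →
        ∃ v, a :: v <:+ b :: u ∧ G.infoset v = some K ∧ G.player K = i ∧
          G.ownHistory i v = r := fun h' => by
      obtain ⟨v, hv, hr⟩ := ih h'
      exact ⟨v, hv.trans (List.suffix_cons b u), hr⟩
    rw [ownHistory] at h
    split at h
    · split_ifs at h with hi
      · simp only [List.cons.injEq, Prod.mk.injEq] at h
        obtain ⟨⟨rfl, rfl⟩, rfl⟩ := h
        exact ⟨u, List.suffix_rfl, by assumption, hi, rfl⟩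
      · exact lift h
    · exact lift h

theorem ownHistory_suffix {i : Player} {u v : List A} (h : u <:+ v) :
    G.ownHistory i u <:+ G.ownHistory i v := by
  induction v with
  | nil => rw [List.suffix_nil.1 h]
  | cons b v ih =>
    rcases List.suffix_cons_iff.1 h with rfl | h
    · exact List.suffix_rfl
    · refine (ih h).trans ?_
      rw [ownHistory]
      split
      · split_ifs
        · exact List.suffix_cons _ _
        · exact List.suffix_rfl
      · exact List.suffix_rfl

theorem ownHistory_cons_of_player {i : Player} {a : A} {u : List A} {J : I}
    (hJ : G.infoset u = some J) (hi : G.player J = i) :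
    G.ownHistory i (a :: u) = (J, a) :: G.ownHistory i u := by
  simp [ownHistory, hJ, hi]

theorem cons_ownHistory_suffix {i : Player} {a : A} {u v : List A} {J : I}
    (h : a :: u <:+ v) (hJ : G.infoset u = some J) (hi : G.player J = i) :
    (J, a) :: G.ownHistory i u <:+ G.ownHistory i v :=
  ownHistory_cons_of_player hJ hi ▸ ownHistory_suffix h

variable (G) in
/-- A node of an information set. -/
noncomputable def someNode (J : I) : List A := (G.infoset_nonempty J).choose

theorem infoset_someNode (J : I) : G.infoset (G.someNode J) = some J :=
  (G.infoset_nonempty J).choose_spec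

theorem someNode_mem (J : I) : G.someNode J ∈ G.nodes := G.infoset_mem _ _ (infoset_someNode J)

variable (G) in
/-- The history of own pairs at an information set, the most recent pair first. -/
noncomputable def hist (J : I) : List (I × A) := G.ownHistory (G.player J) (G.someNode J)

theorem parentSeq_eq_head? (J : I) : G.parentSeq J = (G.hist J).head? := rfl

theorem PerfectRecall.ownHistory_eq (hG : G.PerfectRecall) {J : I} {u : List A}
    (hu : G.infoset u = some J) : G.ownHistory (G.player J) u = G.hist J :=
  hG J _ _ hu (infoset_someNode J)

variable (G) in
/-- The chain of all nonempty ancestors of a sequence, starting with the sequence itself. -/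
noncomputable def chain : Sequence I A → List (I × A)
  | none => []
  | some (J, a) => (J, a) :: G.hist J

@[simp] theorem chain_none : G.chain none = [] := rfl

@[simp] theorem chain_some (J : I) (a : A) : G.chain (some (J, a)) = (J, a) :: G.hist J := rfl

theorem head?_chain (σ : Sequence I A) : (G.chain σ).head? = σ := by
  rcases σ with _ | ⟨J, a⟩ <;> rfl

theorem chain_inj {σ τ : Sequence I A} (h : G.chain σ = G.chain τ) : σ = τ := by
  rw [← head?_chain (G := G) σ, h, head?_chain]

/-- The node where the last own action was taken lies in the information set of that pair, so
perfect recall there identifies the rest of the history with `hist`. -/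
theorem PerfectRecall.chain_parentSeq (hG : G.PerfectRecall) (J : I) :
    G.chain (G.parentSeq J) = G.hist J := by
  rw [parentSeq_eq_head?]
  rcases h : G.hist J with _ | ⟨⟨K, a⟩, r⟩
  · rfl
  · obtain ⟨v, -, hv, hp, hr⟩ := exists_of_ownHistory_eq_cons h
    rw [← hp, hG.ownHistory_eq hv] at hr
    simp [hr]

/-- `parentSeq` looks at one chosen node only; perfect recall transfers what it says to all nodes of
`J`. -/
theorem PerfectRecall.parentSeq_spec (hG : G.PerfectRecall) {J K : I} {a : A}
    (h : G.parentSeq J = some (K, a)) : G.player K = G.player J ∧ a ∈ G.actions K ∧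
      ∀ u, G.infoset u = some J → ∃ v, G.infoset v = some K ∧ a :: v <:+ u := by
  have hc := hG.chain_parentSeq J
  rw [h] at hc
  have key : ∀ u, G.infoset u = some J →
      ∃ v, a :: v <:+ u ∧ G.infoset v = some K ∧ G.player K = G.player J ∧
        G.ownHistory (G.player J) v = G.hist K := fun u hu =>
    exists_of_ownHistory_eq_cons (by rw [hG.ownHistory_eq hu, ← hc]; rfl)
  obtain ⟨v, hv, hK, hp, -⟩ := key _ (infoset_someNode J)
  obtain ⟨K', hK', ha⟩ := exists_infoset_of_cons_suffix hv (someNode_mem J)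
  obtain rfl : K = K' := by simpa [hK] using hK'
  refine ⟨hp, ha, fun u hu => ?_⟩
  obtain ⟨v, hv, hK, -⟩ := key u hu
  exact ⟨v, hK, hv⟩

theorem PerfectRecall.isSequence_parentSeq (hG : G.PerfectRecall) (J : I) :
    G.IsSequence (G.player J) (G.parentSeq J) := by
  rcases h : G.parentSeq J with _ | ⟨K, a⟩
  · trivial
  · exact ⟨(hG.parentSeq_spec h).1, (hG.parentSeq_spec h).2.1⟩

/-- Replaces the inductively defined order by the suffix order on lists, where antisymmetry,
comparability of ancestors and lengths are at hand. -/
theorem PerfectRecall.descends_iff (hG : G.PerfectRecall) {τ τ' : Sequence I A} :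
    G.Descends τ τ' ↔ G.chain τ' <:+ G.chain τ := by
  constructor
  · intro h
    induction h with
    | refl => exact List.suffix_rfl
    | step J a τ _ ih =>
      rw [hG.chain_parentSeq] at ih
      exact ih.trans (List.suffix_cons _ _)
  · intro h
    generalize hn : (G.chain τ).length = n
    induction n generalizing τ with
    | zero =>
      rw [List.length_eq_zero_iff.1 hn, List.suffix_nil, ← List.length_eq_zero_iff] at h
      rw [chain_inj ((List.length_eq_zero_iff.1 hn).trans (List.length_eq_zero_iff.1 h).symm)]
      exact .refl _
    | succ n ih =>
      rcases τ with _ | ⟨J, a⟩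
      · simp at hn
      · rw [chain_some, List.suffix_cons_iff] at h
        rcases h with h | h
        · rw [chain_inj (h.trans (chain_some J a).symm)]
          exact .refl _
        · rw [← hG.chain_parentSeq] at h
          exact .step J a _ (ih h (by rw [hG.chain_parentSeq]; simpa using hn))

theorem PerfectRecall.descends_trans (hG : G.PerfectRecall) {σ τ υ : Sequence I A}
    (h₁ : G.Descends σ τ) (h₂ : G.Descends τ υ) : G.Descends σ υ := by
  rw [hG.descends_iff] at *
  exact h₂.trans h₁

theorem PerfectRecall.descends_antisymm (hG : G.PerfectRecall) {σ τ : Sequence I A}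
    (h₁ : G.Descends σ τ) (h₂ : G.Descends τ σ) : σ = τ := by
  rw [hG.descends_iff] at *
  exact chain_inj (h₂.eq_of_length_le h₁.length_le)

theorem PerfectRecall.descends_none (hG : G.PerfectRecall) (σ : Sequence I A) :
    G.Descends σ none := by
  rw [hG.descends_iff]
  exact List.nil_suffix

theorem descends_some_iff {J : I} {a : A} {τ : Sequence I A} :
    G.Descends (some (J, a)) τ ↔ τ = some (J, a) ∨ G.Descends (G.parentSeq J) τ := by
  constructor
  · rintro (_ | ⟨_, _, _, h⟩)
    · exact Or.inl rfl
    · exact Or.inr h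
  · rintro (rfl | h)
    · exact .refl _
    · exact .step _ _ _ h

theorem descends_none_iff {τ : Sequence I A} : G.Descends none τ ↔ τ = none := by
  constructor
  · rintro (_ | _)
    rfl
  · rintro rfl
    exact .refl _

theorem descends_some_parentSeq (J : I) (a : A) : G.Descends (some (J, a)) (G.parentSeq J) :=
  .step _ _ _ (.refl _)

theorem PerfectRecall.not_descends_some (hG : G.PerfectRecall) (J : I) (a : A) :
    ¬ G.Descends (G.parentSeq J) (some (J, a)) := by
  rw [hG.descends_iff, hG.chain_parentSeq, chain_some]
  intro h
  simpa using h.length_le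

theorem PerfectRecall.parentSeq_ne_some (hG : G.PerfectRecall) (J : I) (a : A) :
    G.parentSeq J ≠ some (J, a) := fun h =>
  hG.not_descends_some J a (h ▸ .refl _)

/-- The child of `s` from which a strict descendant of `s` descends. -/
theorem PerfectRecall.exists_child (hG : G.PerfectRecall) {σ s : Sequence I A}
    (h : G.Descends σ s) (hne : σ ≠ s) :
    ∃ J a, G.parentSeq J = s ∧ G.Descends σ (some (J, a)) := by
  rw [hG.descends_iff] at h
  rcases h.eq_or_cons with h | ⟨⟨J, a⟩, h⟩
  · exact absurd (chain_inj h).symm hne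
  · have hJ : G.hist J = G.chain s := by
      rcases hs : σ with _ | ⟨K, b⟩
      · simp [hs] at h
      · rw [hs, chain_some, List.suffix_cons_iff] at h
        rcases h with h | h
        · simp only [List.cons.injEq, Prod.mk.injEq] at h
          rw [h.1.1, h.2]
        · have : ∃ v, G.ownHistory (G.player K) v = (J, a) :: G.chain s := by
            obtain ⟨r, hr⟩ := h
            clear hs hne
            -- Removing the most recent pair leaves the history at an earlier node; repeating this
            -- strips off `r`.
            have main : ∀ (r : List (I × A)) (i : Player) (v : List A),
                G.ownHistory i v = r ++ (J, a) :: G.chain s →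
                ∃ v, G.ownHistory i v = (J, a) :: G.chain s := by
              intro r i
              induction r with
              | nil => exact fun v hv => ⟨v, hv⟩
              | cons x r ih =>
                intro v hv
                obtain ⟨w, -, -, -, hw⟩ := exists_of_ownHistory_eq_cons hv
                exact ih w hw
            exact main r _ _ hr.symm
          obtain ⟨v, hv⟩ := this
          obtain ⟨w, -, hw, hp, hr⟩ := exists_of_ownHistory_eq_cons hv
          rw [← hp, hG.ownHistory_eq hw] at hr
          exact hr
    refine ⟨J, a, chain_inj ((hG.chain_parentSeq J).trans hJ), ?_⟩
    rw [hG.descends_iff, chain_some, hJ]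
    exact h

/-- Both candidates are suffixes of the chain of `σ`, and their chains have the same length because
the parents agree. Hence subtrees of different children are disjoint. -/
theorem PerfectRecall.child_unique (hG : G.PerfectRecall) {σ : Sequence I A} {J J' : I} {a a' : A}
    (hJ : G.parentSeq J = G.parentSeq J') (h : G.Descends σ (some (J, a)))
    (h' : G.Descends σ (some (J', a'))) : J = J' ∧ a = a' := by
  rw [hG.descends_iff] at h h'
  have hl : (G.chain (some (J, a))).length = (G.chain (some (J', a'))).length := by
    simp [← hG.chain_parentSeq, hJ]
  have : G.chain (some (J, a)) = G.chain (some (J', a')) := by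
    rcases List.suffix_or_suffix_of_suffix h h' with h | h
    · exact h.eq_of_length hl
    · exact (h.eq_of_length hl.symm).symm
  simpa using chain_inj this

theorem PerfectRecall.isSequence_of_descends (hG : G.PerfectRecall) {i : Player}
    {σ τ : Sequence I A} (h : G.Descends σ τ) (hσ : G.IsSequence i σ) : G.IsSequence i τ := by
  induction h with
  | refl => exact hσ
  | step J a τ _ ih => exact ih (hσ.1 ▸ hG.isSequence_parentSeq J)

theorem connected_comm {J K : I} : G.Connected J K ↔ G.Connected K J := by
  constructor <;> rintro ⟨u, v, hu, hv, h⟩ <;> exact ⟨v, u, hv, hu, h.symm⟩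

/-- An own node `w` above `u` stays comparable with every node `v` that is comparable with `u`, so
connections are inherited by ancestors. -/
theorem PerfectRecall.seqInfosetRelevant_of_descends (hG : G.PerfectRecall) {σ τ : Sequence I A}
    {K : I} (h : G.Descends σ τ) (hσ : G.SeqInfosetRelevant σ K) : G.SeqInfosetRelevant τ K := by
  induction h with
  | refl => exact hσ
  | step J a τ _ ih =>
    refine ih ?_
    rcases h : G.parentSeq J with _ | ⟨J', a'⟩
    · trivial
    · obtain ⟨u, v, hu, hv, huv⟩ := hσ
      obtain ⟨w, hw, hwu⟩ := (hG.parentSeq_spec h).2.2 u hu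
      have hwu := (List.suffix_cons a' w).trans hwu
      refine ⟨w, v, hw, hv, ?_⟩
      rcases huv with huv | huv
      · exact Or.inl (hwu.trans huv)
      · exact List.suffix_or_suffix_of_suffix hwu huv


end EFG

/-! ### Relevant pairs, from the point of view of either player -/

namespace EFG

variable {I A : Type*} {G : EFG I A}

/-- A form of relevance with a variable player `i`, so that the two cases of the algorithm are
treated at once. -/
theorem relevant_mkPair {i : Player} {s t : Sequence I A} :
    G.Relevant (mkPair i s t) ↔ G.IsSequence i s ∧ G.IsSequence i.opp t ∧
      ∀ J a, s = some (J, a) → G.SeqInfosetRelevant t J := by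
  have key : (∀ J a, s = some (J, a) → G.SeqInfosetRelevant t J) ↔
      ∀ J a K b, s = some (J, a) → t = some (K, b) → G.Connected J K := by
    constructor
    · rintro h J a K b hs rfl
      exact connected_comm.1 (h J a hs)
    · intro h J a hs
      rcases t with _ | ⟨K, b⟩
      · trivial
      · exact connected_comm.1 (h J a K b hs rfl)
  rw [key]
  cases i
  · rfl
  · constructor
    · rintro ⟨h₁, h₂, h⟩
      exact ⟨h₂, h₁, fun J a K b hJ hK => connected_comm.1 (h K b J a hK hJ)⟩
    · rintro ⟨h₁, h₂, h⟩
      exact ⟨h₂, h₁, fun J a K b hJ hK => connected_comm.1 (h K b J a hK hJ)⟩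

theorem relevant_some_left {i : Player} {J : I} {a : A} {t : Sequence I A}
    (hJ : G.player J = i) (ha : a ∈ G.actions J) (ht : G.IsSequence i.opp t)
    (h : G.SeqInfosetRelevant t J) : G.Relevant (mkPair i (some (J, a)) t) := by
  refine relevant_mkPair.2 ⟨⟨hJ, ha⟩, ht, fun J' a' h' => ?_⟩
  simp only [Option.some.injEq, Prod.mk.injEq] at h'
  exact h'.1 ▸ h

theorem relevant_some_right {i : Player} {K : I} {b : A} {s : Sequence I A}
    (hK : G.player K = i.opp) (hb : b ∈ G.actions K) (hs : G.IsSequence i s)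
    (h : G.SeqInfosetRelevant s K) : G.Relevant (mkPair i s (some (K, b))) := by
  rw [← mkPair_opp]
  exact relevant_some_left hK hb (by simpa using hs) h

theorem seqInfosetRelevant_left {i : Player} {J : I} {a : A} {t : Sequence I A}
    (h : G.Relevant (mkPair i (some (J, a)) t)) : G.SeqInfosetRelevant t J :=
  (relevant_mkPair.1 h).2.2 J a rfl

theorem seqInfosetRelevant_right {i : Player} {K : I} {b : A} {s : Sequence I A}
    (h : G.Relevant (mkPair i s (some (K, b)))) : G.SeqInfosetRelevant s K := by
  rw [← mkPair_opp] at h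
  exact (relevant_mkPair.1 h).2.2 K b rfl

theorem PerfectRecall.relevant_of_descends_right (hG : G.PerfectRecall) {i : Player}
    {s t t' : Sequence I A} (h : G.Relevant (mkPair i s t)) (ht : G.Descends t t') :
    G.Relevant (mkPair i s t') := by
  rw [relevant_mkPair] at *
  exact ⟨h.1, hG.isSequence_of_descends ht h.2.1, fun J a hJ =>
    hG.seqInfosetRelevant_of_descends ht (h.2.2 J a hJ)⟩

theorem PerfectRecall.relevant_of_descends (hG : G.PerfectRecall) {i : Player}
    {s s' t t' : Sequence I A} (h : G.Relevant (mkPair i s t)) (hs : G.Descends s s')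
    (ht : G.Descends t t') : G.Relevant (mkPair i s' t') := by
  have := hG.relevant_of_descends_right h ht
  rw [← mkPair_opp] at *
  exact hG.relevant_of_descends_right this hs

/-! ### Critical players -/

/-- If `u` came strictly before `u'`, the history at `u'` would contain that at `u` and the pair at
`J` as well; but equal parent sequences force equal histories. -/
theorem PerfectRecall.not_suffix (hG : G.PerfectRecall) {J J' : I} {u u' : List A}
    (hu : G.infoset u = some J) (hu' : G.infoset u' = some J') (hp : G.player J = G.player J')
    (hs : G.parentSeq J = G.parentSeq J') (hne : J ≠ J') : ¬ u <:+ u' := by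
  intro h
  rcases h.eq_or_cons with rfl | ⟨a, h⟩
  · rw [hu] at hu'
    exact hne (by simpa using hu')
  · have := cons_ownHistory_suffix h hu hp
    rw [← hp, hG.ownHistory_eq hu, hp, hG.ownHistory_eq hu', ← hG.chain_parentSeq J',
      ← hs, hG.chain_parentSeq] at this
    simpa using this.length_le

/-- The actions `c` and `c'` at the branching node are recorded in the histories at `J` and at `J'`,
directly above the same remainder. These histories coincide, since the parent sequences do. -/
theorem PerfectRecall.not_diverge (hG : G.PerfectRecall) {J J' X : I} {u u' w w' x : List A}
    {c c' : A} (hu : G.infoset u = some J) (hu' : G.infoset u' = some J')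
    (hp : G.player J = G.player J') (hs : G.parentSeq J = G.parentSeq J') (hne : J ≠ J')
    (huw : u <:+ w) (huw' : u' <:+ w') (hx : G.infoset x = some X) (hX : G.player X = G.player J)
    (hc : c :: x <:+ w) (hc' : c' :: x <:+ w') : c = c' := by
  -- The branching happens above `v`: otherwise `v` would lie on the common part of the two paths,
  -- hence on the path to `w'`, and would be comparable with `v'`.
  have aux : ∀ {v v' w w' : List A} {d d' : A}, v <:+ w → v' <:+ w' → ¬ v <:+ v' → ¬ v' <:+ v →
      d :: x <:+ w → d' :: x <:+ w' → d :: x <:+ v := by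
    intro v v' w w' d d' hv hv' h₁ h₂ hd hd'
    rcases List.suffix_or_suffix_of_suffix hv hd with h | h
    · rcases List.suffix_cons_iff.1 h with rfl | h
      · exact List.suffix_rfl
      · have hvw' := h.trans ((List.suffix_cons d' x).trans hd')
        rcases List.suffix_or_suffix_of_suffix hvw' hv' with h | h
        · exact absurd h h₁
        · exact absurd h h₂
    · exact h
  have n₁ := hG.not_suffix hu hu' hp hs hne
  have n₂ := hG.not_suffix hu' hu hp.symm hs.symm hne.symm
  have h₁ := cons_ownHistory_suffix (aux huw huw' n₁ n₂ hc hc') hx hX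
  have h₂ := cons_ownHistory_suffix (aux huw' huw n₂ n₁ hc' hc) hx hX
  rw [hG.ownHistory_eq hu] at h₁
  rw [hp, hG.ownHistory_eq hu', ← hG.chain_parentSeq J', ← hs, hG.chain_parentSeq, ← hp] at h₂
  have : (X, c) :: G.ownHistory (G.player J) x = (X, c') :: G.ownHistory (G.player J) x := by
    rcases List.suffix_or_suffix_of_suffix h₁ h₂ with h | h
    · exact h.eq_of_length (by simp)
    · exact (h.eq_of_length (by simp)).symm
  simpa using this

/-- Each connection lies on the path to a single node, `w` or `w'`. Nested paths would make the
nodes of `J` and `J'` comparable. At a separation the acting player owns either `J`, `J'` or `K`,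
`K'`, and `not_diverge` applies to that pair. -/
theorem PerfectRecall.no_disjoint_connections (hG : G.PerfectRecall) {i : Player} {J J' K K' : I}
    (hJ : G.player J = i) (hJ' : G.player J' = i) (hK : G.player K = i.opp)
    (hK' : G.player K' = i.opp) (hs : G.parentSeq J = G.parentSeq J')
    (ht : G.parentSeq K = G.parentSeq K') (hneJ : J ≠ J') (hneK : K ≠ K')
    (h : G.Connected J K) (h' : G.Connected J' K') : False := by
  have deeper : ∀ {J K : I}, G.Connected J K → ∃ u v w, G.infoset u = some J ∧
      G.infoset v = some K ∧ u <:+ w ∧ v <:+ w ∧ w ∈ G.nodes := by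
    rintro J K ⟨u, v, hu, hv, h | h⟩
    · exact ⟨u, v, v, hu, hv, h, List.suffix_rfl, G.infoset_mem _ _ hv⟩
    · exact ⟨u, v, u, hu, hv, List.suffix_rfl, h, G.infoset_mem _ _ hu⟩
  obtain ⟨u, v, w, hu, hv, huw, hvw, hw⟩ := deeper h
  obtain ⟨u', v', w', hu', hv', huw', hvw', -⟩ := deeper h'
  have hp : G.player J = G.player J' := hJ.trans hJ'.symm
  have n₁ := hG.not_suffix hu hu' hp hs hneJ
  have n₂ := hG.not_suffix hu' hu hp.symm hs.symm hneJ.symm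
  rcases List.suffix_or_suffix_or_diverge w w' with hww | hww | ⟨x, c, c', hc, hcw, hcw'⟩
  · exact (List.suffix_or_suffix_of_suffix (huw.trans hww) huw').elim n₁ n₂
  · exact (List.suffix_or_suffix_of_suffix huw (huw'.trans hww)).elim n₁ n₂
  · obtain ⟨X, hX, -⟩ := exists_infoset_of_cons_suffix hcw hw
    rcases Player.eq_or_eq_opp (G.player X) i with hi | hi
    · exact hc (hG.not_diverge hu hu' hp hs hneJ huw huw' hX (hi.trans hJ.symm) hcw hcw')
    · exact hc (hG.not_diverge hv hv' (hK.trans hK'.symm) ht hneK hvw hvw' hX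
        (hi.trans hK.symm) hcw hcw')

/-- At every pair of sequences, at least one of the players is critical. -/
theorem PerfectRecall.exists_critical_player (hG : G.PerfectRecall) (i : Player)
    (s t : Sequence I A) :
    (∀ J J', G.Critical i s t J → G.Critical i s t J' → J = J') ∨
      ∀ K K', G.Critical i.opp t s K → G.Critical i.opp t s K' → K = K' := by
  by_contra! hcon
  obtain ⟨⟨J₁, J₂, ⟨hJ₁, hs₁, L₁, hL₁, ht₁, hc₁⟩, ⟨hJ₂, hs₂, L₂, hL₂, ht₂, hc₂⟩, hJ⟩,
    ⟨K₁, K₂, ⟨hK₁, hu₁, M₁, hM₁, hv₁, hd₁⟩, ⟨hK₂, hu₂, M₂, hM₂, hv₂, hd₂⟩, hK⟩⟩ := hcon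
  simp only [Player.opp_opp] at hM₁ hM₂
  -- Two connections with different ends on the side of `i` share their other end.
  have edge : ∀ {J J' K K' : I}, G.player J = i → G.player J' = i → G.player K = i.opp →
      G.player K' = i.opp → G.parentSeq J = s → G.parentSeq J' = s → G.parentSeq K = t →
      G.parentSeq K' = t → G.Connected J K → G.Connected J' K' → J ≠ J' → K = K' :=
    fun h₁ h₂ h₃ h₄ h₅ h₆ h₇ h₈ h h' hne => by
      by_contra hK
      exact hG.no_disjoint_connections h₁ h₂ h₃ h₄ (h₅.trans h₆.symm) (h₇.trans h₈.symm) hne hK h h'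
  obtain rfl := edge hJ₁ hJ₂ hL₁ hL₂ hs₁ hs₂ ht₁ ht₂ hc₁ hc₂ hJ
  -- `J₁` and `J₂` are both joined to `L₁`, and any other edge can be compared with one of these
  -- two; so all edges end in `L₁`, against `K₁ ≠ K₂`.
  have main : ∀ K M, G.player K = i.opp → G.parentSeq K = t → G.player M = i →
      G.parentSeq M = s → G.Connected K M → K = L₁ := by
    intro K M hK ht hM hs hc
    by_cases h : M = J₁
    · exact edge hM hJ₂ hK hL₁ hs hs₂ ht ht₁ (connected_comm.1 hc) hc₂ (h ▸ hJ)
    · exact edge hM hJ₁ hK hL₁ hs hs₁ ht ht₁ (connected_comm.1 hc) hc₁ h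
  exact hK ((main K₁ M₁ hK₁ hu₁ hM₁ hv₁ hd₁).trans (main K₂ M₂ hK₂ hu₂ hM₂ hv₂ hd₂).symm)

/-! ### Finiteness -/

theorem someNode_injective : Function.Injective G.someNode := fun J K h => by
  have := infoset_someNode (G := G) J
  rw [h, infoset_someNode] at this
  exact (by simpa using this : K = J).symm

theorem finite_infosets (G : EFG I A) : Finite I :=
  Finite.of_injective (fun J : I => (⟨G.someNode J, someNode_mem J⟩ : G.nodes)) fun J K h =>
    someNode_injective (by simpa using h)

theorem card_infosets_le (G : EFG I A) : Nat.card I ≤ G.nodes.card := by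
  have := Nat.card_le_card_of_injective
    (fun J : I => (⟨G.someNode J, someNode_mem J⟩ : G.nodes)) fun J K h =>
      someNode_injective (by simpa using h)
  simpa using this

theorem length_ownHistory_le (i : Player) (u : List A) :
    (G.ownHistory i u).length ≤ u.length := by
  induction u with
  | nil => simp [ownHistory]
  | cons a u ih =>
    rw [ownHistory]
    split
    · split_ifs <;> simp only [List.length_cons] <;> omega
    · simp only [List.length_cons]
      omega

/-- The node and its ancestors have the pairwise different lengths `0, …, u.length`. -/
theorem length_lt_card_nodes {u : List A} (hu : u ∈ G.nodes) : u.length < G.nodes.card := by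
  have : (Finset.range (u.length + 1)).card ≤ G.nodes.card :=
    Finset.card_le_card_of_injOn (fun n => u.drop n)
      (fun n _ => mem_nodes_of_suffix (List.drop_suffix n u) hu) fun n hn n' hn' h => by
        have := congrArg List.length h
        simp only [Finset.coe_range, Set.mem_Iio, List.length_drop] at hn hn' this
        omega
  simpa using this

variable (G) in
/-- A node at which a sequence ends. -/
noncomputable def seqNode : Sequence I A → List A
  | none => []
  | some (J, a) => a :: G.someNode J

theorem seqNode_mem {i : Player} {σ : Sequence I A} (h : G.IsSequence i σ) :
    G.seqNode σ ∈ G.nodes := by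
  rcases σ with _ | ⟨J, a⟩
  · exact G.root_mem
  · exact (G.cons_mem_iff _ _).2 ⟨J, infoset_someNode J, h.2⟩

theorem seqNode_injective : Function.Injective G.seqNode := by
  rintro (_ | ⟨J, a⟩) (_ | ⟨K, b⟩) h
  · rfl
  · simp [seqNode] at h
  · simp [seqNode] at h
  · simp only [seqNode, List.cons.injEq] at h
    rw [h.1, someNode_injective h.2]

variable (G) in
/-- Relevant pairs embed into pairs of nodes. -/
noncomputable def pairNode (p : G.RelevantPair) : G.nodes × G.nodes :=
  (⟨G.seqNode p.1.1, seqNode_mem p.2.1⟩, ⟨G.seqNode p.1.2, seqNode_mem p.2.2.1⟩)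

theorem pairNode_injective : Function.Injective G.pairNode := fun p q h => by
  simp only [pairNode, Prod.mk.injEq, Subtype.mk.injEq] at h
  exact Subtype.ext (Prod.ext (seqNode_injective h.1) (seqNode_injective h.2))

instance finite_relevantPair : Finite G.RelevantPair :=
  Finite.of_injective _ (pairNode_injective (G := G))

theorem card_relevantPair_le : Nat.card G.RelevantPair ≤ G.nodes.card ^ 2 := by
  refine (Nat.card_le_card_of_injective _ (pairNode_injective (G := G))).trans ?_
  simp [sq]

end EFG

/-! ## What one call of the algorithm fills in -/

open Classical in
theorem IsActionOrder.sum_map {I A : Type*} {G : EFG I A} {ord : I → List A}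
    (h : IsActionOrder G ord) (J : I) (f : A → ℝ) :
    ((ord J).map f).sum = ∑ a ∈ G.actions J, f a := by
  rw [← List.sum_toFinset f (h J).1]
  congr 1
  ext a
  simp [(h J).2 a]

namespace EFG

variable {I A : Type*} (G : EFG I A)

/-- The relevant pairs strictly below a pair. -/
def below (p : SeqPair I A) : Set (SeqPair I A) :=
  {q | G.Relevant q ∧ G.Descends q.1 p.1 ∧ G.Descends q.2 p.2 ∧ q ≠ p}

theorem below_finite (p : SeqPair I A) : (G.below p).Finite :=
  (Set.finite_coe_iff.1 (finite_relevantPair (G := G))).subset fun _ hq => hq.1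

/-- The relevant pairs strictly below a pair, listed in some order. -/
noncomputable def belowList (p : SeqPair I A) : List (SeqPair I A) :=
  (G.below_finite p).toFinset.toList

/-- The constraints of player `i` on correlation plans, below the pair in which player `i` has the
sequence `s` and the opponent has `t`. -/
def OwnConstraints (f : SeqPair I A → ℝ) (i : Player) (s t : Sequence I A) : Prop :=
  ∀ J σ, G.player J = i → G.IsSequence i.opp σ → G.SeqInfosetRelevant σ J →
    G.Descends (G.parentSeq J) s → G.Descends σ t →
    ∑ a ∈ G.actions J, f (mkPair i (some (J, a)) σ) = f (mkPair i (G.parentSeq J) σ)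

variable {G}

theorem mem_belowList {p q : SeqPair I A} : q ∈ G.belowList p ↔ q ∈ G.below p := by
  simp [belowList]

theorem nodup_belowList (p : SeqPair I A) : (G.belowList p).Nodup := Finset.nodup_toList _

theorem mkPair_mem_below {i : Player} {s t s' t' : Sequence I A} :
    mkPair i s' t' ∈ G.below (mkPair i s t) ↔ G.Relevant (mkPair i s' t') ∧ G.Descends s' s ∧
      G.Descends t' t ∧ ¬ (s' = s ∧ t' = t) := by
  rw [← mkPair_inj (i := i)]
  cases i
  · rfl
  · constructor <;> exact fun ⟨h₁, h₂, h₃, h₄⟩ => ⟨h₁, h₃, h₂, h₄⟩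

theorem OwnConstraints.mono (hG : G.PerfectRecall) {f : SeqPair I A → ℝ} {i : Player}
    {s t s' t' : Sequence I A} (h : G.OwnConstraints f i s t) (hs : G.Descends s' s)
    (ht : G.Descends t' t) : G.OwnConstraints f i s' t' :=
  fun J σ h₁ h₂ h₃ h₄ h₅ =>
    h J σ h₁ h₂ h₃ (hG.descends_trans h₄ hs) (hG.descends_trans h₅ ht)

end EFG

/-! ### Meaning of the operations: entries filled in, entries read, equations, weight -/

namespace Operation

variable {I A : Type*} (G : EFG I A)

/-- The entries that an operation fills in. -/
noncomputable def fill : Operation I A → List (SeqPair I A)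
  | .call p => G.belowList p
  | .split _ new => new
  | .sum _ new => [new]

/-- The entries that an operation reads. -/
def needs : Operation I A → List (SeqPair I A)
  | .call p => [p]
  | .split source _ => [source]
  | .sum sources _ => sources

/-- Side conditions under which an operation makes sense. -/
def WellFormed : Operation I A → Prop
  | .call p => G.Relevant p
  | .split _ new => new ≠ []
  | .sum sources _ => sources.Nodup

/-- The constraints that an operation imposes on the entries. -/
def Equations (f : SeqPair I A → ℝ) : Operation I A → Prop
  | .call p => (∀ q ∈ G.below p, 0 ≤ f q) ∧ G.OwnConstraints f .one p.1 p.2 ∧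
      G.OwnConstraints f .two p.2 p.1
  | .split source new => (∀ q ∈ new, 0 ≤ f q) ∧ (new.map f).sum = f source
  | .sum sources new => f new = (sources.map f).sum

/-- An upper bound for the number of steps that it takes to perform an operation. -/
noncomputable def weight : Operation I A → ℕ
  | .call p => 2 * (G.belowList p).length + 1
  | .split _ _ => 1
  | .sum _ _ => 1

variable {G}

theorem equations_call_mkPair {f : SeqPair I A → ℝ} {i : Player} {s t : Sequence I A} :
    (Operation.call (mkPair i s t)).Equations G f ↔ (∀ q ∈ G.below (mkPair i s t), 0 ≤ f q) ∧
      G.OwnConstraints f i s t ∧ G.OwnConstraints f i.opp t s := by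
  cases i
  · rfl
  · exact and_congr_right fun _ => and_comm

theorem Equations.call_mono (hG : G.PerfectRecall) {f : SeqPair I A → ℝ} {i : Player}
    {s t s' t' : Sequence I A} (h : (Operation.call (mkPair i s t)).Equations G f)
    (hs : G.Descends s' s) (ht : G.Descends t' t) :
    (Operation.call (mkPair i s' t')).Equations G f := by
  rw [equations_call_mkPair] at *
  refine ⟨fun q hq => h.1 q ?_, h.2.1.mono hG hs ht, h.2.2.mono hG ht hs⟩
  obtain ⟨σ, τ, rfl⟩ := exists_eq_mkPair i q
  rw [EFG.mkPair_mem_below] at *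
  refine ⟨hq.1, hG.descends_trans hq.2.1 hs, hG.descends_trans hq.2.2.1 ht, ?_⟩
  rintro ⟨rfl, rfl⟩
  exact hq.2.2.2 ⟨hG.descends_antisymm hq.2.1 hs, hG.descends_antisymm hq.2.2.1 ht⟩

end Operation

/-- `Ready G S ts`: if the entries in `S` are filled in, then the operations `ts` can be performed
in turn, and each of them only reads entries that have been filled in before. -/
def Ready {I A : Type*} (G : EFG I A) : Set (SeqPair I A) → List (Operation I A) → Prop
  | _, [] => True
  | S, op :: ts => op.WellFormed G ∧ (∀ q ∈ op.needs, q ∈ S) ∧ Ready G (S ∪ {q | q ∈ op.fill G}) ts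

theorem Ready.mono {I A : Type*} {G : EFG I A} {ts : List (Operation I A)}
    {S T : Set (SeqPair I A)} (h : Ready G S ts) (hST : S ⊆ T) : Ready G T ts := by
  induction ts generalizing S T with
  | nil => trivial
  | cons op ts ih =>
    exact ⟨h.1, fun q hq => hST (h.2.1 q hq), ih h.2.2 (Set.union_subset_union_left _ hST)⟩

theorem ready_append {I A : Type*} {G : EFG I A} {ts us : List (Operation I A)}
    {S : Set (SeqPair I A)} :
    Ready G S (ts ++ us) ↔
      Ready G S ts ∧ Ready G (S ∪ {q | q ∈ ts.flatMap (Operation.fill G)}) us := by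
  induction ts generalizing S with
  | nil => simp [Ready]
  | cons op ts ih =>
    have : S ∪ {q | q ∈ op.fill G} ∪ {q | q ∈ ts.flatMap (Operation.fill G)} =
        S ∪ {q | q ∈ (op :: ts).flatMap (Operation.fill G)} := by
      ext q
      simp only [Set.mem_union, Set.mem_ofPred_eq, List.flatMap_cons, List.mem_append, or_assoc]
    rw [List.cons_append, Ready, ih, Ready, this, and_assoc, and_assoc]

/-- The induction runs from the right, since a block may read what all the blocks before it have
filled in. -/
theorem ready_flatMap {I A β : Type*} {G : EFG I A} {l : List β} {g : β → List (Operation I A)}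
    {S : Set (SeqPair I A)}
    (h : ∀ l₁ x l₂, l = l₁ ++ x :: l₂ →
      Ready G (S ∪ {q | q ∈ (l₁.flatMap g).flatMap (Operation.fill G)}) (g x)) :
    Ready G S (l.flatMap g) := by
  induction l using List.reverseRecOn with
  | nil => trivial
  | append_singleton l x ih =>
    rw [List.flatMap_append, ready_append]
    refine ⟨ih fun l₁ y l₂ hl => h l₁ y (l₂ ++ [x]) (by simp [hl]), ?_⟩
    simpa using h l x [] rfl

theorem ready_map {I A β : Type*} {G : EFG I A} {l : List β} {g : β → Operation I A}
    {S : Set (SeqPair I A)} (h₁ : ∀ x ∈ l, (g x).WellFormed G)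
    (h₂ : ∀ x ∈ l, ∀ q ∈ (g x).needs, q ∈ S) : Ready G S (l.map g) := by
  rw [List.map_eq_flatMap]
  refine ready_flatMap fun l₁ x l₂ hl => ?_
  have hx : x ∈ l := hl ▸ by simp
  exact ⟨h₁ x hx, fun q hq => Or.inl (h₂ x hx q hq), trivial⟩

/-- The choices made in one call: the critical player `i`, the critical information set `star` and
the orders of the two loops. -/
structure IsCallChoice {I A : Type*} (G : EFG I A) (i : Player) (s t : Sequence I A)
    (star : Option I) (Js Ks : List I) : Prop where
  star_iff : ∀ J, star = some J ↔ G.Critical i s t J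
  nodup_own : Js.Nodup
  mem_own : ∀ J, J ∈ Js ↔ G.player J = i ∧ G.parentSeq J = s ∧ G.SeqInfosetRelevant t J
  nodup_opp : Ks.Nodup
  mem_opp : ∀ K, K ∈ Ks ↔
    G.player K = i.opp ∧ G.Descends (G.parentSeq K) t ∧ G.SeqInfosetRelevant s K
  sorted : Ks.Pairwise fun J K =>
    ¬ (G.Descends (G.parentSeq J) (G.parentSeq K) ∧ G.parentSeq J ≠ G.parentSeq K)

/-- The list of the operations of a call. -/
noncomputable def callBody {I A : Type*} (G : EFG I A) (ord : I → List A) (i : Player)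
    (s t : Sequence I A) (star : Option I) (Js Ks : List I) : List (Operation I A) :=
  Js.flatMap (ownTasks ord i s t) ++ Ks.flatMap (opponentTasks G ord i s star)

theorem isBody_iff {I A : Type*} {G : EFG I A} {ord : I → List A} {p : SeqPair I A}
    {body : List (Operation I A)} :
    IsBody G ord p body ↔ ∃ i s t star Js Ks, p = mkPair i s t ∧
      IsCallChoice G i s t star Js Ks ∧ body = callBody G ord i s t star Js Ks := by
  constructor
  · rintro ⟨i, s, t, star, Js, Ks, h, h₁, h₂, h₃, h₄, h₅, h₆, h₇⟩
    exact ⟨i, s, t, star, Js, Ks, h, ⟨h₁, h₂, h₃, h₄, h₅, h₆⟩, h₇⟩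
  · rintro ⟨i, s, t, star, Js, Ks, h, ⟨h₁, h₂, h₃, h₄, h₅, h₆⟩, h₇⟩
    exact ⟨i, s, t, star, Js, Ks, h, h₁, h₂, h₃, h₄, h₅, h₆, h₇⟩

section Tasks

variable {I A : Type*} {G : EFG I A} {ord : I → List A} {i : Player} {s t : Sequence I A}
  {star : Option I}

theorem opponentTasks_of_connected {J K : I} (h : star = some J) (hJK : G.Connected J K) :
    opponentTasks G ord i s star K = (ord K).map fun b =>
      .sum ((ord J).map fun a => mkPair i (some (J, a)) (some (K, b)))
        (mkPair i s (some (K, b))) := by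
  subst h
  simp [opponentTasks, hJK]

theorem opponentTasks_of_not_connected {K : I} (h : ∀ J, star = some J → ¬ G.Connected J K) :
    opponentTasks G ord i s star K =
      [.split (mkPair i s (G.parentSeq K)) ((ord K).map fun b => mkPair i s (some (K, b)))] := by
  rcases star with _ | J
  · rfl
  · simp [opponentTasks, h J rfl]

theorem opponentTasks_cases (G : EFG I A) (star : Option I) (K : I) :
    (∃ J, star = some J ∧ G.Connected J K) ∨ ∀ J, star = some J → ¬ G.Connected J K := by
  by_cases h : ∃ J, star = some J ∧ G.Connected J K
  · exact Or.inl h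
  · exact Or.inr fun J hJ hJK => h ⟨J, hJ, hJK⟩

theorem fill_opponentTasks (K : I) :
    (opponentTasks G ord i s star K).flatMap (Operation.fill G) =
      (ord K).map fun b => mkPair i s (some (K, b)) := by
  rcases opponentTasks_cases G star K with ⟨J, hJ, hJK⟩ | h
  · rw [opponentTasks_of_connected hJ hJK, List.flatMap_map]
    exact (List.map_eq_flatMap ..).symm
  · rw [opponentTasks_of_not_connected h]
    simp [Operation.fill]

theorem fill_ownTasks (J : I) :
    (ownTasks ord i s t J).flatMap (Operation.fill G) =
      ((ord J).map fun a => mkPair i (some (J, a)) t) ++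
        (ord J).flatMap fun a => G.belowList (mkPair i (some (J, a)) t) := by
  simp [ownTasks, Operation.fill, List.flatMap_map]

/-- The split fills in the pair `((J, a), t)` itself, and the call everything strictly below it;
together they cover the whole subtree. -/
theorem mem_fill_ownTasks (hG : G.PerfectRecall) (hord : IsActionOrder G ord) {J : I}
    {σ τ : Sequence I A} (hJ : G.player J = i) (ht : G.IsSequence i.opp t) (htJ : G.SeqInfosetRelevant t J) :
    mkPair i σ τ ∈ (ownTasks ord i s t J).flatMap (Operation.fill G) ↔
      ∃ a, G.Relevant (mkPair i σ τ) ∧ G.Descends σ (some (J, a)) ∧ G.Descends τ t := by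
  simp only [fill_ownTasks, List.mem_append, List.mem_map, List.mem_flatMap, EFG.mem_belowList,
    EFG.mkPair_mem_below, mkPair_inj, (hord J).2]
  constructor
  · rintro (⟨a, ha, rfl, rfl⟩ | ⟨a, ha, h, h₁, h₂, -⟩)
    · exact ⟨a, EFG.relevant_some_left hJ ha ht htJ, .refl _, .refl _⟩
    · exact ⟨a, h, h₁, h₂⟩
  · rintro ⟨a, h, h₁, h₂⟩
    have ha : a ∈ G.actions J :=
      (EFG.relevant_mkPair.1 (hG.relevant_of_descends h h₁ h₂)).1.2
    by_cases heq : σ = some (J, a) ∧ τ = t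
    · exact Or.inl ⟨a, ha, heq.1.symm, heq.2.symm⟩
    · exact Or.inr ⟨a, ha, h, h₁, h₂, heq⟩

/-- Different actions have disjoint subtrees by `child_unique`, and a call leaves out its own pair,
which the split has filled in. -/
theorem nodup_fill_ownTasks (hG : G.PerfectRecall) (hord : IsActionOrder G ord) (J : I) :
    ((ownTasks ord i s t J).flatMap (Operation.fill G)).Nodup := by
  rw [fill_ownTasks, List.nodup_append]
  refine ⟨(hord J).1.map fun a b h => by simpa [mkPair_inj] using h, ?_, ?_⟩
  · rw [List.nodup_flatMap]
    refine ⟨fun a _ => EFG.nodup_belowList _, (hord J).1.imp fun {a b} hab q hqa hqb => ?_⟩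
    obtain ⟨σ, τ, rfl⟩ := exists_eq_mkPair i q
    rw [EFG.mem_belowList, EFG.mkPair_mem_below] at hqa hqb
    exact hab (hG.child_unique rfl hqa.2.1 hqb.2.1).2
  · rintro q hq q' hq' rfl
    obtain ⟨a, -, rfl⟩ := List.mem_map.1 hq
    obtain ⟨b, -, hb⟩ := List.mem_flatMap.1 hq'
    rw [EFG.mem_belowList, EFG.mkPair_mem_below] at hb
    have := (hG.child_unique rfl (EFG.Descends.refl (some (J, a))) hb.2.1).2
    exact hb.2.2.2 ⟨by rw [this], rfl⟩

end Tasks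

/-! ### Entries filled in and read by one call -/

namespace IsCallChoice

variable {I A : Type*} {G : EFG I A} {ord : I → List A} {i : Player} {s t : Sequence I A}
  {star : Option I} {Js Ks : List I}

/-- The first loop tests only `t ⋈ J`, which follows from the connection of `J` with an information
set whose parent is `t`, by going up one step. -/
theorem star_mem (h : IsCallChoice G i s t star Js Ks) (hG : G.PerfectRecall) {J : I}
    (hJ : star = some J) : J ∈ Js := by
  obtain ⟨hp, hs, K, -, ht, hc⟩ := (h.star_iff J).1 hJ
  obtain ⟨b, -⟩ := G.actions_nonempty K
  exact (h.mem_own J).2 ⟨hp, hs, ht ▸ hG.seqInfosetRelevant_of_descends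
    (EFG.descends_some_parentSeq K b) (EFG.connected_comm.1 hc)⟩

/-- Going up from `K` to its ancestor with parent `t` preserves the connection with `J`, so `J` is
critical. Hence `I*` is the only member of the first loop that interacts with the second one. -/
theorem star_eq (h : IsCallChoice G i s t star Js Ks) (hG : G.PerfectRecall) {J K : I}
    (hJ : J ∈ Js) (hK : K ∈ Ks) (hc : G.Connected J K) : star = some J := by
  obtain ⟨hp, hs, -⟩ := (h.mem_own J).1 hJ
  obtain ⟨hKp, hKt, -⟩ := (h.mem_opp K).1 hK
  obtain ⟨b, hb⟩ := G.actions_nonempty K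
  have hd : G.Descends (some (K, b)) t := .step _ _ _ hKt
  obtain ⟨K₀, b₀, hK₀, hd₀⟩ := hG.exists_child hd (by
    rintro rfl
    exact hG.not_descends_some K b hKt)
  refine (h.star_iff J).2 ⟨hp, hs, K₀, ?_, hK₀, ?_⟩
  · exact (hG.isSequence_of_descends hd₀ ⟨hKp, hb⟩).1
  · exact EFG.connected_comm.1 (hG.seqInfosetRelevant_of_descends (σ := some (K, b)) hd₀
      (EFG.connected_comm.1 hc))

/-- Below a pair, own strict descendants belong to the own loop. -/
theorem exists_own (h : IsCallChoice G i s t star Js Ks) (hG : G.PerfectRecall)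
    {σ τ : Sequence I A} (hr : G.Relevant (mkPair i σ τ)) (hσ : G.Descends σ s)
    (hτ : G.Descends τ t) (hne : σ ≠ s) :
    ∃ J ∈ Js, ∃ a ∈ G.actions J, G.Descends σ (some (J, a)) := by
  obtain ⟨J, a, hJ, hd⟩ := hG.exists_child hσ hne
  have hr' := hG.relevant_of_descends hr hd hτ
  have hs := (EFG.relevant_mkPair.1 hr').1
  exact ⟨J, (h.mem_own J).2 ⟨hs.1, hJ, EFG.seqInfosetRelevant_left hr'⟩, a, hs.2, hd⟩

theorem mem_opp_of_relevant (h : IsCallChoice G i s t star Js Ks) {K : I} {b : A}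
    (hr : G.Relevant (mkPair i s (some (K, b)))) (ht : G.Descends (G.parentSeq K) t) : K ∈ Ks :=
  (h.mem_opp K).2 ⟨(EFG.relevant_mkPair.1 hr).2.1.1, ht, EFG.seqInfosetRelevant_right hr⟩

/-- The two loops correspond to the alternative whether the sequence of `i` lies strictly below `s`
or equals `s`; in the latter case the opponent's sequence lies strictly below `t`. -/
theorem mem_fill_callBody (h : IsCallChoice G i s t star Js Ks) (hG : G.PerfectRecall)
    (hord : IsActionOrder G ord) (hr : G.Relevant (mkPair i s t)) (q : SeqPair I A) :
    q ∈ (callBody G ord i s t star Js Ks).flatMap (Operation.fill G) ↔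
      q ∈ G.below (mkPair i s t) := by
  obtain ⟨σ, τ, rfl⟩ := exists_eq_mkPair i q
  have hst := EFG.relevant_mkPair.1 hr
  rw [callBody, List.flatMap_append, List.mem_append, List.flatMap_assoc, List.flatMap_assoc,
    List.mem_flatMap, List.mem_flatMap, EFG.mkPair_mem_below]
  simp only [fill_opponentTasks, List.mem_map, mkPair_inj]
  constructor
  · rintro (⟨J, hJ, hq⟩ | ⟨K, hK, b, hb, rfl, rfl⟩)
    · obtain ⟨hp, hs, hR⟩ := (h.mem_own J).1 hJ
      obtain ⟨a, hrel, h₁, h₂⟩ := (mem_fill_ownTasks hG hord hp hst.2.1 hR).1 hq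
      refine ⟨hrel, hG.descends_trans h₁ (hs ▸ EFG.descends_some_parentSeq J a), h₂, ?_⟩
      rintro ⟨rfl, -⟩
      exact hG.not_descends_some J a (hs ▸ h₁)
    · obtain ⟨hp, ht, hR⟩ := (h.mem_opp K).1 hK
      refine ⟨EFG.relevant_some_right hp ((hord K).2 b |>.1 hb) hst.1 hR, .refl _,
        .step _ _ _ ht, ?_⟩
      rintro ⟨-, rfl⟩
      exact hG.not_descends_some K b ht
  · rintro ⟨hrel, h₁, h₂, hne⟩
    by_cases hσ : σ = s
    · subst hσ
      right
      obtain ⟨K, b, hK, hd⟩ := hG.exists_child h₂ fun h => hne ⟨rfl, h⟩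
      rcases τ with _ | ⟨K', b'⟩
      · exact absurd (EFG.descends_none_iff.1 hd) (by simp)
      · have hK' : G.Descends (G.parentSeq K') t := by
          rcases EFG.descends_some_iff.1 h₂ with rfl | h'
          · exact absurd ⟨rfl, rfl⟩ hne
          · exact h'
        exact ⟨K', h.mem_opp_of_relevant hrel hK', b',
          (hord K').2 b' |>.2 (EFG.relevant_mkPair.1 hrel).2.1.2, rfl, rfl⟩
    · left
      obtain ⟨J, hJ, a, -, hd⟩ := h.exists_own hG hrel h₁ h₂ hσ
      obtain ⟨hp, hs, hR⟩ := (h.mem_own J).1 hJ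
      exact ⟨J, hJ, (mem_fill_ownTasks hG hord hp hst.2.1 hR).2 ⟨a, hrel, hd, h₂⟩⟩

theorem nodup_fill_callBody (h : IsCallChoice G i s t star Js Ks) (hG : G.PerfectRecall)
    (hord : IsActionOrder G ord) (hr : G.Relevant (mkPair i s t)) :
    ((callBody G ord i s t star Js Ks).flatMap (Operation.fill G)).Nodup := by
  have hst := EFG.relevant_mkPair.1 hr
  rw [callBody, List.flatMap_append, List.flatMap_assoc, List.flatMap_assoc]
  simp only [fill_opponentTasks]
  rw [List.nodup_append, List.nodup_flatMap, List.nodup_flatMap]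
  refine ⟨⟨fun J _ => nodup_fill_ownTasks hG hord J, ?_⟩,
    ⟨fun K _ => (hord K).1.map fun a b h => by simpa [mkPair_inj] using h, ?_⟩, ?_⟩
  · refine h.nodup_own.imp_of_mem fun {J J'} hJ hJ' hne q hq hq' => ?_
    obtain ⟨σ, τ, rfl⟩ := exists_eq_mkPair i q
    obtain ⟨hp, hs, hR⟩ := (h.mem_own J).1 hJ
    obtain ⟨hp', hs', hR'⟩ := (h.mem_own J').1 hJ'
    obtain ⟨a, -, h₁, -⟩ := (mem_fill_ownTasks hG hord hp hst.2.1 hR).1 hq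
    obtain ⟨a', -, h₂, -⟩ := (mem_fill_ownTasks hG hord hp' hst.2.1 hR').1 hq'
    exact hne (hG.child_unique (hs.trans hs'.symm) h₁ h₂).1
  · refine h.nodup_opp.imp fun {K K'} hne q hq hq' => hne ?_
    obtain ⟨b, -, rfl⟩ := List.mem_map.1 hq
    obtain ⟨b', -, hb⟩ := List.mem_map.1 hq'
    simpa using (congrArg (Option.map Prod.fst) (mkPair_inj.1 hb).2).symm
  · rintro q hq q' hq' rfl
    obtain ⟨J, hJ, hq⟩ := List.mem_flatMap.1 hq
    obtain ⟨K, hK, hq'⟩ := List.mem_flatMap.1 hq'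
    obtain ⟨b, -, rfl⟩ := List.mem_map.1 hq'
    obtain ⟨hp, hs, hR⟩ := (h.mem_own J).1 hJ
    obtain ⟨a, -, h₁, -⟩ := (mem_fill_ownTasks hG hord hp hst.2.1 hR).1 hq
    exact hG.not_descends_some J a (hs ▸ h₁)

theorem fill_callBody_perm (h : IsCallChoice G i s t star Js Ks) (hG : G.PerfectRecall)
    (hord : IsActionOrder G ord) (hr : G.Relevant (mkPair i s t)) :
    ((callBody G ord i s t star Js Ks).flatMap (Operation.fill G)).Perm
      (G.belowList (mkPair i s t)) :=
  (List.perm_ext_iff_of_nodup (h.nodup_fill_callBody hG hord hr) (EFG.nodup_belowList _)).2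
    fun q => by rw [h.mem_fill_callBody hG hord hr, EFG.mem_belowList]

/-- A sum reads entries below the children of `I*`, which the calls of the first loop have filled
in. A split in the second loop reads `(s, σ(K))`, which is the pair of the call or was filled in
earlier thanks to the top-down order. -/
theorem ready_callBody (h : IsCallChoice G i s t star Js Ks) (hG : G.PerfectRecall)
    (hord : IsActionOrder G ord) (hr : G.Relevant (mkPair i s t)) {S : Set (SeqPair I A)}
    (hS : mkPair i s t ∈ S) : Ready G S (callBody G ord i s t star Js Ks) := by
  have hst := EFG.relevant_mkPair.1 hr
  have hord_ne : ∀ J, ord J ≠ [] := fun J hJ => by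
    obtain ⟨a, ha⟩ := G.actions_nonempty J
    simpa [hJ] using ((hord J).2 a).2 ha
  rw [callBody, ready_append]
  constructor
  · refine ready_flatMap fun l₁ J l₂ hl => ?_
    obtain ⟨hp, hs, hR⟩ := (h.mem_own J).1 (hl ▸ by simp)
    refine ⟨by simp [Operation.WellFormed, hord_ne J], ?_, ?_⟩
    · simp only [Operation.needs, List.mem_singleton, forall_eq]
      exact Or.inl hS
    · refine ready_map (fun a ha => ?_) fun a ha => ?_
      · exact EFG.relevant_some_left hp ((hord J).2 a |>.1 ha) hst.2.1 hR
      · simp only [Operation.needs, List.mem_singleton, forall_eq]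
        exact Or.inr (List.mem_map.2 ⟨a, ha, rfl⟩)
  · refine ready_flatMap fun l₁ K l₂ hl => ?_
    obtain ⟨hp, ht, hR⟩ := (h.mem_opp K).1 (hl ▸ by simp)
    rcases opponentTasks_cases G star K with ⟨J, hJ, hJK⟩ | hnc
    · rw [opponentTasks_of_connected hJ hJK]
      obtain ⟨hp', hs, hR'⟩ := (h.mem_own J).1 (h.star_mem hG hJ)
      refine ready_map (fun b hb => ?_) fun b hb => ?_
      · exact (hord J).1.map fun a a' h => by simpa [mkPair_inj] using h
      · simp only [Operation.needs, List.mem_map]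
        rintro q ⟨a, ha, rfl⟩
        left; right
        rw [Set.mem_ofPred_eq, List.flatMap_assoc, List.mem_flatMap]
        refine ⟨J, h.star_mem hG hJ, (mem_fill_ownTasks hG hord hp' hst.2.1 hR').2
          ⟨a, ?_, .refl _, .step _ _ _ ht⟩⟩
        exact EFG.relevant_some_left hp' ((hord J).2 a |>.1 ha)
          ⟨hp, (hord K).2 b |>.1 hb⟩ (EFG.connected_comm.1 hJK)
    · rw [opponentTasks_of_not_connected hnc]
      refine ⟨by simp [Operation.WellFormed, hord_ne K], ?_, trivial⟩
      simp only [Operation.needs, List.mem_singleton, forall_eq]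
      by_cases htK : G.parentSeq K = t
      · rw [htK]
        exact Or.inl (Or.inl hS)
      · right
        rcases hK : G.parentSeq K with _ | ⟨K', b'⟩
        · rw [hK, EFG.descends_none_iff] at ht
          exact absurd (hK.trans ht.symm) htK
        · have ht' : G.Descends (G.parentSeq K') t := by
            rw [hK] at ht
            rcases EFG.descends_some_iff.1 ht with h' | h'
            · exact absurd (hK.trans h'.symm) htK
            · exact h'
          obtain ⟨b, hb⟩ := G.actions_nonempty K
          have hb' := hG.isSequence_parentSeq K
          rw [hK] at hb'
          have hrel : G.Relevant (mkPair i s (some (K', b'))) := by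
            refine hG.relevant_of_descends_right
              (EFG.relevant_some_right hp hb hst.1 hR) (.step _ _ _ (hK ▸ .refl _))
          -- Since `σ(K) = (K', b') ≻ σ(K')`, the sorting condition forbids `K'` to come after `K`.
          have hK'mem : K' ∈ l₁ := by
            have hmem := h.mem_opp_of_relevant hrel ht'
            have hsort := h.sorted
            rw [hl] at hmem hsort
            rw [List.pairwise_append, List.pairwise_cons] at hsort
            rcases List.mem_append.1 hmem with hm | hm
            · exact hm
            · have hlt : G.Descends (G.parentSeq K) (G.parentSeq K') ∧
                  G.parentSeq K ≠ G.parentSeq K' := by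
                rw [hK]
                exact ⟨EFG.descends_some_parentSeq K' b',
                  fun h => hG.parentSeq_ne_some K' b' h.symm⟩
              rcases List.mem_cons.1 hm with rfl | hm
              · exact absurd rfl hlt.2
              · exact absurd hlt (hsort.2.1.1 K' hm)
          rw [Set.mem_ofPred_eq, List.flatMap_assoc, List.mem_flatMap]
          refine ⟨K', hK'mem, ?_⟩
          rw [fill_opponentTasks, List.mem_map]
          exact ⟨b', (hord K').2 b' |>.2 hb'.2, rfl⟩

end IsCallChoice

/-! ### Equivalence of the operations of a call with the constraints below its pair -/

namespace IsCallChoice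

variable {I A : Type*} {G : EFG I A} {ord : I → List A} {i : Player} {s t : Sequence I A}
  {star : Option I} {Js Ks : List I}

/-- Each operation expresses a constraint: splits are constraints of `i` at `t` or of the opponent
at `s`, sums are constraints of `I*` against `(K, b)`, and calls are constraints further down. -/
theorem equations_callBody_of_call (h : IsCallChoice G i s t star Js Ks) (hG : G.PerfectRecall)
    (hord : IsActionOrder G ord) (hr : G.Relevant (mkPair i s t)) {f : SeqPair I A → ℝ}
    (hf : (Operation.call (mkPair i s t)).Equations G f) :
    ∀ op ∈ callBody G ord i s t star Js Ks, op.Equations G f := by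
  have hst := EFG.relevant_mkPair.1 hr
  obtain ⟨hnn, hown, hopp⟩ := Operation.equations_call_mkPair.1 hf
  intro op hop
  have hnew : ∀ q ∈ op.fill G, 0 ≤ f q := fun q hq =>
    hnn q ((h.mem_fill_callBody hG hord hr q).1 (List.mem_flatMap.2 ⟨op, hop, hq⟩))
  rcases List.mem_append.1 hop with hop | hop
  · obtain ⟨J, hJ, hop⟩ := List.mem_flatMap.1 hop
    obtain ⟨hp, hs, hR⟩ := (h.mem_own J).1 hJ
    rcases List.mem_cons.1 hop with rfl | hop
    · refine ⟨hnew, ?_⟩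
      have := hown J t hp hst.2.1 hR (hs ▸ .refl _) (.refl _)
      rw [hs, ← hord.sum_map] at this
      rw [List.map_map, ← this]
      rfl
    · obtain ⟨a, -, rfl⟩ := List.mem_map.1 hop
      exact hf.call_mono hG (hs ▸ EFG.descends_some_parentSeq J a) (.refl _)
  · obtain ⟨K, hK, hop⟩ := List.mem_flatMap.1 hop
    obtain ⟨hp, ht, hR⟩ := (h.mem_opp K).1 hK
    rcases opponentTasks_cases G star K with ⟨J, hJ, hJK⟩ | hnc
    · rw [opponentTasks_of_connected hJ hJK] at hop
      obtain ⟨b, hb, rfl⟩ := List.mem_map.1 hop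
      obtain ⟨hp', hs, hR'⟩ := (h.mem_own J).1 (h.star_mem hG hJ)
      have := hown J (some (K, b)) hp' ⟨hp, (hord K).2 b |>.1 hb⟩ (EFG.connected_comm.1 hJK)
        (hs ▸ .refl _) (.step _ _ _ ht)
      rw [hs, ← hord.sum_map] at this
      rw [Operation.Equations, List.map_map, ← this]
      rfl
    · rw [opponentTasks_of_not_connected hnc, List.mem_singleton] at hop
      subst hop
      refine ⟨hnew, ?_⟩
      have := hopp K s hp (by simpa using hst.1) hR ht (.refl _)
      rw [mkPair_opp, ← hord.sum_map] at this
      rw [List.map_map, ← this]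
      simp [mkPair_opp, Function.comp_def]

/-- Only the sums do not impose nonnegativity; their values are sums of entries from the first loop,
which are nonnegative. -/
theorem nonneg_of_callBody (h : IsCallChoice G i s t star Js Ks) (hG : G.PerfectRecall)
    (hord : IsActionOrder G ord) (hr : G.Relevant (mkPair i s t)) {f : SeqPair I A → ℝ}
    (hf : ∀ op ∈ callBody G ord i s t star Js Ks, op.Equations G f) :
    ∀ q ∈ G.below (mkPair i s t), 0 ≤ f q := by
  have hown : ∀ J ∈ Js, ∀ q ∈ (ownTasks ord i s t J).flatMap (Operation.fill G), 0 ≤ f q := by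
    intro J hJ q hq
    obtain ⟨op, hop, hq⟩ := List.mem_flatMap.1 hq
    have hop' := hf op (List.mem_append_left _ (List.mem_flatMap.2 ⟨J, hJ, hop⟩))
    rcases List.mem_cons.1 hop with rfl | hop
    · exact hop'.1 q hq
    · obtain ⟨a, -, rfl⟩ := List.mem_map.1 hop
      exact hop'.1 q (EFG.mem_belowList.1 hq)
  intro q hq
  rw [← h.mem_fill_callBody hG hord hr, callBody, List.flatMap_append, List.mem_append,
    List.flatMap_assoc, List.flatMap_assoc] at hq
  rcases hq with hq | hq
  · obtain ⟨J, hJ, hq⟩ := List.mem_flatMap.1 hq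
    exact hown J hJ q hq
  · obtain ⟨K, hK, hq⟩ := List.mem_flatMap.1 hq
    obtain ⟨hp, ht, hR⟩ := (h.mem_opp K).1 hK
    have hf' : ∀ op ∈ opponentTasks G ord i s star K, op.Equations G f := fun op hop =>
      hf op (List.mem_append_right _ (List.mem_flatMap.2 ⟨K, hK, hop⟩))
    rcases opponentTasks_cases G star K with ⟨J, hJ, hJK⟩ | hnc
    · rw [fill_opponentTasks] at hq
      obtain ⟨b, hb, rfl⟩ := List.mem_map.1 hq
      have := hf' _ (opponentTasks_of_connected (ord := ord) (i := i) (s := s) hJ hJK ▸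
        List.mem_map.2 ⟨b, hb, rfl⟩)
      rw [Operation.Equations] at this
      rw [this]
      refine List.sum_nonneg fun x hx => ?_
      simp only [List.map_map, List.mem_map, Function.comp] at hx
      obtain ⟨a, ha, rfl⟩ := hx
      obtain ⟨hp', hs, hR'⟩ := (h.mem_own J).1 (h.star_mem hG hJ)
      refine hown J (h.star_mem hG hJ) _ ((mem_fill_ownTasks hG hord hp'
        (EFG.relevant_mkPair.1 hr).2.1 hR').2 ⟨a, ?_, .refl _, .step _ _ _ ht⟩)
      exact EFG.relevant_some_left hp' ((hord J).2 a |>.1 ha) ⟨hp, (hord K).2 b |>.1 hb⟩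
        (EFG.connected_comm.1 hJK)
    · rw [opponentTasks_of_not_connected hnc] at hf' hq
      have hf' := hf' _ (List.mem_singleton_self _)
      simp only [List.flatMap_cons, List.flatMap_nil, List.append_nil, Operation.fill] at hq
      exact hf'.1 q hq

/-- Constraints with an `i`-sequence strictly below `s` come from the recursive calls. The ones left
are those of `i` at information sets with parent `s`, given by splits and sums, and those of the
opponent at `s`. The only constraints not imposed directly are the opponent's at a `K` connected
with `I*`. -/
theorem equations_call_of_callBody (h : IsCallChoice G i s t star Js Ks) (hG : G.PerfectRecall)
    (hord : IsActionOrder G ord) (hr : G.Relevant (mkPair i s t)) {f : SeqPair I A → ℝ}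
    (hf : ∀ op ∈ callBody G ord i s t star Js Ks, op.Equations G f) :
    (Operation.call (mkPair i s t)).Equations G f := by
  have hst := EFG.relevant_mkPair.1 hr
  have hsplit : ∀ J ∈ Js, ∑ a ∈ G.actions J, f (mkPair i (some (J, a)) t) = f (mkPair i s t) := by
    intro J hJ
    have := (hf _ (List.mem_append_left _ (List.mem_flatMap.2 ⟨J, hJ, List.mem_cons_self⟩))).2
    rw [List.map_map] at this
    rw [← this, ← hord.sum_map]
    rfl
  have hcall : ∀ J ∈ Js, ∀ a ∈ G.actions J,
      (Operation.call (mkPair i (some (J, a)) t)).Equations G f := fun J hJ a ha =>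
    hf _ (List.mem_append_left _ (List.mem_flatMap.2 ⟨J, hJ, List.mem_cons_of_mem _
      (List.mem_map.2 ⟨a, (hord J).2 a |>.2 ha, rfl⟩)⟩))
  have hsum : ∀ K ∈ Ks, ∀ J, star = some J → G.Connected J K → ∀ b ∈ G.actions K,
      f (mkPair i s (some (K, b))) =
        ∑ a ∈ G.actions J, f (mkPair i (some (J, a)) (some (K, b))) := by
    intro K hK J hJ hJK b hb
    have hmem : .sum ((ord J).map fun a => mkPair i (some (J, a)) (some (K, b)))
        (mkPair i s (some (K, b))) ∈ opponentTasks G ord i s star K := by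
      rw [opponentTasks_of_connected hJ hJK]
      exact List.mem_map.2 ⟨b, (hord K).2 b |>.2 hb, rfl⟩
    have := hf _ (List.mem_append_right _ (List.mem_flatMap.2 ⟨K, hK, hmem⟩))
    rw [Operation.Equations, List.map_map] at this
    rw [this, ← hord.sum_map]
    rfl
  refine Operation.equations_call_mkPair.2 ⟨h.nonneg_of_callBody hG hord hr hf, ?_, ?_⟩
  · intro J σ hp hσ hR hJ hσt
    by_cases hs : G.parentSeq J = s
    · have hJmem : J ∈ Js :=
        (h.mem_own J).2 ⟨hp, hs, hG.seqInfosetRelevant_of_descends hσt hR⟩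
      by_cases hne : σ = t
      · rw [hne, hs]
        exact hsplit J hJmem
      · rcases σ with _ | ⟨K, b⟩
        · exact absurd (EFG.descends_none_iff.1 hσt).symm hne
        · have ht : G.Descends (G.parentSeq K) t := by
            rcases EFG.descends_some_iff.1 hσt with h' | h'
            · exact absurd h'.symm hne
            · exact h'
          obtain ⟨a, ha⟩ := G.actions_nonempty J
          have hrel : G.Relevant (mkPair i s (some (K, b))) :=
            hG.relevant_of_descends (EFG.relevant_some_left hp ha hσ hR)
              (hs ▸ EFG.descends_some_parentSeq J a) (.refl _)
          have hK := h.mem_opp_of_relevant hrel ht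
          have hc := EFG.connected_comm.1 hR
          -- By `star_eq` the information set `J` is critical, so its constraint against `(K, b)` is
          -- one of the sums.
          rw [hs, hsum K hK J (h.star_eq hG hJmem hK hc) hc b hσ.2]
    · obtain ⟨a, ha⟩ := G.actions_nonempty J
      obtain ⟨J₀, hJ₀, a₀, ha₀, hd⟩ := h.exists_own hG
        (hG.relevant_of_descends (EFG.relevant_some_left hp ha hσ hR)
          (EFG.descends_some_parentSeq J a) (.refl _)) hJ hσt hs
      exact (Operation.equations_call_mkPair.1 (hcall J₀ hJ₀ a₀ ha₀)).2.1 J σ hp hσ hR hd hσt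
  · intro K σ hp hσ hR hKt hσs
    rw [Player.opp_opp] at hσ
    by_cases hs : σ = s
    · subst hs
      have hK : K ∈ Ks := (h.mem_opp K).2 ⟨hp, hKt, hR⟩
      simp only [mkPair_opp]
      rcases opponentTasks_cases G star K with ⟨J, hJ, hJK⟩ | hnc
      · obtain ⟨hp', hs, hR'⟩ := (h.mem_own J).1 (h.star_mem hG hJ)
        -- Write every `ξ[s, (K, b)]` as the sum over `I*` and exchange the sums: the inner sums
        -- over `b` are the opponent's constraints below `((J, a), t)`, known from the recursive
        -- calls.
        rw [Finset.sum_congr rfl (hsum K hK J hJ hJK), Finset.sum_comm]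
        have hcol : ∀ a ∈ G.actions J, ∑ b ∈ G.actions K,
            f (mkPair i (some (J, a)) (some (K, b))) =
              f (mkPair i (some (J, a)) (G.parentSeq K)) := by
          intro a ha
          have := (Operation.equations_call_mkPair.1 (hcall J (h.star_mem hG hJ) a ha)).2.2
            K (some (J, a)) hp (by simpa using ⟨hp', ha⟩) hJK hKt (.refl _)
          simpa only [mkPair_opp] using this
        rw [Finset.sum_congr rfl hcol]
        by_cases ht : G.parentSeq K = t
        · rw [ht]
          exact hsplit J (h.star_mem hG hJ)
        · rcases hK' : G.parentSeq K with _ | ⟨K', b'⟩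
          · rw [hK', EFG.descends_none_iff] at hKt
            exact absurd (hK'.trans hKt.symm) ht
          · have ht' : G.Descends (G.parentSeq K') t := by
              rw [hK'] at hKt
              rcases EFG.descends_some_iff.1 hKt with h' | h'
              · exact absurd (hK'.trans h'.symm) ht
              · exact h'
            obtain ⟨b, hb⟩ := G.actions_nonempty K
            have hd : G.Descends (some (K, b)) (some (K', b')) := .step _ _ _ (hK' ▸ .refl _)
            have hrel := hG.relevant_of_descends_right
              (EFG.relevant_some_right hp hb hσ hR) hd
            -- The parent `K'` of `K` inherits the connection with `I*`, so the remaining sum over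
            -- `a` is the one that defines `ξ[s, (K', b')]`.
            have hc : G.Connected J K' := EFG.connected_comm.1
              (hG.seqInfosetRelevant_of_descends (σ := some (K, b)) hd
                (EFG.connected_comm.1 hJK))
            exact (hsum K' (h.mem_opp_of_relevant hrel ht') J hJ hc b'
              (EFG.relevant_mkPair.1 hrel).2.1.2).symm
      · have hmem : .split (mkPair i σ (G.parentSeq K))
            ((ord K).map fun b => mkPair i σ (some (K, b))) ∈ opponentTasks G ord i σ star K := by
          rw [opponentTasks_of_not_connected hnc]
          exact List.mem_singleton_self _
        have := (hf _ (List.mem_append_right _ (List.mem_flatMap.2 ⟨K, hK, hmem⟩))).2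
        rw [List.map_map] at this
        rw [← this, ← hord.sum_map]
        rfl
    · obtain ⟨b, hb⟩ := G.actions_nonempty K
      obtain ⟨J₀, hJ₀, a₀, ha₀, hd⟩ := h.exists_own hG
        (hG.relevant_of_descends_right (EFG.relevant_some_right hp hb hσ hR)
          (EFG.descends_some_parentSeq K b)) hσs hKt hs
      exact (Operation.equations_call_mkPair.1 (hcall J₀ hJ₀ a₀ ha₀)).2.2 K σ hp
        (by simpa using hσ) hR hKt hd

/-- In each group of operations the weight is at most twice the number of entries filled in: a split
and its `|A_J|` calls contribute `1 + |A_J|` beyond twice the entries below those calls, which `2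
|A_J|` covers because there is an action. The summand 1 in the weight of a call makes the inequality
strict. -/
theorem weight_callBody_le (h : IsCallChoice G i s t star Js Ks) (hG : G.PerfectRecall)
    (hord : IsActionOrder G ord) (hr : G.Relevant (mkPair i s t)) :
    ((callBody G ord i s t star Js Ks).map (Operation.weight G)).sum <
      (Operation.call (mkPair i s t)).weight G := by
  have hord_ne : ∀ J, 1 ≤ (ord J).length := fun J => by
    obtain ⟨a, ha⟩ := G.actions_nonempty J
    exact List.length_pos_of_mem (((hord J).2 a).2 ha)
  have main : ∀ (l : List I) (g : I → List (Operation I A)),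
      (∀ J, ((g J).map (Operation.weight G)).sum ≤
        2 * ((g J).flatMap (Operation.fill G)).length) →
      ((l.flatMap g).map (Operation.weight G)).sum ≤
        2 * ((l.flatMap g).flatMap (Operation.fill G)).length := by
    intro l g hg
    induction l with
    | nil => simp
    | cons J l ih =>
      have := hg J
      simp only [List.flatMap_cons, List.map_append, List.sum_append, List.flatMap_append,
        List.length_append]
      omega
  have hown : ∀ J, ((ownTasks ord i s t J).map (Operation.weight G)).sum ≤
      2 * ((ownTasks ord i s t J).flatMap (Operation.fill G)).length := by
    intro J
    have aux : ∀ l : List A, ((l.map fun a => Operation.call (mkPair i (some (J, a)) t)).map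
        (Operation.weight G)).sum =
          2 * (l.flatMap fun a => G.belowList (mkPair i (some (J, a)) t)).length + l.length := by
      intro l
      induction l with
      | nil => rfl
      | cons a l ih =>
        simp only [List.map_cons, List.sum_cons, List.flatMap_cons, List.length_append,
          List.length_cons, ih, Operation.weight]
        omega
    have := hord_ne J
    rw [fill_ownTasks, ownTasks, List.map_cons, List.sum_cons, aux, List.length_append,
      List.length_map, Operation.weight]
    omega
  have hopp : ∀ K, ((opponentTasks G ord i s star K).map (Operation.weight G)).sum ≤
      2 * ((opponentTasks G ord i s star K).flatMap (Operation.fill G)).length := by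
    intro K
    have := hord_ne K
    rw [fill_opponentTasks, List.length_map]
    rcases opponentTasks_cases G star K with ⟨J, hJ, hJK⟩ | hnc
    · rw [opponentTasks_of_connected hJ hJK, List.map_map]
      simp only [Function.comp_def, Operation.weight, List.map_const', List.sum_replicate]
      simp
      omega
    · rw [opponentTasks_of_not_connected hnc]
      simp only [Operation.weight, List.map_cons, List.map_nil, List.sum_cons, List.sum_nil]
      omega
  have h₁ := main Js _ hown
  have h₂ := main Ks _ hopp
  have h₃ := (h.fill_callBody_perm hG hord hr).length_eq
  rw [callBody, List.flatMap_append, List.length_append] at h₃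
  rw [callBody, List.map_append, List.sum_append, Operation.weight]
  omega

end IsCallChoice

/-! ### The polytope as the constraints of the call at the root -/

namespace EFG

variable {I A : Type*} {G : EFG I A}

/-- The constraints below `(∅, ∅)`, with the normalization, define the polytope of correlation
plans. -/
theorem mem_correlationPlans_iff (hG : G.PerfectRecall) (f : SeqPair I A → ℝ) :
    (fun p : G.RelevantPair => f p) ∈ G.correlationPlans ↔
      f (none, none) = 1 ∧ (Operation.call (none, none)).Equations G f := by
  have hnone : G.Relevant (none, none) := ⟨trivial, trivial, by simp⟩
  have hent : ∀ p, G.Relevant p → G.entry (fun p : G.RelevantPair => f p) p = f p :=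
    fun p hp => by simp [entry, hp]
  -- All pairs in a constraint are relevant, so the default value 0 of `entry` plays no role.
  have hcon : ∀ (i : Player) J σ, G.player J = i → G.IsSequence i.opp σ →
      G.SeqInfosetRelevant σ J → ((∑ a ∈ G.actions J,
        G.entry (fun p : G.RelevantPair => f p) (mkPair i (some (J, a)) σ) =
          G.entry (fun p : G.RelevantPair => f p) (mkPair i (G.parentSeq J) σ)) ↔
        ∑ a ∈ G.actions J, f (mkPair i (some (J, a)) σ) = f (mkPair i (G.parentSeq J) σ)) := by
    intro i J σ hp hσ hR
    obtain ⟨a, ha⟩ := G.actions_nonempty J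
    rw [hent _ (hG.relevant_of_descends (relevant_some_left hp ha hσ hR)
      (descends_some_parentSeq J a) (.refl _)), Finset.sum_congr rfl fun a ha =>
        hent _ (relevant_some_left hp ha hσ hR)]
  rw [correlationPlans, Set.mem_ofPred_eq, hent _ hnone]
  constructor
  · rintro ⟨h₁, h₂, h₃, h₄⟩
    refine ⟨h₂, fun q hq => h₁ ⟨q, hq.1⟩, ?_, ?_⟩
    · exact fun J σ hp hσ hR _ _ => (hcon .one J σ hp hσ hR).1 (h₃ J σ hp hσ hR)
    · exact fun J σ hp hσ hR _ _ => (hcon .two J σ hp hσ hR).1 (h₄ J σ hp hσ hR)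
  · rintro ⟨h₂, h₁, h₃, h₄⟩
    refine ⟨?_, h₂, ?_, ?_⟩
    · rintro ⟨p, hp⟩
      by_cases hne : p = (none, none)
      · subst hne
        change 0 ≤ f _
        rw [h₂]
        exact zero_le_one
      · exact h₁ p ⟨hp, hG.descends_none _, hG.descends_none _, hne⟩
    · exact fun J σ hp hσ hR => (hcon .one J σ hp hσ hR).2
        (h₃ J σ hp hσ hR (hG.descends_none _) (hG.descends_none _))
    · exact fun J σ hp hσ hR => (hcon .two J σ hp hσ hR).2
        (h₄ J σ hp hσ hR (hG.descends_none _) (hG.descends_none _))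

end EFG

/-! ## Scaled extensions -/

section ScaledExtension

variable {m n : ℕ}

theorem dotNat_add {d : ℕ} (a : Fin d → ℕ) (x y : Fin d → ℝ) :
    dotNat a (x + y) = dotNat a x + dotNat a y := by
  simp [dotNat, mul_add, Finset.sum_add_distrib]

theorem dotNat_smul {d : ℕ} (a : Fin d → ℕ) (c : ℝ) (x : Fin d → ℝ) :
    dotNat a (c • x) = c * dotNat a x := by
  simp only [dotNat, Pi.smul_apply, smul_eq_mul, Finset.mul_sum]
  exact Finset.sum_congr rfl fun j _ => by ring

theorem continuous_dotNat {d : ℕ} (a : Fin d → ℕ) : Continuous (dotNat a) := by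
  unfold dotNat
  fun_prop

theorem dotNat_nonneg {d : ℕ} (a : Fin d → ℕ) {x : Fin d → ℝ} (hx : ∀ j, 0 ≤ x j) :
    0 ≤ dotNat a x :=
  Finset.sum_nonneg fun j _ => mul_nonneg (Nat.cast_nonneg _) (hx j)

theorem scaledExtension_eq_image (X : Set (Fin m → ℝ)) (h : (Fin m → ℝ) → ℝ)
    (Y : Set (Fin n → ℝ)) : scaledExtension X h Y =
      (fun z : (Fin m → ℝ) × (Fin n → ℝ) => Fin.append z.1 (h z.1 • z.2)) '' X ×ˢ Y := by
  ext z
  constructor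
  · rintro ⟨x, hx, y, hy, rfl⟩
    exact ⟨(x, y), ⟨hx, hy⟩, rfl⟩
  · rintro ⟨⟨x, y⟩, ⟨hx, hy⟩, rfl⟩
    exact ⟨x, hx, y, hy, rfl⟩

theorem isCompact_scaledExtension {X : Set (Fin m → ℝ)} {a : Fin m → ℕ} {Y : Set (Fin n → ℝ)}
    (hX : IsCompact X) (hY : IsCompact Y) : IsCompact (scaledExtension X (dotNat a) Y) := by
  rw [scaledExtension_eq_image]
  refine (hX.prod hY).image (continuous_pi fun j => ?_)
  have := continuous_dotNat a
  refine Fin.addCases (fun j => ?_) (fun j => ?_) j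
  · simp only [Fin.append_left]
    fun_prop
  · simp only [Fin.append_right, Pi.smul_apply, smul_eq_mul]
    fun_prop

theorem append_add (x x' : Fin m → ℝ) (y y' : Fin n → ℝ) :
    Fin.append x y + Fin.append x' y' = Fin.append (x + x') (y + y') := by
  ext j
  refine Fin.addCases (fun j => ?_) (fun j => ?_) j <;> simp

theorem smul_append (c : ℝ) (x : Fin m → ℝ) (y : Fin n → ℝ) :
    c • Fin.append x y = Fin.append (c • x) (c • y) := by
  ext j
  refine Fin.addCases (fun j => ?_) (fun j => ?_) j <;> simp

/-- The second components add up to `α y₁ + β y₂`, which is `α + β` times a convex combination of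
`y₁` and `y₂`. If `α + β = 0`, both coefficients vanish and any point of `Y` will do. -/
theorem convex_scaledExtension {X : Set (Fin m → ℝ)} {a : Fin m → ℕ} {Y : Set (Fin n → ℝ)}
    (hX : Convex ℝ X) (hY : Convex ℝ Y) (hnn : ∀ x ∈ X, 0 ≤ dotNat a x) :
    Convex ℝ (scaledExtension X (dotNat a) Y) := by
  rintro _ ⟨x₁, hx₁, y₁, hy₁, rfl⟩ _ ⟨x₂, hx₂, y₂, hy₂, rfl⟩ c d hc hd hcd
  refine ⟨c • x₁ + d • x₂, hX hx₁ hx₂ hc hd hcd, ?_⟩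
  rw [smul_append, smul_append, append_add, dotNat_add, dotNat_smul, dotNat_smul, smul_smul,
    smul_smul]
  have h₁ := mul_nonneg hc (hnn x₁ hx₁)
  have h₂ := mul_nonneg hd (hnn x₂ hx₂)
  set α := c * dotNat a x₁
  set β := d * dotNat a x₂
  rcases (add_nonneg h₁ h₂).eq_or_lt with h | h
  · have hα : α = 0 := by linarith
    have hβ : β = 0 := by linarith
    exact ⟨y₁, hy₁, by simp [hα, hβ]⟩
  · refine ⟨(α / (α + β)) • y₁ + (β / (α + β)) • y₂,
      hY hy₁ hy₂ (by positivity) (by positivity) (by field_simp), ?_⟩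
    rw [smul_add, smul_smul, smul_smul, mul_div_cancel₀ _ h.ne', mul_div_cancel₀ _ h.ne']

/-- What is kept track of for the sets in a chain. -/
structure GoodSet {d : ℕ} (X : Set (Fin d → ℝ)) : Prop where
  nonempty : X.Nonempty
  compact : IsCompact X
  convex : Convex ℝ X
  nonneg : ∀ x ∈ X, ∀ j, 0 ≤ x j

theorem GoodSet.singleton_one (d : ℕ) : GoodSet ({fun _ => 1} : Set (Fin d → ℝ)) :=
  ⟨Set.singleton_nonempty _, isCompact_singleton, convex_singleton _, by simp⟩

theorem GoodSet.stdSimplex {s : ℕ} (hs : s ≠ 0) : GoodSet (stdSimplex ℝ (Fin s)) := by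
  refine ⟨?_, isCompact_stdSimplex ℝ _, convex_stdSimplex ℝ _, fun x hx => hx.1⟩
  exact ⟨_, single_mem_stdSimplex ℝ (⟨0, Nat.pos_of_ne_zero hs⟩ : Fin s)⟩

theorem GoodSet.extensionDefined {X : Set (Fin m → ℝ)} {Y : Set (Fin n → ℝ)} (hX : GoodSet X)
    (hY : GoodSet Y) (a : Fin m → ℕ) : ScaledExtensionDefined X (dotNat a) Y :=
  ⟨hX.nonempty, hX.compact, hX.convex, hY.nonempty, hY.compact, hY.convex,
    fun x hx => dotNat_nonneg a (hX.nonneg x hx)⟩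

/-- Nonnegativity of all coordinates is carried along because it makes every later functional with
natural coefficients nonnegative. -/
theorem GoodSet.scaledExtension {X : Set (Fin m → ℝ)} {Y : Set (Fin n → ℝ)} (hX : GoodSet X)
    (hY : GoodSet Y) (a : Fin m → ℕ) : GoodSet (scaledExtension X (dotNat a) Y) := by
  have hnn : ∀ x ∈ X, 0 ≤ dotNat a x := fun x hx => dotNat_nonneg a (hX.nonneg x hx)
  refine ⟨?_, isCompact_scaledExtension hX.compact hY.compact,
    convex_scaledExtension hX.convex hY.convex hnn, ?_⟩
  · obtain ⟨x, hx⟩ := hX.nonempty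
    obtain ⟨y, hy⟩ := hY.nonempty
    exact ⟨_, x, hx, y, hy, rfl⟩
  · rintro _ ⟨x, hx, y, hy, rfl⟩ j
    refine Fin.addCases (fun j => ?_) (fun j => ?_) j
    · simpa using hX.nonneg x hx j
    · simpa using mul_nonneg (hnn x hx) (hY.nonneg y hy j)

theorem append_mem_scaledExtension {X : Set (Fin m → ℝ)} {h : (Fin m → ℝ) → ℝ}
    {Y : Set (Fin n → ℝ)} {x : Fin m → ℝ} {z : Fin n → ℝ} :
    Fin.append x z ∈ scaledExtension X h Y ↔ x ∈ X ∧ ∃ y ∈ Y, z = h x • y := by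
  constructor
  · rintro ⟨x', hx', y, hy, h⟩
    obtain rfl : x = x' := funext fun j => by simpa using congrFun h (Fin.castAdd n j)
    obtain rfl := show z = _ from funext fun j => by simpa using congrFun h (Fin.natAdd m j)
    exact ⟨hx', y, hy, rfl⟩
  · rintro ⟨hx, y, hy, rfl⟩
    exact ⟨x, hx, y, hy, rfl⟩

/-- For `c > 0` divide by `c`; for `c = 0` the right side forces `z = 0`, and a point of the simplex
is needed. With `s = 0` the simplex is empty and the equivalence would fail at `c = 0`. -/
theorem exists_smul_mem_stdSimplex_iff {s : ℕ} (hs : s ≠ 0) {c : ℝ} (hc : 0 ≤ c)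
    {z : Fin s → ℝ} :
    (∃ y ∈ stdSimplex ℝ (Fin s), z = c • y) ↔ (∀ j, 0 ≤ z j) ∧ ∑ j, z j = c := by
  constructor
  · rintro ⟨y, hy, rfl⟩
    exact ⟨fun j => mul_nonneg hc (hy.1 j), by simp [← Finset.mul_sum, hy.2]⟩
  · rintro ⟨hz, hsum⟩
    rcases hc.eq_or_lt with rfl | hc
    · obtain ⟨y, hy⟩ := (GoodSet.stdSimplex hs).nonempty
      refine ⟨y, hy, ?_⟩
      ext j
      simpa using (Finset.sum_eq_zero_iff_of_nonneg fun j _ => hz j).1 hsum j (Finset.mem_univ j)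
    · refine ⟨c⁻¹ • z, ⟨fun j => mul_nonneg (inv_nonneg.2 hc.le) (hz j), ?_⟩, ?_⟩
      · simp [← Finset.mul_sum, hsum, hc.ne']
      · rw [smul_smul, mul_inv_cancel₀ hc.ne', one_smul]

end ScaledExtension

/-! ### Chains as systems of conditions on the entries -/

namespace IndexedChain

variable {I A : Type*}

/-- The entries `f` satisfy all the conditions that the expression imposes. -/
def Holds (D : IndexedChain I A) (f : SeqPair I A → ℝ) : Prop := f ∘ D.index ∈ D.chain.toSet

/-- The expression makes sense, and no entry is filled in twice. -/
structure Valid (D : IndexedChain I A) : Prop where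
  injective : Function.Injective D.index
  wellDefined : D.chain.WellDefined
  good : GoodSet D.chain.toSet

theorem valid_init : (init I A).Valid :=
  ⟨fun i j _ => Subsingleton.elim (α := Fin 1) i j, trivial, GoodSet.singleton_one 1⟩

theorem holds_init {f : SeqPair I A → ℝ} : (init I A).Holds f ↔ f (none, none) = 1 := by
  constructor
  · exact fun h => congrFun (h : _ = _) (0 : Fin 1)
  · exact fun h => funext fun _ => h

theorem ofFn_index_split (D : IndexedChain I A) (source : SeqPair I A) (new : List (SeqPair I A)) :
    List.ofFn (D.split source new).index = List.ofFn D.index ++ new := by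
  change List.ofFn (Fin.append D.index new.get) = _
  rw [List.ofFn_fin_append, List.ofFn_get]

theorem ofFn_index_sum (D : IndexedChain I A) (sources : List (SeqPair I A)) (new : SeqPair I A) :
    List.ofFn (D.sum sources new).index = List.ofFn D.index ++ [new] := by
  change List.ofFn (Fin.append D.index (fun _ : Fin 1 => new)) = _
  rw [List.ofFn_fin_append]
  simp

theorem comp_append {m n : ℕ} (f : SeqPair I A → ℝ) (a : Fin m → SeqPair I A)
    (b : Fin n → SeqPair I A) : f ∘ Fin.append a b = Fin.append (f ∘ a) (f ∘ b) := by
  ext j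
  refine Fin.addCases (fun j => ?_) (fun j => ?_) j <;> simp

open Classical in
-- No pair indexes two coordinates and none is listed twice, so the indicator vector counts each
-- listed entry exactly once.
theorem dotNat_mem_list (D : IndexedChain I A) (hD : Function.Injective D.index)
    {l : List (SeqPair I A)} (hl : l.Nodup) (hsub : ∀ q ∈ l, q ∈ Set.range D.index)
    (f : SeqPair I A → ℝ) :
    dotNat (fun j => if D.index j ∈ l then 1 else 0) (f ∘ D.index) = (l.map f).sum := by
  rw [← List.sum_toFinset f hl, dotNat]
  simp only [Nat.cast_ite, Nat.cast_one, Nat.cast_zero, ite_mul, one_mul, zero_mul,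
    Function.comp_apply]
  rw [← Finset.sum_filter, ← Finset.sum_image (f := f) (g := D.index) hD.injOn]
  refine Finset.sum_congr ?_ fun _ _ => rfl
  ext q
  simp only [Finset.mem_image, Finset.mem_filter, Finset.mem_univ, true_and, List.mem_toFinset]
  constructor
  · rintro ⟨j, hj, rfl⟩
    exact hj
  · intro hq
    obtain ⟨j, rfl⟩ := hsub q hq
    exact ⟨j, hq, rfl⟩

theorem Valid.split {D : IndexedChain I A} (hD : D.Valid) {source : SeqPair I A}
    {new : List (SeqPair I A)} (hnew : new ≠ [])
    (hnd : (List.ofFn D.index ++ new).Nodup) : (D.split source new).Valid := by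
  have hY := GoodSet.stdSimplex (s := new.length) (by simpa using hnew)
  refine ⟨?_, ⟨hD.wellDefined, hD.good.extensionDefined hY _⟩, hD.good.scaledExtension hY _⟩
  rw [← List.nodup_ofFn, ofFn_index_split]
  exact hnd

theorem Valid.sum {D : IndexedChain I A} (hD : D.Valid) {sources : List (SeqPair I A)}
    {new : SeqPair I A} (hnd : (List.ofFn D.index ++ [new]).Nodup) : (D.sum sources new).Valid := by
  have hY := GoodSet.singleton_one 1
  refine ⟨?_, ⟨hD.wellDefined, hD.good.extensionDefined hY _⟩, hD.good.scaledExtension hY _⟩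
  rw [← List.nodup_ofFn, ofFn_index_sum]
  exact hnd

theorem Valid.holds_split {D : IndexedChain I A} (hD : D.Valid) {source : SeqPair I A}
    {new : List (SeqPair I A)} (hnew : new ≠ []) (hs : source ∈ Set.range D.index)
    {f : SeqPair I A → ℝ} : (D.split source new).Holds f ↔
      D.Holds f ∧ (∀ q ∈ new, 0 ≤ f q) ∧ (new.map f).sum = f source := by
  classical
  change f ∘ Fin.append D.index new.get ∈ scaledExtension D.chain.toSet _ (stdSimplex ℝ _) ↔ _
  rw [comp_append, append_mem_scaledExtension]
  refine and_congr_right fun hf => ?_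
  have hdot := D.dotNat_mem_list hD.injective (List.nodup_singleton source) (by simpa using hs) f
  simp only [List.mem_singleton, List.map_cons, List.map_nil, List.sum_cons, List.sum_nil,
    add_zero] at hdot
  have hnn : 0 ≤ f source := by
    obtain ⟨j, rfl⟩ := hs
    exact hD.good.nonneg _ hf j
  rw [show dotNat _ (f ∘ D.index) = f source by convert hdot,
    exists_smul_mem_stdSimplex_iff (by simpa using hnew) hnn]
  refine and_congr ?_ ?_
  · simp [List.forall_mem_iff_get]
  · have : ∑ j : Fin new.length, f (new.get j) = (new.map f).sum := by
      conv_rhs => rw [← List.ofFn_get new, List.map_ofFn, List.sum_ofFn]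
      rfl
    simp only [Function.comp_apply, this]

theorem Valid.holds_sum {D : IndexedChain I A} (hD : D.Valid) {sources : List (SeqPair I A)}
    {new : SeqPair I A} (hnd : sources.Nodup) (hs : ∀ q ∈ sources, q ∈ Set.range D.index)
    {f : SeqPair I A → ℝ} : (D.sum sources new).Holds f ↔
      D.Holds f ∧ f new = (sources.map f).sum := by
  classical
  change f ∘ Fin.append D.index (fun _ : Fin 1 => new) ∈
    scaledExtension D.chain.toSet _ {fun _ => 1} ↔ _
  rw [comp_append, append_mem_scaledExtension]
  refine and_congr_right fun hf => ?_
  rw [show dotNat _ (f ∘ D.index) = (sources.map f).sum by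
    convert D.dotNat_mem_list hD.injective hnd hs f]
  constructor
  · rintro ⟨y, rfl, h⟩
    simpa using congrFun h 0
  · intro h
    exact ⟨_, rfl, funext fun _ => by simpa using h⟩

end IndexedChain

/-! ## Correctness of the algorithm -/

theorem List.mem_ofFn_iff_mem_range {α : Type*} {n : ℕ} {f : Fin n → α} {x : α} :
    x ∈ List.ofFn f ↔ x ∈ Set.range f := List.mem_ofFn

section Correctness

variable {I A : Type*} {G : EFG I A} {ord : I → List A}

theorem IsBody.fill_perm (hG : G.PerfectRecall) (hord : IsActionOrder G ord) {p : SeqPair I A}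
    {body : List (Operation I A)} (h : IsBody G ord p body) (hp : G.Relevant p) :
    (body.flatMap (Operation.fill G)).Perm (G.belowList p) := by
  obtain ⟨i, s, t, star, Js, Ks, rfl, hc, rfl⟩ := isBody_iff.1 h
  exact hc.fill_callBody_perm hG hord hp

theorem IsBody.ready (hG : G.PerfectRecall) (hord : IsActionOrder G ord) {p : SeqPair I A}
    {body : List (Operation I A)} (h : IsBody G ord p body) (hp : G.Relevant p)
    {S : Set (SeqPair I A)} (hS : p ∈ S) : Ready G S body := by
  obtain ⟨i, s, t, star, Js, Ks, rfl, hc, rfl⟩ := isBody_iff.1 h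
  exact hc.ready_callBody hG hord hp hS

theorem IsBody.equations_iff (hG : G.PerfectRecall) (hord : IsActionOrder G ord) {p : SeqPair I A}
    {body : List (Operation I A)} (h : IsBody G ord p body) (hp : G.Relevant p)
    {f : SeqPair I A → ℝ} :
    (∀ op ∈ body, op.Equations G f) ↔ (Operation.call p).Equations G f := by
  obtain ⟨i, s, t, star, Js, Ks, rfl, hc, rfl⟩ := isBody_iff.1 h
  exact ⟨hc.equations_call_of_callBody hG hord hp, hc.equations_callBody_of_call hG hord hp⟩

theorem IsBody.weight_lt (hG : G.PerfectRecall) (hord : IsActionOrder G ord) {p : SeqPair I A}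
    {body : List (Operation I A)} (h : IsBody G ord p body) (hp : G.Relevant p) :
    (body.map (Operation.weight G)).sum < (Operation.call p).weight G := by
  obtain ⟨i, s, t, star, Js, Ks, rfl, hc, rfl⟩ := isBody_iff.1 h
  exact hc.weight_callBody_le hG hord hp

/-- A call enters the induction only through three facts about its body, whatever choices were made
in it: it fills in the same entries up to order, it is ready, and its equations are equivalent to
those of the call. -/
theorem Executes.spec (hG : G.PerfectRecall) (hord : IsActionOrder G ord)
    {ts : List (Operation I A)} {D D' : IndexedChain I A} (h : Executes G ord ts D D') :
    D.Valid → Ready G (Set.range D.index) ts →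
    (List.ofFn D.index ++ ts.flatMap (Operation.fill G)).Nodup →
    D'.Valid ∧ (List.ofFn D'.index).Perm (List.ofFn D.index ++ ts.flatMap (Operation.fill G)) ∧
      ∀ f, D'.Holds f ↔ D.Holds f ∧ ∀ op ∈ ts, op.Equations G f := by
  induction h with
  | nil D => exact fun hD _ _ => ⟨hD, by simp, by simp⟩
  | @split source new ts D D' _ ih =>
    intro hD hR hnd
    rw [List.flatMap_cons, ← List.append_assoc] at hnd
    obtain ⟨hwf, hneeds, hR⟩ := hR
    have hs : source ∈ Set.range D.index := hneeds _ (List.mem_singleton_self _)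
    have hD' := hD.split (source := source) hwf (hnd.sublist (List.sublist_append_left _ _))
    have hidx := D.ofFn_index_split source new
    obtain ⟨h₁, h₂, h₃⟩ := ih hD' (hR.mono fun q hq => by
      rw [← List.mem_ofFn_iff_mem_range, hidx, List.mem_append]
      exact hq.imp List.mem_ofFn_iff_mem_range.2 id) (by rw [hidx]; exact hnd)
    refine ⟨h₁, ?_, fun f => ?_⟩
    · rw [hidx, List.append_assoc] at h₂
      exact h₂
    · rw [h₃, hD.holds_split hwf hs, List.forall_mem_cons, and_assoc]
      rfl
  | @sum sources new ts D D' _ ih =>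
    intro hD hR hnd
    rw [List.flatMap_cons, ← List.append_assoc] at hnd
    obtain ⟨hwf, hneeds, hR⟩ := hR
    have hD' := hD.sum (sources := sources) (hnd.sublist (List.sublist_append_left _ _))
    have hidx := D.ofFn_index_sum sources new
    obtain ⟨h₁, h₂, h₃⟩ := ih hD' (hR.mono fun q hq => by
      rw [← List.mem_ofFn_iff_mem_range, hidx, List.mem_append]
      exact hq.imp List.mem_ofFn_iff_mem_range.2 id) (by rw [hidx]; exact hnd)
    refine ⟨h₁, ?_, fun f => ?_⟩
    · rw [hidx, List.append_assoc] at h₂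
      exact h₂
    · rw [h₃, hD.holds_sum hwf hneeds, List.forall_mem_cons, and_assoc]
      rfl
  | @call p body ts D D' D'' hb _ _ ih₁ ih₂ =>
    intro hD hR hnd
    rw [List.flatMap_cons, ← List.append_assoc] at hnd
    obtain ⟨hwf, hneeds, hR⟩ := hR
    have hperm : (List.ofFn D.index ++ body.flatMap (Operation.fill G)).Perm
        (List.ofFn D.index ++ (Operation.call p).fill G) :=
      (hb.fill_perm hG hord hwf).append_left _
    obtain ⟨h₁, h₂, h₃⟩ := ih₁ hD (hb.ready hG hord hwf (hneeds _ (List.mem_singleton_self _)))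
      (hperm.nodup_iff.2 (hnd.sublist (List.sublist_append_left _ _)))
    have h₂ := h₂.trans hperm
    obtain ⟨h₄, h₅, h₆⟩ := ih₂ h₁ (hR.mono fun q hq => by
      rw [← List.mem_ofFn_iff_mem_range, h₂.mem_iff, List.mem_append]
      exact hq.imp List.mem_ofFn_iff_mem_range.2 id) ((h₂.append_right _).nodup_iff.2 hnd)
    refine ⟨h₄, ?_, fun f => ?_⟩
    · have := h₅.trans (h₂.append_right _)
      rw [List.append_assoc] at this
      exact this
    · rw [h₆, h₃, hb.equations_iff hG hord hwf, List.forall_mem_cons, and_assoc]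

theorem EFG.relevant_none (G : EFG I A) : G.Relevant (none, none) := ⟨trivial, trivial, by simp⟩

theorem ofFn_index_init : List.ofFn (IndexedChain.init I A).index = [(none, none)] := by
  simp [IndexedChain.init]

theorem mem_none_cons_belowList (hG : G.PerfectRecall) (q : SeqPair I A) :
    q ∈ (none, none) :: G.belowList (none, none) ↔ G.Relevant q := by
  rw [List.mem_cons, EFG.mem_belowList]
  constructor
  · rintro (rfl | hq)
    · exact G.relevant_none
    · exact hq.1
  · intro hq
    by_cases h : q = (none, none)
    · exact Or.inl h
    · exact Or.inr ⟨hq, hG.descends_none _, hG.descends_none _, h⟩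

theorem nodup_none_cons_belowList (G : EFG I A) :
    ((none, none) :: G.belowList (none, none)).Nodup :=
  List.nodup_cons.2 ⟨fun h => (EFG.mem_belowList.1 h).2.2.2 rfl, EFG.nodup_belowList _⟩

/-- `Executes.spec` for the root call: the entries filled in are `(∅, ∅)` and everything below it,
that is, all relevant pairs. -/
theorem DecomposeResult.isDecomposition (hG : G.PerfectRecall) {D : IndexedChain I A}
    (h : DecomposeResult G D) : IsDecomposition G D := by
  obtain ⟨ord, hord, h⟩ := h
  have hstart : List.ofFn (IndexedChain.init I A).index ++
      [Operation.call (none, none)].flatMap (Operation.fill G) =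
        (none, none) :: G.belowList (none, none) := by
    simp [ofFn_index_init, Operation.fill]
  obtain ⟨hD, hperm, hH⟩ := h.spec hG hord IndexedChain.valid_init
    ⟨G.relevant_none, by simpa [Operation.needs] using ⟨(0 : Fin 1), rfl⟩, trivial⟩
    (by rw [hstart]; exact nodup_none_cons_belowList G)
  rw [hstart] at hperm
  have hmem : ∀ q, q ∈ Set.range D.index ↔ G.Relevant q := fun q => by
    rw [← List.mem_ofFn_iff_mem_range, hperm.mem_iff, mem_none_cons_belowList hG]
  let e : Fin D.dim ≃ G.RelevantPair := Equiv.ofBijective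
    (fun j => ⟨D.index j, (hmem _).1 ⟨j, rfl⟩⟩)
    ⟨fun j k h => hD.injective (congrArg Subtype.val h), fun ⟨q, hq⟩ => by
      obtain ⟨j, hj⟩ := (hmem q).2 hq
      exact ⟨j, Subtype.ext hj⟩⟩
  have hkey : ∀ f : SeqPair I A → ℝ,
      f ∘ D.index ∈ D.chain.toSet ↔ (fun p : G.RelevantPair => f p) ∈ G.correlationPlans := by
    intro f
    rw [EFG.mem_correlationPlans_iff hG]
    refine (hH f).trans ?_
    rw [IndexedChain.holds_init]
    simp
  refine ⟨hD.wellDefined, e, fun j => rfl, ?_⟩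
  -- The conditions are stated for functions on all pairs, so a vector on relevant pairs is extended
  -- by 0; the values elsewhere are never read.
  have hsurj : ∀ ξ : G.RelevantPair → ℝ, ∃ f : SeqPair I A → ℝ,
      (fun p : G.RelevantPair => f p) = ξ := fun ξ =>
    ⟨Function.extend Subtype.val ξ 0, funext fun p => Subtype.val_injective.extend_apply ξ 0 p⟩
  ext x
  constructor
  · intro hx
    obtain ⟨f, hf⟩ := hsurj (x ∘ e.symm)
    have hfx : f ∘ D.index = x := by
      ext j
      exact (congrFun hf (e j)).trans (by simp)
    refine ⟨_, (hkey f).1 (hfx ▸ hx), ?_⟩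
    exact hfx
  · rintro ⟨ξ, hξ, rfl⟩
    obtain ⟨f, rfl⟩ := hsurj ξ
    exact (hkey f).2 hξ

/-! ### Existence of a run -/

theorem Executes.append {ts us : List (Operation I A)} {D D' : IndexedChain I A}
    (h : Executes G ord (ts ++ us) D D') :
    ∃ D₁, Executes G ord ts D D₁ ∧ Executes G ord us D₁ D' := by
  generalize hv : ts ++ us = vs at h
  induction h generalizing ts with
  | nil D =>
    obtain ⟨rfl, rfl⟩ := List.append_eq_nil_iff.1 hv
    exact ⟨D, .nil D, .nil D⟩
  | @split source new vs D D' h ih =>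
    rcases ts with _ | ⟨op, ts⟩
    · obtain rfl := hv
      exact ⟨D, .nil D, .split h⟩
    · obtain ⟨rfl, hv'⟩ := List.cons.inj hv
      obtain ⟨D₁, h₁, h₂⟩ := ih hv'
      exact ⟨D₁, .split h₁, h₂⟩
  | @sum sources new vs D D' h ih =>
    rcases ts with _ | ⟨op, ts⟩
    · obtain rfl := hv
      exact ⟨D, .nil D, .sum h⟩
    · obtain ⟨rfl, hv'⟩ := List.cons.inj hv
      obtain ⟨D₁, h₁, h₂⟩ := ih hv'
      exact ⟨D₁, .sum h₁, h₂⟩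
  | @call p body vs D D' D'' hb h h' _ ih =>
    rcases ts with _ | ⟨op, ts⟩
    · obtain rfl := hv
      exact ⟨D, .nil D, .call hb h h'⟩
    · obtain ⟨rfl, hv'⟩ := List.cons.inj hv
      obtain ⟨D₁, h₁, h₂⟩ := ih hv'
      exact ⟨D₁, .call hb h h₁, h₂⟩

/-- Pushing the body of a call on the stack of pending operations has the effect of the recursive
call; this flattens the recursion. -/
theorem Executes.call_of_append {p : SeqPair I A} {body ts : List (Operation I A)}
    {D D' : IndexedChain I A} (hb : IsBody G ord p body)
    (h : Executes G ord (body ++ ts) D D') : Executes G ord (.call p :: ts) D D' := by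
  obtain ⟨D₁, h₁, h₂⟩ := h.append
  exact .call hb h₁ h₂

/-- One step of a stack machine that executes the algorithm. -/
noncomputable def machineStep (body : SeqPair I A → List (Operation I A)) :
    List (Operation I A) × IndexedChain I A → List (Operation I A) × IndexedChain I A
  | ([], D) => ([], D)
  | (.call p :: ts, D) => (body p ++ ts, D)
  | (.split source new :: ts, D) => (ts, D.split source new)
  | (.sum sources new :: ts, D) => (ts, D.sum sources new)

variable {body : SeqPair I A → List (Operation I A)}

theorem executes_of_machineStep (hbody : ∀ p, IsBody G ord p (body p)) {n : ℕ}
    {ts : List (Operation I A)} {D : IndexedChain I A}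
    (h : ((machineStep body)^[n] (ts, D)).1 = []) :
    Executes G ord ts D ((machineStep body)^[n] (ts, D)).2 := by
  induction n generalizing ts D with
  | zero =>
    obtain rfl : ts = [] := h
    exact .nil D
  | succ n ih =>
    rw [Function.iterate_succ_apply] at h ⊢
    rcases ts with _ | ⟨op | ⟨source, new⟩ | ⟨sources, new⟩, ts⟩
    · exact ih h
    · exact .call_of_append (hbody _) (ih h)
    · exact .split (ih h)
    · exact .sum (ih h)

/-- The invariant of the stack machine: the called pairs are relevant, the total number of entries
that have been filled in or will be filled in is constant, and the weight goes down. -/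
structure MachineInvariant (G : EFG I A) (n : ℕ)
    (x : List (Operation I A) × IndexedChain I A) : Prop where
  relevant : ∀ p, .call p ∈ x.1 → G.Relevant p
  dim : x.2.dim + (x.1.flatMap (Operation.fill G)).length =
    ((none, none) :: G.belowList (none, none)).length
  weight : x.1 = [] ∨
    (x.1.map (Operation.weight G)).sum + n ≤ (Operation.call (none, none)).weight G

theorem MachineInvariant.step (hG : G.PerfectRecall) (hord : IsActionOrder G ord)
    (hbody : ∀ p, IsBody G ord p (body p)) {n : ℕ}
    {x : List (Operation I A) × IndexedChain I A} (h : MachineInvariant G n x) :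
    MachineInvariant G (n + 1) (machineStep body x) := by
  obtain ⟨ts, D⟩ := x
  obtain ⟨h₁, h₂, h₃⟩ := h
  rcases ts with _ | ⟨p | ⟨source, new⟩ | ⟨sources, new⟩, ts⟩
  · exact ⟨h₁, h₂, Or.inl rfl⟩
  · have hp := h₁ p (by simp)
    have hlen := ((hbody p).fill_perm hG hord hp).length_eq
    have hw := (hbody p).weight_lt hG hord hp
    refine ⟨fun q hq => ?_, ?_, ?_⟩
    · rcases List.mem_append.1 hq with hq | hq
      -- The calls inside a body are at relevant pairs because readiness includes well-formedness.
      · have := (hbody p).ready hG hord hp (Set.mem_singleton p)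
        obtain ⟨l₁, l₂, hl⟩ := List.append_of_mem hq
        rw [hl, ready_append] at this
        exact this.2.1
      · exact h₁ q (List.mem_cons_of_mem _ hq)
    · simp only [List.flatMap_cons, List.length_append, machineStep, List.flatMap_append,
        Operation.fill] at h₂ ⊢
      omega
    · right
      simp only [reduceCtorEq, false_or, List.map_cons, List.sum_cons, machineStep,
        List.map_append, List.sum_append] at h₃ ⊢
      omega
  · refine ⟨fun q hq => h₁ q (List.mem_cons_of_mem _ hq), ?_, Or.inr ?_⟩
    · simp only [List.flatMap_cons, List.length_append, machineStep, IndexedChain.split,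
        Operation.fill] at h₂ ⊢
      omega
    · simp only [reduceCtorEq, false_or, List.map_cons, List.sum_cons, machineStep,
        Operation.weight] at h₃ ⊢
      omega
  · refine ⟨fun q hq => h₁ q (List.mem_cons_of_mem _ hq), ?_, Or.inr ?_⟩
    · simp only [List.flatMap_cons, List.length_append, machineStep, IndexedChain.sum,
        Operation.fill, List.length_cons, List.length_nil] at h₂ ⊢
      omega
    · simp only [reduceCtorEq, false_or, List.map_cons, List.sum_cons, machineStep,
        Operation.weight] at h₃ ⊢
      omega

theorem machineInvariant_iterate (hG : G.PerfectRecall) (hord : IsActionOrder G ord)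
    (hbody : ∀ p, IsBody G ord p (body p)) (n : ℕ) :
    MachineInvariant G n ((machineStep body)^[n]
      ([.call (none, none)], IndexedChain.init I A)) := by
  induction n with
  | zero =>
    refine ⟨by simp [G.relevant_none], ?_, Or.inr (by simp)⟩
    simp [IndexedChain.init, Operation.fill, add_comm]
  | succ n ih =>
    rw [Function.iterate_succ_apply']
    exact ih.step hG hord hbody

/-- As long as the stack is nonempty, the remaining weight plus the number of steps is bounded by
the initial weight; one step more than that weight is impossible. -/
theorem exists_machine_halts (hG : G.PerfectRecall) (hord : IsActionOrder G ord)
    (hbody : ∀ p, IsBody G ord p (body p)) :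
    ∃ n ≤ (Operation.call (none, none)).weight G + 1, ((machineStep body)^[n]
      ([.call (none, none)], IndexedChain.init I A)).1 = [] := by
  refine ⟨_, le_rfl, ?_⟩
  rcases (machineInvariant_iterate hG hord hbody
    ((Operation.call (none, none)).weight G + 1)).weight with h | h
  · exact h
  · omega

theorem length_none_cons_belowList_le (hG : G.PerfectRecall) :
    ((none, none) :: G.belowList (none, none)).length ≤ G.nodes.card ^ 2 := by
  classical
  refine le_trans (le_of_eq ?_) (EFG.card_relevantPair_le (G := G))
  rw [← List.toFinset_card_of_nodup (nodup_none_cons_belowList G)]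
  exact (Nat.subtype_card _ fun q => by
    rw [List.mem_toFinset, mem_none_cons_belowList hG]).symm

end Correctness

/-! ### A canonical choice of the bodies -/

section Canonical

variable {I A : Type*} (G : EFG I A) (ord : I → List A) (infosets : List I)

open Classical in
/-- The critical information sets. -/
noncomputable def criticalList (i : Player) (s t : Sequence I A) : List I :=
  infosets.filter fun J => G.Critical i s t J

open Classical in
/-- The order of the first loop. -/
noncomputable def ownList (i : Player) (s t : Sequence I A) : List I :=
  infosets.filter fun J => G.player J = i ∧ G.parentSeq J = s ∧ G.SeqInfosetRelevant t J

open Classical in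
/-- The order of the second loop: sorted by the length of the own history. -/
noncomputable def opponentList (i : Player) (s t : Sequence I A) : List I :=
  (List.range (G.nodes.card + 1)).flatMap fun d => infosets.filter fun K =>
    (G.hist K).length = d ∧ G.player K = i.opp ∧ G.Descends (G.parentSeq K) t ∧
      G.SeqInfosetRelevant s K

/-- The operations of a call, when player `i` is chosen. -/
noncomputable def playerBody (i : Player) (s t : Sequence I A) : List (Operation I A) :=
  callBody G ord i s t (criticalList G infosets i s t).head? (ownList G infosets i s t)
    (opponentList G infosets i s t)

open Classical in
/-- The operations of a call. -/
noncomputable def canonicalBody (p : SeqPair I A) : List (Operation I A) :=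
  if (criticalList G infosets .one p.1 p.2).tail = [] then
    playerBody G ord infosets .one p.1 p.2
  else playerBody G ord infosets .two p.2 p.1

variable {G ord infosets}

theorem hist_length_le (J : I) : (G.hist J).length ≤ G.nodes.card :=
  (EFG.length_ownHistory_le _ _).trans (EFG.length_lt_card_nodes (EFG.someNode_mem J)).le

/-- With at most one critical information set, the head of the list is exactly `I*`. Sorting by the
length of the history is top-down because `σ(J) ≻ σ(K)` makes the history of `J` strictly longer. -/
theorem isBody_playerBody (hG : G.PerfectRecall) (hnd : infosets.Nodup) (hall : ∀ J, J ∈ infosets)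
    {i : Player} {s t : Sequence I A} (hone : (criticalList G infosets i s t).tail = []) :
    IsBody G ord (mkPair i s t) (playerBody G ord infosets i s t) := by
  refine isBody_iff.2 ⟨i, s, t, _, _, _, rfl, ⟨?_, hnd.filter _, ?_, ?_, ?_, ?_⟩, rfl⟩
  · intro J
    have hmem : J ∈ criticalList G infosets i s t ↔ G.Critical i s t J := by
      simp [criticalList, hall]
    rw [← hmem]
    rcases h : criticalList G infosets i s t with _ | ⟨K, l⟩
    · simp
    · obtain rfl : l = [] := by simpa [h] using hone
      simp [eq_comm]
  · simp [hall]
  · rw [opponentList, List.nodup_flatMap]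
    refine ⟨fun d _ => hnd.filter _, List.nodup_range.imp fun {d d'} hne K hK hK' => hne ?_⟩
    simp only [List.mem_filter, decide_eq_true_eq] at hK hK'
    exact hK.2.1.symm.trans hK'.2.1
  · intro K
    simp only [opponentList, List.mem_flatMap, List.mem_filter, hall, true_and, List.mem_range,
      decide_eq_true_eq]
    constructor
    · rintro ⟨d, -, -, h⟩
      exact h
    · exact fun h => ⟨_, Nat.lt_succ_of_le (hist_length_le K), rfl, h⟩
  · rw [opponentList, List.flatMap_def, List.pairwise_flatten]
    have key : ∀ J K, (G.hist J).length ≤ (G.hist K).length →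
        ¬ (G.Descends (G.parentSeq J) (G.parentSeq K) ∧ G.parentSeq J ≠ G.parentSeq K) := by
      rintro J K hle ⟨hd, hne⟩
      rw [hG.descends_iff] at hd
      refine hne (EFG.chain_inj (hd.eq_of_length_le ?_)).symm
      rwa [hG.chain_parentSeq, hG.chain_parentSeq]
    constructor
    · simp only [List.mem_map]
      rintro _ ⟨d, -, rfl⟩
      -- Within one level only membership matters, as all histories there have the same length;
      -- hence the trivial relation.
      refine List.Pairwise.imp_of_mem (R := fun _ _ => True) (fun {J K} hJ hK _ => key J K ?_)
        (by simp [List.pairwise_iff_getElem])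
      simp only [List.mem_filter, decide_eq_true_eq] at hJ hK
      omega
    · rw [List.pairwise_map]
      refine List.pairwise_lt_range.imp fun {d d'} hlt J hJ K hK => key J K ?_
      simp only [List.mem_filter, decide_eq_true_eq] at hJ hK
      omega

theorem isBody_canonicalBody (hG : G.PerfectRecall) (hnd : infosets.Nodup)
    (hall : ∀ J, J ∈ infosets) (p : SeqPair I A) :
    IsBody G ord p (canonicalBody G ord infosets p) := by
  have htail : ∀ i s t, (∀ J K, G.Critical i s t J → G.Critical i s t K → J = K) →
      (criticalList G infosets i s t).tail = [] := by
    intro i s t h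
    have hnd' : (criticalList G infosets i s t).Nodup := hnd.filter _
    have hmem : ∀ J ∈ criticalList G infosets i s t, G.Critical i s t J := by
      simp [criticalList]
    rcases hl : criticalList G infosets i s t with _ | ⟨J, _ | ⟨K, l⟩⟩
    · rfl
    · rfl
    · rw [hl] at hnd' hmem
      have := h J K (hmem J (by simp)) (hmem K (by simp))
      simp [this] at hnd'
  rw [canonicalBody]
  split_ifs with h
  · exact isBody_playerBody hG hnd hall (i := .one) h
  · refine isBody_playerBody hG hnd hall (i := .two) ?_
    rcases hG.exists_critical_player .one p.1 p.2 with h' | h'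
    · exact absurd (htail _ _ _ h') h
    · exact htail _ _ _ h'

theorem exists_decomposeResult (hG : G.PerfectRecall) : ∃ D, DecomposeResult G D := by
  classical
  have := G.finite_infosets
  have := Fintype.ofFinite I
  have hord : IsActionOrder G fun J => (G.actions J).toList := fun J =>
    ⟨Finset.nodup_toList _, fun a => Finset.mem_toList⟩
  have hbody := isBody_canonicalBody (ord := fun J => (G.actions J).toList) hG
    (Finset.nodup_toList (Finset.univ : Finset I)) (fun J => by simp)
  obtain ⟨n, -, hn⟩ := exists_machine_halts hG hord hbody
  exact ⟨_, _, hord, executes_of_machineStep hbody hn⟩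

end Canonical

/-! ## Polynomial time computations -/

/-- `g` is bounded by a polynomial in the size `N`. -/
def PolyBounded {Γ : Type} (N g : Γ → ℕ) : Prop := ∃ P : Polynomial ℕ, ∀ γ, g γ ≤ P.eval (N γ)

namespace PolyBounded

variable {Γ Δ : Type} {N g h : Γ → ℕ}

theorem const (c : ℕ) : PolyBounded N fun _ => c := ⟨Polynomial.C c, by simp⟩

theorem self : PolyBounded N N := ⟨Polynomial.X, by simp⟩

theorem add (hg : PolyBounded N g) (hh : PolyBounded N h) : PolyBounded N fun γ => g γ + h γ := by
  obtain ⟨P, hP⟩ := hg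
  obtain ⟨Q, hQ⟩ := hh
  exact ⟨P + Q, fun γ => by simpa using add_le_add (hP γ) (hQ γ)⟩

theorem mul (hg : PolyBounded N g) (hh : PolyBounded N h) : PolyBounded N fun γ => g γ * h γ := by
  obtain ⟨P, hP⟩ := hg
  obtain ⟨Q, hQ⟩ := hh
  exact ⟨P * Q, fun γ => by simpa using Nat.mul_le_mul (hP γ) (hQ γ)⟩

theorem mono (hg : PolyBounded N g) (h' : ∀ γ, h γ ≤ g γ) : PolyBounded N h := by
  obtain ⟨P, hP⟩ := hg
  exact ⟨P, fun γ => (h' γ).trans (hP γ)⟩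

theorem comp (hg : PolyBounded N g) (φ : Δ → Γ) :
    PolyBounded (fun δ => N (φ δ)) fun δ => g (φ δ) := by
  obtain ⟨P, hP⟩ := hg
  exact ⟨P, fun δ => hP _⟩

end PolyBounded

/-- `f` can be computed from `e` by one program, in time polynomial in `N`. -/
def Comp {Γ : Type} (N : Γ → ℕ) (e f : Γ → Data) : Prop :=
  ∃ (p : Prog) (P : Polynomial ℕ), ∀ γ, ∃ t ≤ P.eval (N γ), Eval p (e γ) (f γ) t

/-- First component. -/
def Data.head : Data → Data
  | .nil => .nil
  | .cons x _ => x

/-- Second component. -/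
def Data.tail : Data → Data
  | .nil => .nil
  | .cons _ y => y

open Classical in
/-- Encoding of truth values. -/
noncomputable def encodeProp (p : Prop) : Data := if p then .cons .nil .nil else .nil

theorem encodeProp_of_true {p : Prop} (h : p) : encodeProp p = .cons .nil .nil := by
  simp [encodeProp, h]

theorem encodeProp_of_false {p : Prop} (h : ¬ p) : encodeProp p = .nil := by
  simp [encodeProp, h]

theorem encodeProp_eq_nil {p : Prop} : encodeProp p = .nil ↔ ¬ p := by
  by_cases h : p <;> simp [encodeProp, h]

namespace Comp

variable {Γ Δ : Type} {N : Γ → ℕ} {e f g h : Γ → Data}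

theorem refl (N : Γ → ℕ) (e : Γ → Data) : Comp N e e :=
  ⟨.id, 1, fun γ => ⟨1, by simp, .id _⟩⟩

theorem trans (hf : Comp N e f) (hg : Comp N f g) : Comp N e g := by
  obtain ⟨p, P, hP⟩ := hf
  obtain ⟨q, Q, hQ⟩ := hg
  refine ⟨.seq p q, P + Q + 1, fun γ => ?_⟩
  obtain ⟨s, hs, h₁⟩ := hP γ
  obtain ⟨t, ht, h₂⟩ := hQ γ
  exact ⟨s + t + 1, by simpa using add_le_add hs ht, .seq h₁ h₂⟩

/-- One program serves all parameters, so restricting them to a subtype or substituting others costs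
nothing. -/
theorem reindex (hf : Comp N e f) (φ : Δ → Γ) :
    Comp (fun δ => N (φ δ)) (fun δ => e (φ δ)) fun δ => f (φ δ) := by
  obtain ⟨p, P, hP⟩ := hf
  exact ⟨p, P, fun δ => hP _⟩

theorem congr (hf : Comp N e f) (h : ∀ γ, f γ = g γ) : Comp N e g := by
  rwa [← funext h]

theorem nil : Comp N e fun _ => .nil := ⟨.nil, 1, fun γ => ⟨1, by simp, .nil _⟩⟩

theorem pair (hf : Comp N e f) (hg : Comp N e g) : Comp N e fun γ => .cons (f γ) (g γ) := by
  obtain ⟨p, P, hP⟩ := hf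
  obtain ⟨q, Q, hQ⟩ := hg
  refine ⟨.cons p q, P + Q + 1, fun γ => ?_⟩
  obtain ⟨s, hs, h₁⟩ := hP γ
  obtain ⟨t, ht, h₂⟩ := hQ γ
  exact ⟨s + t + 1, by simpa using add_le_add hs ht, .cons h₁ h₂⟩

theorem head (hf : Comp N e f) : Comp N e fun γ => (f γ).head := by
  refine hf.trans ⟨.head, 1, fun γ => ⟨1, by simp, ?_⟩⟩
  simp only
  rcases f γ with _ | ⟨x, y⟩
  · exact .head_nil
  · exact .head_cons x y

theorem tail (hf : Comp N e f) : Comp N e fun γ => (f γ).tail := by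
  refine hf.trans ⟨.tail, 1, fun γ => ⟨1, by simp, ?_⟩⟩
  simp only
  rcases f γ with _ | ⟨x, y⟩
  · exact .tail_nil
  · exact .tail_cons x y

theorem fst (hf : Comp N e fun γ => .cons (f γ) (g γ)) : Comp N e f := hf.head

theorem snd (hf : Comp N e fun γ => .cons (f γ) (g γ)) : Comp N e g := hf.tail

theorem const (d : Data) : Comp N e fun _ => d := by
  induction d with
  | nil => exact nil
  | cons x y hx hy => exact hx.pair hy

/-- Each branch has to be correct, and fast, only on the inputs that reach it. -/
theorem cases (hc : Comp N e f)
    (h₁ : Comp (fun γ : {γ // f γ ≠ .nil} => N γ) (fun γ => e γ) fun γ => g γ)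
    (h₂ : Comp (fun γ : {γ // f γ = .nil} => N γ) (fun γ => e γ) fun γ => g γ) : Comp N e g := by
  obtain ⟨r, R, hR⟩ := hc
  obtain ⟨p, P, hP⟩ := h₁
  obtain ⟨q, Q, hQ⟩ := h₂
  refine ⟨.cond r p q, R + P + Q + 1, fun γ => ?_⟩
  obtain ⟨s, hs, h₁⟩ := hR γ
  simp only [Polynomial.eval_add, Polynomial.eval_one]
  rcases hf : f γ with _ | ⟨x, y⟩
  · obtain ⟨t, ht, h₂⟩ := hQ ⟨γ, hf⟩
    exact ⟨s + t + 1, by simp only at ht; omega, .cond_false (hf ▸ h₁) h₂⟩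
  · obtain ⟨t, ht, h₂⟩ := hP ⟨γ, by simp [hf]⟩
    exact ⟨s + t + 1, by simp only at ht; omega, .cond_true (hf ▸ h₁) h₂⟩

theorem by_cases {p : Γ → Prop} (hc : Comp N e fun γ => encodeProp (p γ))
    (h₁ : Comp (fun γ : {γ // p γ} => N γ) (fun γ => e γ) fun γ => g γ)
    (h₂ : Comp (fun γ : {γ // ¬ p γ} => N γ) (fun γ => e γ) fun γ => g γ) : Comp N e g :=
  hc.cases
    (h₁.reindex fun γ : {γ // encodeProp (p γ) ≠ .nil} =>
      ⟨γ, not_not.1 (encodeProp_eq_nil.not.1 γ.2)⟩)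
    (h₂.reindex fun γ : {γ // encodeProp (p γ) = .nil} => ⟨γ, encodeProp_eq_nil.1 γ.2⟩)

/-- While loops whose number of iterations is bounded by a polynomial. -/
theorem whileLoop {σ : Γ → Type} {eσ : ∀ γ, σ γ → Data} {F : ∀ γ, σ γ → σ γ} {init : ∀ γ, σ γ}
    {c : ∀ γ, σ γ → Prop} (hinit : Comp N e fun γ => eσ γ (init γ))
    (hc : Comp (fun x : {x : Σ γ, σ γ // ∃ j, (F x.1)^[j] (init x.1) = x.2} => N x.1.1)
      (fun x => eσ x.1.1 x.1.2) fun x => encodeProp (c x.1.1 x.1.2))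
    (hF : Comp (fun x : {x : Σ γ, σ γ // c x.1 x.2 ∧ ∃ j, (F x.1)^[j] (init x.1) = x.2} =>
      N x.1.1) (fun x => eσ x.1.1 x.1.2) fun x => eσ x.1.1 (F x.1.1 x.1.2))
    {B : Γ → ℕ} (hB : PolyBounded N B) (hn : ∀ γ, ∃ n ≤ B γ, ¬ c γ ((F γ)^[n] (init γ))) :
    ∃ n : Γ → ℕ, (∀ γ, ¬ c γ ((F γ)^[n γ] (init γ))) ∧
      Comp N e fun γ => eσ γ ((F γ)^[n γ] (init γ)) := by
  classical
  have hn' : ∀ γ, ∃ n, ¬ c γ ((F γ)^[n] (init γ)) := fun γ => (hn γ).imp fun _ => And.right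
  -- The loop stops at the first state violating `c`, which may come before the bound given by `hn`.
  refine ⟨fun γ => Nat.find (hn' γ), fun γ => Nat.find_spec (hn' γ), hinit.trans ?_⟩
  obtain ⟨p, P, hP⟩ := hc
  obtain ⟨q, Q, hQ⟩ := hF
  obtain ⟨R, hR⟩ := hB
  refine ⟨.loop p q, (R + 1) * (P + Q + 1), fun γ => ?_⟩
  have hle : Nat.find (hn' γ) ≤ R.eval (N γ) := by
    obtain ⟨n, hnB, hn⟩ := hn γ
    exact (Nat.find_min' _ hn).trans (hnB.trans (hR γ))
  -- Here `k` is the number of iterations still to come; the `+ 1` pays for the last, failing test.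
  have key : ∀ k j, j + k = Nat.find (hn' γ) → ∃ t ≤ (k + 1) * (P.eval (N γ) + Q.eval (N γ) + 1),
      Eval (.loop p q) (eσ γ ((F γ)^[j] (init γ)))
        (eσ γ ((F γ)^[Nat.find (hn' γ)] (init γ))) t := by
    intro k
    induction k with
    | zero =>
      rintro j rfl
      obtain ⟨s, hs, h⟩ := hP ⟨⟨γ, (F γ)^[Nat.find (hn' γ)] (init γ)⟩, ⟨_, rfl⟩⟩
      simp only at h hs
      rw [encodeProp_of_false (Nat.find_spec (hn' γ))] at h
      exact ⟨s + 1, by omega, .loop_false h⟩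
    | succ k ih =>
      intro j hj
      have hcj : c γ ((F γ)^[j] (init γ)) := not_not.1 (Nat.find_min (hn' γ) (by omega))
      obtain ⟨t, ht, h⟩ := ih (j + 1) (by omega)
      obtain ⟨s, hs, h'⟩ := hP ⟨⟨γ, (F γ)^[j] (init γ)⟩, ⟨_, rfl⟩⟩
      obtain ⟨r, hr, h''⟩ := hQ ⟨⟨γ, (F γ)^[j] (init γ)⟩, hcj, ⟨_, rfl⟩⟩
      simp only at h' h'' hs hr
      rw [encodeProp_of_true hcj] at h'
      rw [Function.iterate_succ_apply'] at h
      refine ⟨s + r + t + 1, ?_, .loop_true h' h'' h⟩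
      have : (k + 1 + 1) * (P.eval (N γ) + Q.eval (N γ) + 1) =
        (k + 1) * (P.eval (N γ) + Q.eval (N γ) + 1) + (P.eval (N γ) + Q.eval (N γ) + 1) := by ring
      omega
  obtain ⟨t, ht, h⟩ := key _ 0 (Nat.zero_add _)
  refine ⟨t, ht.trans ?_, h⟩
  simp only [Polynomial.eval_mul, Polynomial.eval_add, Polynomial.eval_one]
  gcongr

/-! ### Truth values -/

theorem encodeProp_ne_nil (hf : Comp N e f) : Comp N e fun γ => encodeProp (f γ ≠ .nil) :=
  hf.cases ((const (.cons .nil .nil)).congr fun γ => (encodeProp_of_true γ.2).symm)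
    (nil.congr fun γ => (encodeProp_of_false (by simp [γ.2])).symm)

theorem true {p : Γ → Prop} (h : ∀ γ, p γ) : Comp N e fun γ => encodeProp (p γ) :=
  (const (.cons .nil .nil)).congr fun γ => (encodeProp_of_true (h γ)).symm

theorem false {p : Γ → Prop} (h : ∀ γ, ¬ p γ) : Comp N e fun γ => encodeProp (p γ) :=
  nil.congr fun γ => (encodeProp_of_false (h γ)).symm

theorem not {p : Γ → Prop} (hp : Comp N e fun γ => encodeProp (p γ)) :
    Comp N e fun γ => encodeProp (¬ p γ) :=
  hp.by_cases (false fun γ => not_not.2 γ.2) (true fun γ => γ.2)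

theorem and {p q : Γ → Prop} (hp : Comp N e fun γ => encodeProp (p γ))
    (hq : Comp N e fun γ => encodeProp (q γ)) : Comp N e fun γ => encodeProp (p γ ∧ q γ) :=
  hp.by_cases ((hq.reindex Subtype.val).congr fun γ => by simp [γ.2])
    (false fun γ h => γ.2 h.1)

theorem or {p q : Γ → Prop} (hp : Comp N e fun γ => encodeProp (p γ))
    (hq : Comp N e fun γ => encodeProp (q γ)) : Comp N e fun γ => encodeProp (p γ ∨ q γ) :=
  hp.by_cases (true fun γ => Or.inl γ.2) ((hq.reindex Subtype.val).congr fun γ => by simp [γ.2])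

open Classical in
theorem ite {p : Γ → Prop} (hp : Comp N e fun γ => encodeProp (p γ)) (hf : Comp N e f)
    (hg : Comp N e g) : Comp N e fun γ => if p γ then f γ else g γ :=
  hp.by_cases ((hf.reindex Subtype.val).congr fun γ => by simp [γ.2])
    ((hg.reindex Subtype.val).congr fun γ => by simp [γ.2])

end Comp

/-! ### Lists -/

theorem encodeList_map {α β : Type*} (f : β → Data) (g : α → β) (l : List α) :
    encodeList f (l.map g) = encodeList (fun x => f (g x)) l := by
  induction l with
  | nil => rfl
  | cons x l ih => simp [encodeList, ih]

theorem encodeList_ne_nil {α : Type*} {f : α → Data} {l : List α} :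
    encodeList f l ≠ .nil ↔ l ≠ [] := by
  cases l <;> simp [encodeList]

theorem encodeOption_eq {α : Type*} (f : α → Data) (o : Option α) :
    encodeOption f o = encodeList f o.toList := by
  cases o <;> rfl

theorem encodeNat_eq (n : ℕ) :
    encodeNat n = encodeList (fun _ : Unit => .nil) (List.replicate n ()) := by
  induction n with
  | zero => rfl
  | succ n ih => rw [encodeNat, ih]; rfl

theorem encodeNat_length {α : Type*} (l : List α) :
    encodeNat l.length = encodeList (fun _ => .nil) l := by
  induction l with
  | nil => rfl
  | cons x l ih => simp [encodeNat, encodeList, ih]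

/-- Contexts with one more variable, which ranges over a list. -/
abbrev ListExt {Γ : Type} {β : Γ → Type} (l : ∀ γ, List (β γ)) : Type := Σ γ, {b // b ∈ l γ}

namespace Comp

variable {Γ : Type} {N : Γ → ℕ} {e f g : Γ → Data} {β δ : Γ → Type} {l l' : ∀ γ, List (β γ)}
  {eβ : ∀ γ, β γ → Data} {eδ : ∀ γ, δ γ → Data}

theorem var : Comp N (fun γ => .cons (f γ) (g γ)) g := (refl _ _).snd

/-- The environment stays available as the first component of the input, so what was computable
before a variable was introduced remains so. -/
theorem weaken {d : ListExt l → Data} (h : Comp N e f) :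
    Comp (fun x : ListExt l => N x.1) (fun x => .cons (e x.1) (d x)) fun x => f x.1 :=
  (refl _ _).fst.trans (h.reindex Sigma.fst)

/-- The loop state consists of the environment, the accumulator and the unread part of the list.
Only the length of the list enters the bound; that the accumulator stays cheap is contained in `hF`,
which is uniform in it. -/
theorem foldl {σ : Γ → Type} {eσ : ∀ γ, σ γ → Data} {F : ∀ γ, σ γ → β γ → σ γ} {init : ∀ γ, σ γ}
    (hl : Comp N e fun γ => encodeList (eβ γ) (l γ)) (hlen : PolyBounded N fun γ => (l γ).length)
    (hinit : Comp N e fun γ => eσ γ (init γ))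
    (hF : Comp (fun x : Σ γ, σ γ × {b // b ∈ l γ} => N x.1)
      (fun x => .cons (e x.1) (.cons (eσ x.1 x.2.1) (eβ x.1 x.2.2)))
      fun x => eσ x.1 (F x.1 x.2.1 x.2.2)) :
    Comp N e fun γ => eσ γ ((l γ).foldl (F γ) (init γ)) := by
  let step : ∀ γ, σ γ × List (β γ) → σ γ × List (β γ) := fun γ s =>
    match s.2 with
    | [] => s
    | b :: r => (F γ s.1 b, r)
  have hinv : ∀ γ j, ((step γ)^[j] (init γ, l γ)).2 = (l γ).drop j ∧
      ((step γ)^[j] (init γ, l γ)).2.foldl (F γ) ((step γ)^[j] (init γ, l γ)).1 =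
        (l γ).foldl (F γ) (init γ) := by
    intro γ j
    induction j with
    | zero => exact ⟨rfl, rfl⟩
    | succ j ih =>
      rw [Function.iterate_succ_apply', ← List.drop_drop, ← ih.1, ← ih.2]
      rcases h : (step γ)^[j] (init γ, l γ) with ⟨s, _ | ⟨b, r⟩⟩
      · simp [step]
      · simp [step]
  obtain ⟨n, hn, h⟩ := Comp.whileLoop (N := N) (e := e) (σ := fun γ => σ γ × List (β γ))
    (eσ := fun γ s => .cons (e γ) (.cons (eσ γ s.1) (encodeList (eβ γ) s.2))) (F := step)
    (init := fun γ => (init γ, l γ)) (c := fun γ s => s.2 ≠ [])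
    ((refl N e).pair (hinit.pair hl))
    ((encodeProp_ne_nil (refl _ _).snd.snd).congr fun x => by rw [encodeList_ne_nil])
    (by
      -- In a reachable state the unread part is a `drop` of `l γ`, so its head is an element of `l
      -- γ`, as `hF` requires.
      have hx : ∀ x : {x : Σ γ, σ γ × List (β γ) // x.2.2 ≠ [] ∧
          ∃ j, (step x.1)^[j] (init x.1, l x.1) = x.2},
          ∃ b r, x.1.2.2 = b :: r ∧ b ∈ l x.1.1 := by
        rintro ⟨⟨γ, s, r'⟩, hr, j, hj⟩
        obtain ⟨b, r, hbr⟩ := List.exists_cons_of_ne_nil hr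
        refine ⟨b, r, hbr, ?_⟩
        have := (hinv γ j).1
        rw [hj] at this
        refine List.mem_of_mem_drop (i := j) ?_
        rw [← this]
        change b ∈ r'
        rw [show r' = b :: r from hbr]
        exact List.mem_cons_self
      choose b r hbr hb using hx
      have h₁ := (refl (fun x : {x : Σ γ, σ γ × List (β γ) // x.2.2 ≠ [] ∧
          ∃ j, (step x.1)^[j] (init x.1, l x.1) = x.2} => N x.1.1)
        (fun x => .cons (e x.1.1) (.cons (eσ x.1.1 x.1.2.1)
          (.cons (eβ x.1.1 (b x)) (encodeList (eβ x.1.1) (r x))))))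
      have h₂ := (h₁.fst.pair (h₁.snd.fst.pair h₁.snd.snd.fst)).trans
        (hF.reindex fun x : {x : Σ γ, σ γ × List (β γ) // x.2.2 ≠ [] ∧
          ∃ j, (step x.1)^[j] (init x.1, l x.1) = x.2} => ⟨x.1.1, x.1.2.1, b x, hb x⟩)
      have h₃ := h₁.fst.pair (h₂.pair h₁.snd.snd.snd)
      refine Eq.mp ?_ h₃
      congr 1
      · funext x
        rw [hbr x]
        rfl
      · funext x
        simp only [step]
        rw [hbr x])
    hlen (fun γ => ⟨(l γ).length, le_rfl, by simp [(hinv γ _).1]⟩)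
  refine h.snd.fst.congr fun γ => ?_
  have := (hinv γ (n γ)).2
  rw [not_not.1 (hn γ)] at this
  rw [← this]
  rfl

theorem reverse_append (hl : Comp N e fun γ => encodeList (eβ γ) (l γ))
    (hlen : PolyBounded N fun γ => (l γ).length)
    (hl' : Comp N e fun γ => encodeList (eβ γ) (l' γ)) :
    Comp N e fun γ => encodeList (eβ γ) ((l γ).reverse ++ l' γ) :=
  (foldl (σ := fun γ => List (β γ)) (eσ := fun γ => encodeList (eβ γ)) (F := fun _ s b => b :: s)
    (init := l') hl hlen hl' ((refl _ _).snd.snd.pair (refl _ _).snd.fst)).congr fun γ => by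
      congr 1
      generalize l' γ = r
      induction l γ generalizing r with
      | nil => rfl
      | cons b l ih => simp [ih]

theorem reverse (hl : Comp N e fun γ => encodeList (eβ γ) (l γ))
    (hlen : PolyBounded N fun γ => (l γ).length) :
    Comp N e fun γ => encodeList (eβ γ) (l γ).reverse :=
  (hl.reverse_append (l' := fun _ => []) hlen nil).congr fun γ => by simp

theorem append (hl : Comp N e fun γ => encodeList (eβ γ) (l γ))
    (hlen : PolyBounded N fun γ => (l γ).length)
    (hl' : Comp N e fun γ => encodeList (eβ γ) (l' γ)) :
    Comp N e fun γ => encodeList (eβ γ) (l γ ++ l' γ) :=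
  ((hl.reverse hlen).reverse_append (by simpa using hlen) hl').congr fun γ => by simp

theorem _root_.PolyBounded.flatMap (hlen : PolyBounded N fun γ => (l γ).length)
    {g : ∀ γ, β γ → List (δ γ)}
    (hg : PolyBounded (fun x : ListExt l => N x.1) fun x => (g x.1 x.2).length) :
    PolyBounded N fun γ => ((l γ).flatMap (g γ)).length := by
  obtain ⟨Q, hQ⟩ := hg
  refine (hlen.mul ⟨Q, fun _ => le_rfl⟩).mono fun γ => ?_
  rw [List.length_flatMap]
  refine (List.sum_le_card_nsmul _ (Q.eval (N γ)) ?_).trans (by simp)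
  simp only [List.mem_map]
  rintro _ ⟨b, hb, rfl⟩
  exact hQ ⟨γ, b, hb⟩

/-- The pieces are collected in reverse order and the result is reversed at the end, so each step
has to traverse only the new piece. -/
theorem flatMap {g : ∀ γ, β γ → List (δ γ)}
    (hl : Comp N e fun γ => encodeList (eβ γ) (l γ)) (hlen : PolyBounded N fun γ => (l γ).length)
    (hg : Comp (fun x : ListExt l => N x.1) (fun x => .cons (e x.1) (eβ x.1 x.2))
      fun x => encodeList (eδ x.1) (g x.1 x.2))
    (hglen : PolyBounded (fun x : ListExt l => N x.1) fun x => (g x.1 x.2).length) :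
    Comp N e fun γ => encodeList (eδ γ) ((l γ).flatMap (g γ)) := by
  have h₁ := foldl (σ := fun γ => List (δ γ)) (eσ := fun γ => encodeList (eδ γ))
    (F := fun γ s b => (g γ b).reverse ++ s) (init := fun _ => []) hl hlen nil
    (reverse_append (β := fun x : Σ γ, List (δ γ) × {b // b ∈ l γ} => δ x.1)
      (eβ := fun x => eδ x.1) (l := fun x => g x.1 x.2.2) (l' := fun x => x.2.1)
      (((refl _ _).fst.pair (refl _ _).snd.snd).trans (hg.reindex
        fun x : Σ γ, List (δ γ) × {b // b ∈ l γ} => ⟨x.1, x.2.2⟩))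
      (hglen.comp fun x : Σ γ, List (δ γ) × {b // b ∈ l γ} => (⟨x.1, x.2.2⟩ : ListExt l))
      (refl _ _).snd.fst)
  have h₂ : ∀ γ, (l γ).foldl (fun s b => (g γ b).reverse ++ s) [] =
      ((l γ).flatMap (g γ)).reverse := by
    intro γ
    have : ∀ (r : List (δ γ)), (l γ).foldl (fun s b => (g γ b).reverse ++ s) r =
        ((l γ).flatMap (g γ)).reverse ++ r := by
      induction l γ with
      | nil => simp
      | cons b l ih => simp [ih]
    simpa using this []
  simp only [h₂] at h₁
  exact (h₁.reverse (by simpa using hlen.flatMap hglen)).congr fun γ => by simp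

theorem map {g : ∀ γ, β γ → δ γ}
    (hl : Comp N e fun γ => encodeList (eβ γ) (l γ)) (hlen : PolyBounded N fun γ => (l γ).length)
    (hg : Comp (fun x : ListExt l => N x.1) (fun x => .cons (e x.1) (eβ x.1 x.2))
      fun x => eδ x.1 (g x.1 x.2)) :
    Comp N e fun γ => encodeList (eδ γ) ((l γ).map (g γ)) :=
  (flatMap (eδ := eδ) (g := fun γ b => [g γ b]) hl hlen (hg.pair nil) (.const 1)).congr fun γ => by
    rw [← List.map_eq_flatMap]

theorem filter {p : ∀ γ, β γ → Bool} (hl : Comp N e fun γ => encodeList (eβ γ) (l γ))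
    (hlen : PolyBounded N fun γ => (l γ).length)
    (hp : Comp (fun x : ListExt l => N x.1) (fun x => .cons (e x.1) (eβ x.1 x.2))
      fun x => encodeProp (p x.1 x.2 = Bool.true)) :
    Comp N e fun γ => encodeList (eβ γ) ((l γ).filter (p γ)) := by
  refine (flatMap (eδ := eβ) (g := fun γ b => if p γ b then [b] else []) hl hlen
    ((ite hp (var.pair nil) nil).congr fun x => ?_) (.mono (.const 1) fun x => ?_)).congr
      fun γ => ?_
  · split_ifs <;> rfl
  · split_ifs <;> simp
  · congr 1
    induction l γ with
    | nil => rfl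
    | cons b l ih =>
      rw [List.flatMap_cons, ih, List.filter_cons]
      by_cases h : p γ b <;> simp [h]

theorem exists_mem {p : ∀ γ, β γ → Prop} (hl : Comp N e fun γ => encodeList (eβ γ) (l γ))
    (hlen : PolyBounded N fun γ => (l γ).length)
    (hp : Comp (fun x : ListExt l => N x.1) (fun x => .cons (e x.1) (eβ x.1 x.2))
      fun x => encodeProp (p x.1 x.2)) :
    Comp N e fun γ => encodeProp (∃ b ∈ l γ, p γ b) := by
  classical
  refine (encodeProp_ne_nil (filter (p := fun γ b => decide (p γ b)) hl hlen
    (hp.congr fun x => by rw [decide_eq_true_eq]))).congr fun γ => ?_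
  rw [encodeList_ne_nil]
  congr 1
  simp [List.filter_eq_nil_iff]

theorem forall_mem {p : ∀ γ, β γ → Prop} (hl : Comp N e fun γ => encodeList (eβ γ) (l γ))
    (hlen : PolyBounded N fun γ => (l γ).length)
    (hp : Comp (fun x : ListExt l => N x.1) (fun x => .cons (e x.1) (eβ x.1 x.2))
      fun x => encodeProp (p x.1 x.2)) :
    Comp N e fun γ => encodeProp (∀ b ∈ l γ, p γ b) :=
  (not (exists_mem (p := fun γ b => ¬ p γ b) hl hlen hp.not)).congr fun γ => by simp

theorem length (hl : Comp N e fun γ => encodeList (eβ γ) (l γ))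
    (hlen : PolyBounded N fun γ => (l γ).length) :
    Comp N e fun γ => encodeNat (l γ).length :=
  (map (eδ := fun _ _ => .nil) (g := fun _ b => b) hl hlen nil).congr fun γ => by
    simp [encodeNat_length]

theorem list_head? (hl : Comp N e fun γ => encodeList (eβ γ) (l γ)) :
    Comp N e fun γ => encodeOption (eβ γ) (l γ).head? :=
  hl.cases ((hl.head.pair nil).reindex Subtype.val |>.congr fun γ => by
      obtain ⟨b, r, h⟩ := List.exists_cons_of_ne_nil (encodeList_ne_nil.1 γ.2)
      simp [h, encodeList, encodeOption, Data.head])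
    (nil.congr fun γ => by
      rw [not_not.1 (encodeList_ne_nil.not.1 (not_not.2 γ.2))]
      rfl)

theorem list_tail (hl : Comp N e fun γ => encodeList (eβ γ) (l γ)) :
    Comp N e fun γ => encodeList (eβ γ) (l γ).tail :=
  hl.tail.congr fun γ => by cases l γ <;> rfl

theorem list_eq_nil (hl : Comp N e fun γ => encodeList (eβ γ) (l γ)) :
    Comp N e fun γ => encodeProp (l γ = []) :=
  hl.encodeProp_ne_nil.not.congr fun γ => by rw [encodeList_ne_nil, not_not]

end Comp

/-! ### Equality tests -/

/-- The size of a tree. -/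
def Data.size : Data → ℕ
  | .nil => 0
  | .cons x y => x.size + y.size + 1

section Equality

open Classical in
/-- One step of the comparison of trees. The state consists of a flag and of a list of pairs of trees
that remain to be compared. -/
noncomputable def compareStep (d : Data) : Data :=
  if d.tail.head.head ≠ .nil then
    if d.tail.head.tail ≠ .nil then
      .cons d.head (.cons (.cons d.tail.head.head.head d.tail.head.tail.head)
        (.cons (.cons d.tail.head.head.tail d.tail.head.tail.tail) d.tail.tail))
    else .cons .nil .nil
  else
    if d.tail.head.tail ≠ .nil then .cons .nil .nil
    else .cons d.head d.tail.tail

/-- A state of the comparison. -/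
def compareState (l : List (Data × Data)) : Data :=
  .cons (.cons .nil .nil) (encodeList (fun p => .cons p.1 p.2) l)

/-- The state `cons nil nil` has a false flag and nothing left to compare. Otherwise the measure
drops: opening a pair whose first tree is `cons x x'` replaces `2 (|x| + |x'| + 1) + 1` by `(2 |x| +
1) + (2 |x'| + 1)`. The truncated subtraction covers the empty list. -/
theorem compareStep_state (l : List (Data × Data)) :
    (compareStep (compareState l) = .cons .nil .nil ∧ ¬ ∀ p ∈ l, p.1 = p.2) ∨
      ∃ l', compareStep (compareState l) = compareState l' ∧
        ((∀ p ∈ l, p.1 = p.2) ↔ ∀ p ∈ l', p.1 = p.2) ∧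
        (l'.map fun p => 2 * p.1.size + 1).sum ≤ (l.map fun p => 2 * p.1.size + 1).sum - 1 := by
  rcases l with _ | ⟨⟨_ | ⟨x, x'⟩, _ | ⟨y, y'⟩⟩, l⟩
  · exact Or.inr ⟨[], by simp [compareStep, compareState, encodeList, Data.head, Data.tail]⟩
  · refine Or.inr ⟨l, ?_, by simp, by simp [Data.size]⟩
    simp [compareStep, compareState, encodeList, Data.head, Data.tail]
  · refine Or.inl ⟨?_, by simp⟩
    simp [compareStep, compareState, encodeList, Data.head, Data.tail]
  · refine Or.inl ⟨?_, by simp⟩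
    simp [compareStep, compareState, encodeList, Data.head, Data.tail]
  · refine Or.inr ⟨(x, y) :: (x', y') :: l, ?_, by simp [and_assoc], ?_⟩
    · simp [compareStep, compareState, encodeList, Data.head, Data.tail]
    · simp only [List.map_cons, List.sum_cons, Data.size]
      omega

theorem compareStep_halts (k : ℕ) (l : List (Data × Data))
    (hl : (l.map fun p => 2 * p.1.size + 1).sum ≤ k) :
    ∃ n ≤ k + 1, (compareStep^[n] (compareState l)).tail = .nil := by
  induction k generalizing l with
  | zero =>
    rcases l with _ | ⟨p, l⟩
    · exact ⟨0, by simp, rfl⟩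
    · simp at hl
  | succ k ih =>
    rcases compareStep_state l with ⟨h, -⟩ | ⟨l', h, -, hle⟩
    · exact ⟨1, by omega, by rw [Function.iterate_one, h]; rfl⟩
    · obtain ⟨n, hn, h'⟩ := ih l' (by omega)
      exact ⟨n + 1, by omega, by rwa [Function.iterate_succ_apply, h]⟩

/-- Along the iteration either a mismatch has been found for good, or the pairs still listed agree
if and only if the original ones do. -/
theorem compareStep_correct (l : List (Data × Data)) (n : ℕ)
    (h : (compareStep^[n] (compareState l)).tail = .nil) :
    (compareStep^[n] (compareState l)).head ≠ .nil ↔ ∀ p ∈ l, p.1 = p.2 := by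
  have hinv : (compareStep^[n] (compareState l) = .cons .nil .nil ∧ ¬ ∀ p ∈ l, p.1 = p.2) ∨
      ∃ l', compareStep^[n] (compareState l) = compareState l' ∧
        ((∀ p ∈ l, p.1 = p.2) ↔ ∀ p ∈ l', p.1 = p.2) := by
    clear h
    induction n with
    | zero => exact Or.inr ⟨l, rfl, Iff.rfl⟩
    | succ n ih =>
      rw [Function.iterate_succ_apply']
      rcases ih with ⟨h, hP⟩ | ⟨l', h, hP⟩
      · refine Or.inl ⟨?_, hP⟩
        rw [h]
        simp [compareStep, Data.head, Data.tail]
      · rw [h, hP]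
        exact (compareStep_state l').imp_right fun ⟨l'', h₁, h₂, _⟩ => ⟨l'', h₁, h₂⟩
  rcases hinv with ⟨h', hP⟩ | ⟨l', h', hP⟩
  · rw [h']
    simp only [hP, iff_false, not_not]
    rfl
  · rw [h'] at h ⊢
    have : l' = [] := by
      by_contra hne
      exact encodeList_ne_nil.2 hne h
    rw [hP, this]
    simp [compareState, Data.head]

theorem comp_compareStep {Γ : Type} {N : Γ → ℕ} {e f : Γ → Data} (hf : Comp N e f) :
    Comp N e fun γ => compareStep (f γ) := by
  have hp := hf.tail.head
  refine (Comp.ite hp.head.encodeProp_ne_nil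
    (.ite hp.tail.encodeProp_ne_nil
      (hf.head.pair ((hp.head.head.pair hp.tail.head).pair
        ((hp.head.tail.pair hp.tail.tail).pair hf.tail.tail))) (Comp.nil.pair Comp.nil))
    (.ite hp.tail.encodeProp_ne_nil (Comp.nil.pair Comp.nil) (hf.head.pair hf.tail.tail))).congr fun γ => ?_
  unfold compareStep
  split_ifs <;> rfl

/-- The first tree alone drives the comparison, so no bound on the size of `g` is needed. -/
theorem Comp.data_eq {Γ : Type} {N : Γ → ℕ} {e f g : Γ → Data} (hf : Comp N e f)
    (hg : Comp N e g) (hsize : PolyBounded N fun γ => (f γ).size) :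
    Comp N e fun γ => encodeProp (f γ = g γ) := by
  obtain ⟨n, hn, h⟩ := Comp.whileLoop (N := N) (e := e) (σ := fun _ => Data)
    (eσ := fun _ d => d) (F := fun _ => compareStep) (init := fun γ => compareState [(f γ, g γ)])
    (c := fun _ d => d.tail ≠ .nil) ((Comp.nil.pair Comp.nil).pair ((hf.pair hg).pair Comp.nil))
    (Comp.refl _ _).tail.encodeProp_ne_nil (comp_compareStep (Comp.refl _ _))
    (((PolyBounded.const 2).mul hsize).add (.const 2))
    (fun γ => by simpa using compareStep_halts (2 * (f γ).size + 1) [(f γ, g γ)] (by simp))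
  refine h.head.encodeProp_ne_nil.congr fun γ => ?_
  congr 1
  simpa using compareStep_correct _ _ (not_not.1 (hn γ))

theorem Comp.eq {Γ : Type} {N : Γ → ℕ} {e : Γ → Data} {β : Γ → Type} {eβ : ∀ γ, β γ → Data}
    {x y : ∀ γ, β γ} (hinj : ∀ γ, Function.Injective (eβ γ)) (hx : Comp N e fun γ => eβ γ (x γ))
    (hy : Comp N e fun γ => eβ γ (y γ)) (hsize : PolyBounded N fun γ => (eβ γ (x γ)).size) :
    Comp N e fun γ => encodeProp (x γ = y γ) :=
  (hx.data_eq hy hsize).congr fun γ => by rw [(hinj γ).eq_iff]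

end Equality

/-! ### Injectivity and size of the encodings -/

theorem encodeNat_injective : Function.Injective encodeNat := by
  intro m
  induction m with
  | zero => rintro (_ | n) h <;> simp_all [encodeNat]
  | succ m ih =>
    rintro (_ | n) h
    · simp [encodeNat] at h
    · simp only [encodeNat, Data.cons.injEq, true_and] at h
      rw [ih h]

theorem encodeFin_injective {n : ℕ} : Function.Injective (encodeFin (n := n)) := fun _ _ h =>
  Fin.ext (encodeNat_injective h)

theorem encodeList_injective {α : Type*} {f : α → Data} (hf : Function.Injective f) :
    Function.Injective (encodeList f) := by
  intro l
  induction l with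
  | nil => rintro (_ | ⟨y, l'⟩) h <;> simp_all [encodeList]
  | cons x l ih =>
    rintro (_ | ⟨y, l'⟩) h
    · simp [encodeList] at h
    · simp only [encodeList, Data.cons.injEq] at h
      rw [hf h.1, ih h.2]

theorem encodeOption_injective {α : Type*} {f : α → Data} (hf : Function.Injective f) :
    Function.Injective (encodeOption f) := by
  rintro (_ | x) (_ | y) h
  · rfl
  · simp [encodeOption] at h
  · simp [encodeOption] at h
  · simp only [encodeOption, Data.cons.injEq, and_true] at h
    rw [hf h]

theorem encodePlayer_injective : Function.Injective encodePlayer := by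
  rintro (_ | _) (_ | _) h <;> simp_all [encodePlayer]

theorem encodeSequence_injective {m k : ℕ} :
    Function.Injective (encodeSequence (m := m) (k := k)) := by
  refine encodeOption_injective fun x y h => ?_
  simp only [Data.cons.injEq] at h
  exact Prod.ext (encodeFin_injective h.1) (encodeFin_injective h.2)

/-- Encoding of sequence pairs. -/
def encodePair {m k : ℕ} (p : SeqPair (Fin m) (Fin k)) : Data :=
  .cons (encodeSequence p.1) (encodeSequence p.2)

@[simp] theorem size_encodeNat (n : ℕ) : (encodeNat n).size = n := by
  induction n with
  | zero => rfl
  | succ n ih => simp [encodeNat, Data.size, ih]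

theorem size_encodeFin_le {n : ℕ} (x : Fin n) : (encodeFin x).size ≤ n := by
  simp [encodeFin, x.2.le]

theorem size_encodeList_le {α : Type*} {f : α → Data} {B : ℕ} {l : List α}
    (h : ∀ x ∈ l, (f x).size ≤ B) : (encodeList f l).size ≤ l.length * (B + 1) := by
  induction l with
  | nil => simp [encodeList, Data.size]
  | cons x l ih =>
    have h₁ := h x (by simp)
    have h₂ := ih fun y hy => h y (by simp [hy])
    simp only [encodeList, Data.size, List.length_cons, Nat.add_mul]
    omega

theorem size_encodePlayer_le (i : Player) : (encodePlayer i).size ≤ 1 := by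
  cases i <;> simp [encodePlayer, Data.size]

theorem size_encodeSequence_le {m k : ℕ} (σ : Sequence (Fin m) (Fin k)) :
    (encodeSequence σ).size ≤ m + k + 2 := by
  rcases σ with _ | ⟨J, a⟩
  · simp [encodeSequence, encodeOption, Data.size]
  · have h₁ := size_encodeFin_le J
    have h₂ := size_encodeFin_le a
    simp only [encodeSequence, encodeOption, Data.size]
    omega

/-! ### Numbers, tails and lookup -/

namespace Comp

variable {Γ : Type} {N : Γ → ℕ} {e : Γ → Data} {β : Γ → Type} {l : ∀ γ, List (β γ)}
  {eβ : ∀ γ, β γ → Data}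

/-- A unary number is a list of units, so counting is folding over that list. -/
theorem drop {n : Γ → ℕ} (hl : Comp N e fun γ => encodeList (eβ γ) (l γ))
    (hn : Comp N e fun γ => encodeNat (n γ)) (hB : PolyBounded N n) :
    Comp N e fun γ => encodeList (eβ γ) ((l γ).drop (n γ)) := by
  simp only [encodeNat_eq] at hn
  refine (foldl (σ := fun γ => List (β γ)) (eσ := fun γ => encodeList (eβ γ))
    (F := fun _ s _ => s.tail) (init := l) hn (by simpa using hB) hl
    (refl _ _).snd.fst.list_tail).congr fun γ => ?_
  congr 1
  generalize l γ = r
  induction n γ generalizing r with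
  | zero => rfl
  | succ n ih => simp [List.replicate_succ, ih]

theorem range {n : Γ → ℕ} (hn : Comp N e fun γ => encodeNat (n γ)) (hB : PolyBounded N n) :
    Comp N e fun γ => encodeList encodeNat (List.range (n γ)) := by
  have hn' := hn
  simp only [encodeNat_eq] at hn'
  -- The state is just the counter; its encoding also carries the numbers listed so far, in reverse.
  have h₁ := foldl (σ := fun _ => ℕ)
    (eσ := fun _ j => .cons (encodeNat j) (encodeList encodeNat (List.range j).reverse))
    (F := fun _ j _ => j + 1) (init := fun _ => 0) hn' (by simpa using hB) (nil.pair nil)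
    ((nil.pair (refl _ _).snd.fst.fst).pair (refl _ _).snd.fst |>.congr fun x => by
      simp [List.range_succ, encodeList, encodeNat])
  have h₂ : ∀ j n : ℕ, (List.replicate n ()).foldl (fun j _ => j + 1) j = j + n := by
    intro j n
    induction n generalizing j with
    | zero => rfl
    | succ n ih => rw [List.replicate_succ, List.foldl_cons, ih]; omega
  simp only [h₂, Nat.zero_add] at h₁
  refine (reverse (β := fun _ => ℕ) (eβ := fun _ => encodeNat) (l := fun γ => (List.range (n γ)).reverse)
    h₁.snd (by simpa using hB)).congr fun γ => by simp

/-- All the tails of a list. -/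
theorem tails (hl : Comp N e fun γ => encodeList (eβ γ) (l γ))
    (hlen : PolyBounded N fun γ => (l γ).length) :
    Comp N e fun γ => encodeList (encodeList (eβ γ)) (l γ).tails := by
  -- The accumulator starts as `[l γ]` and only grows, so the default of `headD` does not matter.
  have h₁ := foldl (σ := fun γ => List (List (β γ)))
    (eσ := fun γ => encodeList (encodeList (eβ γ))) (F := fun _ s _ => (s.headD []).tail :: s)
    (init := fun γ => [l γ]) hl hlen (hl.pair nil)
    (((refl _ _).snd.fst.head.tail.congr fun x => by
      rcases x.2.1 with _ | ⟨_ | ⟨b, r⟩, s⟩ <;> rfl).pair (refl _ _).snd.fst)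
  have h₂ : ∀ (γ : Γ) (r : List (β γ)) (s : List (List (β γ))),
      r.foldl (fun s _ => (s.headD []).tail :: s) (r :: s) = r.tails.reverse ++ s := by
    intro γ r
    induction r with
    | nil => intro s; simp
    | cons b r ih => exact fun s => (ih ((b :: r) :: s)).trans (by simp)
  simp only [h₂, List.append_nil] at h₁
  refine (reverse (β := fun γ => List (β γ)) (eβ := fun γ => encodeList (eβ γ))
    (l := fun γ => (l γ).tails.reverse) h₁ ?_).congr fun γ => by rw [List.reverse_reverse]
  simpa using hlen.add (.const 1)

end Comp

/-! ## Computations on the table of a game -/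

/-- A game with perfect recall whose nodes are listed in some order. -/
structure GameInput where
  m : ℕ
  k : ℕ
  G : EFG (Fin m) (Fin k)
  L : List (List (Fin k))
  perfectRecall : G.PerfectRecall
  isNodeList : IsNodeList G L

namespace GameInput

/-- The size of the input. -/
def size (x : GameInput) : ℕ := x.G.nodes.card + x.k

/-- The actions at an information set, in their natural order. -/
def ord (x : GameInput) (J : Fin x.m) : List (Fin x.k) :=
  (List.finRange x.k).filter fun a => a ∈ x.G.actions J

/-- The encoding of the input. -/
def encode (x : GameInput) : Data := encodeGame x.G x.L

theorem isActionOrder_ord (x : GameInput) : IsActionOrder x.G x.ord := fun J =>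
  ⟨(List.nodup_finRange _).filter _, fun a => by simp [ord]⟩

/-- The size counts nodes and actions only; information sets are bounded by the nodes because each
of them contains one. -/
theorem m_le (x : GameInput) : x.m ≤ x.size := by
  have := EFG.card_infosets_le x.G
  rw [Nat.card_eq_fintype_card, Fintype.card_fin] at this
  exact this.trans (Nat.le_add_right _ _)

theorem k_le (x : GameInput) : x.k ≤ x.size := Nat.le_add_left _ _

theorem card_nodes_le (x : GameInput) : x.G.nodes.card ≤ x.size := Nat.le_add_right _ _

theorem length_ord_le (x : GameInput) (J : Fin x.m) : (x.ord J).length ≤ x.size :=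
  ((List.length_filter_le _ _).trans (by simp)).trans x.k_le

theorem length_nodes_le (x : GameInput) : x.L.length ≤ x.size := by
  classical
  rw [← List.toFinset_card_of_nodup x.isNodeList.1]
  exact (Finset.card_le_card fun h hh => (x.isNodeList.2 h).1 (List.mem_toFinset.1 hh)).trans
    x.card_nodes_le

theorem length_node_le (x : GameInput) {h : List (Fin x.k)} (hh : h ∈ x.L) : h.length ≤ x.size :=
  (EFG.length_lt_card_nodes ((x.isNodeList.2 h).1 hh)).le.trans x.card_nodes_le

theorem length_hist_le (x : GameInput) (J : Fin x.m) : (x.G.hist J).length ≤ x.size :=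
  (hist_length_le J).trans x.card_nodes_le

theorem mem_nodes_of_infoset (x : GameInput) {h : List (Fin x.k)} {J : Fin x.m}
    (hJ : x.G.infoset h = some J) : h ∈ x.L := (x.isNodeList.2 h).2 (x.G.infoset_mem h J hJ)

/-- Encoding of nodes. -/
def encodeWord (x : GameInput) (h : List (Fin x.k)) : Data := encodeList encodeFin h

/-- Encoding of the rows of the table of nodes. -/
def encodeNode (x : GameInput) (h : List (Fin x.k)) : Data :=
  .cons (x.encodeWord h) (encodeOption encodeFin (x.G.infoset h))

/-- Encoding of pairs of an information set and an action. -/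
def encodeStep (x : GameInput) (q : Fin x.m × Fin x.k) : Data :=
  .cons (encodeFin q.1) (encodeFin q.2)

theorem encodeWord_injective (x : GameInput) : Function.Injective x.encodeWord :=
  encodeList_injective encodeFin_injective

theorem encodeStep_injective (x : GameInput) : Function.Injective x.encodeStep := fun p q h => by
  simp only [encodeStep, Data.cons.injEq] at h
  exact Prod.ext (encodeFin_injective h.1) (encodeFin_injective h.2)

theorem size_encodeWord_le (x : GameInput) {h : List (Fin x.k)} (hh : h.length ≤ x.size) :
    (x.encodeWord h).size ≤ x.size * (x.size + 1) :=
  (size_encodeList_le fun a _ => (size_encodeFin_le a).trans x.k_le).trans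
    (Nat.mul_le_mul_right _ hh)

theorem size_encodeStep_le (x : GameInput) (q : Fin x.m × Fin x.k) :
    (x.encodeStep q).size ≤ 2 * x.size + 1 := by
  have h₁ := (size_encodeFin_le q.1).trans x.m_le
  have h₂ := (size_encodeFin_le q.2).trans x.k_le
  simp only [encodeStep, Data.size]
  omega

end GameInput

theorem polyBounded_of_le {Γ : Type} {N g : Γ → ℕ} (h : ∀ γ, g γ ≤ N γ) : PolyBounded N g :=
  PolyBounded.self.mono h

theorem List.filter_eq_singleton {α : Type*} {l : List α} (hl : l.Nodup) {a : α} (ha : a ∈ l)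
    {p : α → Bool} (hp : ∀ b, p b = true ↔ b = a) : l.filter p = [a] := by
  obtain ⟨l₁, l₂, rfl⟩ := List.append_of_mem ha
  rw [List.nodup_middle, List.nodup_cons, List.mem_append, not_or] at hl
  rw [List.filter_append, List.filter_cons, if_pos ((hp a).2 rfl),
    List.filter_eq_nil_iff.2 fun b hb hb' => hl.1.1 ((hp b).1 hb' ▸ hb),
    List.filter_eq_nil_iff.2 fun b hb hb' => hl.1.2 ((hp b).1 hb' ▸ hb)]
  rfl

theorem length_toList_le {α : Type*} (o : Option α) : o.toList.length ≤ 1 := by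
  cases o <;> simp

namespace Comp

variable {Γ : Type} {ω : Γ → GameInput} {e : Γ → Data}

theorem eq_player {N : Γ → ℕ} {i j : Γ → Player} (hi : Comp N e fun γ => encodePlayer (i γ))
    (hj : Comp N e fun γ => encodePlayer (j γ)) : Comp N e fun γ => encodeProp (i γ = j γ) :=
  Comp.eq (β := fun _ => Player) (eβ := fun _ => encodePlayer) (fun _ => encodePlayer_injective) hi hj
    ((PolyBounded.const 1).mono fun _ => size_encodePlayer_le _)

theorem eq_sequence {σ τ : ∀ γ, Sequence (Fin (ω γ).m) (Fin (ω γ).k)}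
    (hσ : Comp (fun γ => (ω γ).size) e fun γ => encodeSequence (σ γ))
    (hτ : Comp (fun γ => (ω γ).size) e fun γ => encodeSequence (τ γ)) :
    Comp (fun γ => (ω γ).size) e fun γ => encodeProp (σ γ = τ γ) :=
  Comp.eq (β := fun γ => Sequence (Fin (ω γ).m) (Fin (ω γ).k)) (eβ := fun _ => encodeSequence)
    (fun _ => encodeSequence_injective) hσ hτ
    (((PolyBounded.const 2).mul .self |>.add (.const 2)).mono fun γ => by
      have h₁ := size_encodeSequence_le (σ γ)
      have h₂ := (ω γ).m_le
      have h₃ := (ω γ).k_le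
      omega)

theorem eq_pair {p q : ∀ γ, SeqPair (Fin (ω γ).m) (Fin (ω γ).k)}
    (hp : Comp (fun γ => (ω γ).size) e fun γ => encodePair (p γ))
    (hq : Comp (fun γ => (ω γ).size) e fun γ => encodePair (q γ)) :
    Comp (fun γ => (ω γ).size) e fun γ => encodeProp (p γ = q γ) :=
  (hp.fst.eq_sequence hq.fst |>.and (hp.snd.eq_sequence hq.snd)).congr fun γ => by
    rw [Prod.ext_iff]

theorem opp {N : Γ → ℕ} {i : Γ → Player} (hi : Comp N e fun γ => encodePlayer (i γ)) :
    Comp N e fun γ => encodePlayer (i γ).opp :=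
  (ite hi.encodeProp_ne_nil nil (const (.cons .nil .nil))).congr fun γ => by
    cases i γ <;> simp [encodePlayer, Player.opp]

theorem mkPair {N : Γ → ℕ} {i : Γ → Player} {m k : Γ → ℕ}
    {s t : ∀ γ, Sequence (Fin (m γ)) (Fin (k γ))}
    (hi : Comp N e fun γ => encodePlayer (i γ)) (hs : Comp N e fun γ => encodeSequence (s γ))
    (ht : Comp N e fun γ => encodeSequence (t γ)) :
    Comp N e fun γ => encodePair (mkPair (i γ) (s γ) (t γ)) :=
  (ite hi.encodeProp_ne_nil (ht.pair hs) (hs.pair ht)).congr fun γ => by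
    cases i γ <;> simp [encodePlayer, encodePair, _root_.mkPair]

theorem some_sequence {N : Γ → ℕ} {m k : Γ → ℕ} {J : ∀ γ, Fin (m γ)} {a : ∀ γ, Fin (k γ)}
    (hJ : Comp N e fun γ => encodeFin (J γ)) (ha : Comp N e fun γ => encodeFin (a γ)) :
    Comp N e fun γ => encodeSequence (some (J γ, a γ)) := (hJ.pair ha).pair nil

theorem toList {N : Γ → ℕ} {β : Γ → Type} {eβ : ∀ γ, β γ → Data} {o : ∀ γ, Option (β γ)}
    (h : Comp N e fun γ => encodeOption (eβ γ) (o γ)) :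
    Comp N e fun γ => encodeList (eβ γ) (o γ).toList := h.congr fun _ => encodeOption_eq _ _

theorem of_toList {N : Γ → ℕ} {β : Γ → Type} {eβ : ∀ γ, β γ → Data} {o : ∀ γ, Option (β γ)}
    (h : Comp N e fun γ => encodeList (eβ γ) (o γ).toList) :
    Comp N e fun γ => encodeOption (eβ γ) (o γ) := h.congr fun _ => (encodeOption_eq _ _).symm

theorem nodes (he : Comp (fun γ => (ω γ).size) e fun γ => (ω γ).encode) :
    Comp (fun γ => (ω γ).size) e fun γ => encodeList (ω γ).encodeNode (ω γ).L := he.fst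

theorem infoset (he : Comp (fun γ => (ω γ).size) e fun γ => (ω γ).encode)
    {h : ∀ γ, List (Fin (ω γ).k)}
    (hh : Comp (fun γ => (ω γ).size) e fun γ => (ω γ).encodeWord (h γ)) :
    Comp (fun γ => (ω γ).size) e fun γ => encodeOption encodeFin ((ω γ).G.infoset (h γ)) := by
  have hlen : PolyBounded (fun γ => (ω γ).size) fun γ => (ω γ).L.length :=
    polyBounded_of_le fun γ => (ω γ).length_nodes_le
  have h₁ := filter (β := fun γ => List (Fin (ω γ).k)) (eβ := fun γ => (ω γ).encodeNode)
    (p := fun γ b => decide (b = h γ)) he.nodes hlen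
    ((Comp.eq (β := fun x : ListExt fun γ => (ω γ).L => List (Fin (ω x.1).k))
      (eβ := fun x => (ω x.1).encodeWord) (x := fun x => x.2.1)
      (fun x => (ω x.1).encodeWord_injective) var.fst hh.weaken
      ((PolyBounded.self.mul (PolyBounded.self.add (.const 1))).mono fun x =>
        (ω x.1).size_encodeWord_le ((ω x.1).length_node_le x.2.2))).congr fun x => by
          rw [decide_eq_true_eq])
  have h₂ := flatMap (δ := fun γ => Fin (ω γ).m) (eδ := fun γ => encodeFin)
    (g := fun γ b => ((ω γ).G.infoset b).toList) h₁
    (hlen.mono fun γ => List.length_filter_le _ _) var.snd.toList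
    ((PolyBounded.const 1).mono fun x => length_toList_le _)
  refine of_toList (h₂.congr fun γ => ?_)
  congr 1
  by_cases hmem : h γ ∈ (ω γ).L
  · rw [List.filter_eq_singleton (ω γ).isNodeList.1 hmem (by simp)]
    simp
  -- A word that is missing from the table is not a node, and then it has no information set.
  · rw [List.filter_eq_nil_iff.2 fun b hb hb' => hmem (by simp_all)]
    rcases hJ : (ω γ).G.infoset (h γ) with _ | J
    · rfl
    · exact absurd ((ω γ).mem_nodes_of_infoset hJ) hmem

/-- The table of information sets is in the order of their names, so the row of `J` is what comes
first after dropping `J` rows. -/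
theorem row (he : Comp (fun γ => (ω γ).size) e fun γ => (ω γ).encode)
    {J : ∀ γ, Fin (ω γ).m}
    (hJ : Comp (fun γ => (ω γ).size) e fun γ => encodeFin (J γ)) :
    Comp (fun γ => (ω γ).size) e fun γ => .cons (encodePlayer ((ω γ).G.player (J γ)))
      (encodeList encodeFin ((ω γ).ord (J γ))) := by
  have h₁ := drop (β := fun γ => Fin (ω γ).m) (eβ := fun γ J =>
      .cons (encodePlayer ((ω γ).G.player J)) (encodeList encodeFin ((ω γ).ord J)))
    (l := fun γ => List.finRange (ω γ).m) (n := fun γ => J γ) he.snd hJ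
    (polyBounded_of_le fun γ => (J γ).2.le.trans (ω γ).m_le)
  refine h₁.head.congr fun γ => ?_
  rw [List.drop_eq_getElem_cons (by simp)]
  simp [encodeList, Data.head]

theorem player (he : Comp (fun γ => (ω γ).size) e fun γ => (ω γ).encode)
    {J : ∀ γ, Fin (ω γ).m}
    (hJ : Comp (fun γ => (ω γ).size) e fun γ => encodeFin (J γ)) :
    Comp (fun γ => (ω γ).size) e fun γ => encodePlayer ((ω γ).G.player (J γ)) := (he.row hJ).fst

theorem ord (he : Comp (fun γ => (ω γ).size) e fun γ => (ω γ).encode)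
    {J : ∀ γ, Fin (ω γ).m}
    (hJ : Comp (fun γ => (ω γ).size) e fun γ => encodeFin (J γ)) :
    Comp (fun γ => (ω γ).size) e fun γ => encodeList encodeFin ((ω γ).ord (J γ)) := (he.row hJ).snd

theorem infosets (he : Comp (fun γ => (ω γ).size) e fun γ => (ω γ).encode) :
    Comp (fun γ => (ω γ).size) e fun γ => encodeList encodeFin (List.finRange (ω γ).m) := by
  have hm : PolyBounded (fun γ => (ω γ).size) fun γ => (ω γ).m :=
    polyBounded_of_le fun γ => (ω γ).m_le
  have h₁ := length (β := fun γ => Fin (ω γ).m) (eβ := fun γ J =>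
      .cons (encodePlayer ((ω γ).G.player J)) (encodeList encodeFin ((ω γ).ord J)))
    (l := fun γ => List.finRange (ω γ).m) he.snd (by simpa using hm)
  simp only [List.length_finRange] at h₁
  refine (h₁.range hm).congr fun γ => ?_
  rw [← List.map_coe_finRange_eq_range, encodeList_map]
  rfl

end Comp

/-- Unfolds the recursion along a path into a concatenation over the nodes of the path, in which
form the list programs apply. -/
theorem EFG.ownHistory_eq_flatMap {I A : Type*} (G : EFG I A) (i : Player) (h : List A) :
    G.ownHistory i h = h.tails.flatMap fun w => w.head?.toList.flatMap fun a =>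
      (G.infoset w.tail).toList.flatMap fun J => if G.player J = i then [(J, a)] else [] := by
  induction h with
  | nil => simp [ownHistory]
  | cons a h ih =>
    rw [ownHistory, List.tails_cons, List.flatMap_cons, ← ih]
    rcases hJ : G.infoset h with _ | J
    · simp [hJ]
    · by_cases hi : G.player J = i <;> simp [hJ, hi]

theorem length_flatMap_le_one {α β : Type*} {l : List α} {g : α → List β} (hl : l.length ≤ 1)
    (hg : ∀ x, (g x).length ≤ 1) : (l.flatMap g).length ≤ 1 := by
  rcases l with _ | ⟨x, _ | ⟨y, l⟩⟩
  · simp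
  · simpa using hg x
  · simp at hl

/-- The part of the own history that one node of a path contributes. -/
def historyStep (x : GameInput) (i : Player) (w : List (Fin x.k)) : List (Fin x.m × Fin x.k) :=
  w.head?.toList.flatMap fun a =>
    (x.G.infoset w.tail).toList.flatMap fun J => if x.G.player J = i then [(J, a)] else []

theorem length_historyStep_le (x : GameInput) (i : Player) (w : List (Fin x.k)) :
    (historyStep x i w).length ≤ 1 :=
  length_flatMap_le_one (length_toList_le _) fun _ =>
    length_flatMap_le_one (length_toList_le _) fun _ => by split_ifs <;> simp

/-! ### Histories, the order of sequences and connectedness computed from the table -/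

namespace Comp

variable {Γ : Type} {ω : Γ → GameInput} {e : Γ → Data}

theorem infosetPairs (he : Comp (fun γ => (ω γ).size) e fun γ => (ω γ).encode) {i : Γ → Player}
    {o : ∀ γ, Option (Fin (ω γ).m)} {a : ∀ γ, Fin (ω γ).k}
    (hi : Comp (fun γ => (ω γ).size) e fun γ => encodePlayer (i γ))
    (ho : Comp (fun γ => (ω γ).size) e fun γ => encodeList encodeFin (o γ).toList)
    (ha : Comp (fun γ => (ω γ).size) e fun γ => encodeFin (a γ)) :
    Comp (fun γ => (ω γ).size) e fun γ => encodeList (ω γ).encodeStep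
      ((o γ).toList.flatMap fun J => if (ω γ).G.player J = i γ then [(J, a γ)] else []) := by
  refine flatMap (β := fun γ => Fin (ω γ).m) (eβ := fun _ => encodeFin)
    (δ := fun γ => Fin (ω γ).m × Fin (ω γ).k) (eδ := fun γ => (ω γ).encodeStep)
    (g := fun γ J => if (ω γ).G.player J = i γ then [(J, a γ)] else []) ho
    ((PolyBounded.const 1).mono fun _ => length_toList_le _)
    ((ite ((he.weaken.player var).eq_player hi.weaken) ((var.pair ha.weaken).pair nil)
      nil).congr fun x => ?_) ((PolyBounded.const 1).mono fun _ => ?_)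
  · split_ifs <;> rfl
  · split_ifs <;> simp

theorem historyStep (he : Comp (fun γ => (ω γ).size) e fun γ => (ω γ).encode) {i : Γ → Player}
    {w : ∀ γ, List (Fin (ω γ).k)}
    (hi : Comp (fun γ => (ω γ).size) e fun γ => encodePlayer (i γ))
    (hw : Comp (fun γ => (ω γ).size) e fun γ => (ω γ).encodeWord (w γ)) :
    Comp (fun γ => (ω γ).size) e fun γ =>
      encodeList (ω γ).encodeStep (_root_.historyStep (ω γ) (i γ) (w γ)) :=
  flatMap (β := fun γ => Fin (ω γ).k) (eβ := fun _ => encodeFin)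
    (δ := fun γ => Fin (ω γ).m × Fin (ω γ).k) (eδ := fun γ => (ω γ).encodeStep)
    (g := fun γ a => ((ω γ).G.infoset (w γ).tail).toList.flatMap fun J =>
      if (ω γ).G.player J = i γ then [(J, a)] else [])
    (list_head? hw).toList ((PolyBounded.const 1).mono fun _ => length_toList_le _)
    (he.weaken.infosetPairs hi.weaken (he.infoset (list_tail hw)).toList.weaken var)
    ((PolyBounded.const 1).mono fun _ => length_flatMap_le_one (length_toList_le _)
      fun _ => by split_ifs <;> simp)

theorem ownHistory (he : Comp (fun γ => (ω γ).size) e fun γ => (ω γ).encode) {i : Γ → Player}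
    {h : ∀ γ, List (Fin (ω γ).k)}
    (hi : Comp (fun γ => (ω γ).size) e fun γ => encodePlayer (i γ))
    (hh : Comp (fun γ => (ω γ).size) e fun γ => (ω γ).encodeWord (h γ))
    (hlen : PolyBounded (fun γ => (ω γ).size) fun γ => (h γ).length) :
    Comp (fun γ => (ω γ).size) e fun γ =>
      encodeList (ω γ).encodeStep ((ω γ).G.ownHistory (i γ) (h γ)) :=
  (flatMap (β := fun γ => List (Fin (ω γ).k)) (eβ := fun γ => (ω γ).encodeWord)
    (δ := fun γ => Fin (ω γ).m × Fin (ω γ).k) (eδ := fun γ => (ω γ).encodeStep)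
    (g := fun γ w => _root_.historyStep (ω γ) (i γ) w)
    (tails (β := fun γ => Fin (ω γ).k) (eβ := fun _ => encodeFin) hh hlen)
    (by simpa using hlen.add (.const 1)) (he.weaken.historyStep hi.weaken var)
    ((PolyBounded.const 1).mono fun _ => length_historyStep_le _ _ _)).congr fun γ => by
      rw [EFG.ownHistory_eq_flatMap]
      rfl

theorem infoset_eq {o : ∀ γ, Option (Fin (ω γ).m)} {J : ∀ γ, Fin (ω γ).m}
    (ho : Comp (fun γ => (ω γ).size) e fun γ => encodeOption encodeFin (o γ))
    (hJ : Comp (fun γ => (ω γ).size) e fun γ => encodeFin (J γ)) :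
    Comp (fun γ => (ω γ).size) e fun γ => encodeProp (o γ = some (J γ)) :=
  Comp.eq (β := fun γ => Option (Fin (ω γ).m)) (eβ := fun _ => encodeOption encodeFin)
    (fun _ => encodeOption_injective encodeFin_injective) ho (hJ.pair nil)
    ((PolyBounded.self.add (.const 1)).mono fun γ => by
      have h₁ := (ω γ).m_le
      rcases o γ with _ | K
      · simp [encodeOption, Data.size]
      · have := size_encodeFin_le K
        simp only [encodeOption, Data.size]
        omega)

/-- `hist` refers to a node picked by the axiom of choice. By perfect recall any node of `J` has the
same history, so the program takes the one that the table lists first. -/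
theorem hist (he : Comp (fun γ => (ω γ).size) e fun γ => (ω γ).encode) {J : ∀ γ, Fin (ω γ).m}
    (hJ : Comp (fun γ => (ω γ).size) e fun γ => encodeFin (J γ)) :
    Comp (fun γ => (ω γ).size) e fun γ =>
      encodeList (ω γ).encodeStep ((ω γ).G.hist (J γ)) := by
  have h₁ := filter (β := fun γ => List (Fin (ω γ).k)) (eβ := fun γ => (ω γ).encodeNode)
    (p := fun γ b => decide ((ω γ).G.infoset b = some (J γ))) he.nodes
    (polyBounded_of_le fun γ => (ω γ).length_nodes_le)
    ((infoset_eq (ω := fun x : ListExt fun γ => (ω γ).L => ω x.1)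
      (o := fun x => (ω x.1).G.infoset x.2.1) var.snd hJ.weaken).congr fun x => by
        rw [decide_eq_true_eq])
  have hlen : ∀ x : ListExt fun γ =>
      ((ω γ).L.filter fun b => (ω γ).G.infoset b = some (J γ)).head?.toList,
      x.2.1 ∈ (ω x.1).L ∧ (ω x.1).G.infoset x.2.1 = some (J x.1) := by
    rintro ⟨γ, b, hb⟩
    have := List.mem_of_mem_head? (Option.mem_toList.1 hb)
    simpa using this
  have h₂ := flatMap (β := fun γ => List (Fin (ω γ).k)) (eβ := fun γ => (ω γ).encodeNode)
    (δ := fun γ => Fin (ω γ).m × Fin (ω γ).k) (eδ := fun γ => (ω γ).encodeStep)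
    (g := fun γ b => (ω γ).G.ownHistory ((ω γ).G.player (J γ)) b) h₁.list_head?.toList
    ((PolyBounded.const 1).mono fun _ => length_toList_le _)
    (ownHistory (ω := fun x : ListExt fun γ =>
        ((ω γ).L.filter fun b => (ω γ).G.infoset b = some (J γ)).head?.toList => ω x.1)
      he.weaken (h := fun x => x.2.1) (he.player hJ).weaken var.fst
      (polyBounded_of_le fun x => (ω x.1).length_node_le (hlen x).1))
    (polyBounded_of_le fun x => (EFG.length_ownHistory_le _ _).trans
      ((ω x.1).length_node_le (hlen x).1))
  refine h₂.congr fun γ => ?_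
  congr 1
  rcases hl : ((ω γ).L.filter fun b => (ω γ).G.infoset b = some (J γ)).head? with _ | b
  · rw [List.head?_eq_none_iff, List.filter_eq_nil_iff] at hl
    have hn := EFG.infoset_someNode (G := (ω γ).G) (J γ)
    exact absurd hn (by simpa using hl _ ((ω γ).mem_nodes_of_infoset hn))
  · have := (hlen ⟨γ, b, Option.mem_toList.2 hl⟩).2
    simp only [Option.toList_some, List.flatMap_cons, List.flatMap_nil, List.append_nil]
    exact (ω γ).perfectRecall.ownHistory_eq this

theorem parentSeq (he : Comp (fun γ => (ω γ).size) e fun γ => (ω γ).encode)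
    {J : ∀ γ, Fin (ω γ).m} (hJ : Comp (fun γ => (ω γ).size) e fun γ => encodeFin (J γ)) :
    Comp (fun γ => (ω γ).size) e fun γ => encodeSequence ((ω γ).G.parentSeq (J γ)) :=
  (list_head? (β := fun γ => Fin (ω γ).m × Fin (ω γ).k) (eβ := fun γ => (ω γ).encodeStep)
    (he.hist hJ)).congr fun _ => rfl

theorem chain (he : Comp (fun γ => (ω γ).size) e fun γ => (ω γ).encode)
    {σ : ∀ γ, Sequence (Fin (ω γ).m) (Fin (ω γ).k)}
    (hσ : Comp (fun γ => (ω γ).size) e fun γ => encodeSequence (σ γ)) :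
    Comp (fun γ => (ω γ).size) e fun γ =>
      encodeList (ω γ).encodeStep ((ω γ).G.chain (σ γ)) := by
  refine (flatMap (β := fun γ => Fin (ω γ).m × Fin (ω γ).k) (eβ := fun γ => (ω γ).encodeStep)
    (δ := fun γ => Fin (ω γ).m × Fin (ω γ).k) (eδ := fun γ => (ω γ).encodeStep)
    (l := fun γ => (σ γ).toList) (g := fun γ q => q :: (ω γ).G.hist q.1) (toList hσ)
    ((PolyBounded.const 1).mono fun _ => length_toList_le _)
    (var.pair (he.weaken.hist var.fst))
    ((PolyBounded.self.add (.const 1)).mono fun x => ?_)).congr fun γ => ?_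
  · simpa using (ω x.1).length_hist_le _
  · rcases σ γ with _ | ⟨J, a⟩ <;> simp

theorem suffix {N : Γ → ℕ} {β : Γ → Type} {eβ : ∀ γ, β γ → Data} {u v : ∀ γ, List (β γ)} {B : Γ → ℕ}
    (hinj : ∀ γ, Function.Injective (eβ γ))
    (hu : Comp N e fun γ => encodeList (eβ γ) (u γ))
    (hv : Comp N e fun γ => encodeList (eβ γ) (v γ))
    (hulen : PolyBounded N fun γ => (u γ).length) (hvlen : PolyBounded N fun γ => (v γ).length)
    (hB : PolyBounded N B) (hsize : ∀ γ x, (eβ γ x).size ≤ B γ) :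
    Comp N e fun γ => encodeProp (u γ <:+ v γ) :=
  (exists_mem (β := fun γ => List (β γ)) (eβ := fun γ => encodeList (eβ γ))
    (p := fun γ w => u γ = w) (hv.tails hvlen) (by simpa using hvlen.add (.const 1))
    (Comp.eq (β := fun x : ListExt fun γ => (v γ).tails => List (β x.1))
      (eβ := fun x => encodeList (eβ x.1)) (fun x => encodeList_injective (hinj x.1)) hu.weaken var
      (((hulen.mul (hB.add (.const 1))).mono fun γ =>
        size_encodeList_le fun x _ => hsize γ x).comp Sigma.fst))).congr fun γ => by
          simp

/-- The order is decided as a suffix relation between chains of ancestors, using `descends_iff`. -/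
theorem descends (he : Comp (fun γ => (ω γ).size) e fun γ => (ω γ).encode)
    {σ τ : ∀ γ, Sequence (Fin (ω γ).m) (Fin (ω γ).k)}
    (hσ : Comp (fun γ => (ω γ).size) e fun γ => encodeSequence (σ γ))
    (hτ : Comp (fun γ => (ω γ).size) e fun γ => encodeSequence (τ γ)) :
    Comp (fun γ => (ω γ).size) e fun γ => encodeProp ((ω γ).G.Descends (σ γ) (τ γ)) := by
  have hlen : ∀ σ : ∀ γ, Sequence (Fin (ω γ).m) (Fin (ω γ).k),
      PolyBounded (fun γ => (ω γ).size) fun γ => ((ω γ).G.chain (σ γ)).length := fun σ =>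
    (PolyBounded.self.add (.const 1)).mono fun γ => by
      rcases σ γ with _ | ⟨J, a⟩
      · simp
      · simpa using (ω γ).length_hist_le J
  exact (suffix (fun γ => (ω γ).encodeStep_injective) (he.chain hτ) (he.chain hσ) (hlen τ) (hlen σ)
    (((PolyBounded.const 2).mul .self).add (.const 1)) fun γ => (ω γ).size_encodeStep_le).congr
      fun γ => by rw [(ω γ).perfectRecall.descends_iff]

theorem connected_node (he : Comp (fun γ => (ω γ).size) e fun γ => (ω γ).encode)
    {u : ∀ γ, List (Fin (ω γ).k)} {K : ∀ γ, Fin (ω γ).m}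
    (hu : Comp (fun γ => (ω γ).size) e fun γ => (ω γ).encodeWord (u γ))
    (hlen : PolyBounded (fun γ => (ω γ).size) fun γ => (u γ).length)
    (hK : Comp (fun γ => (ω γ).size) e fun γ => encodeFin (K γ)) :
    Comp (fun γ => (ω γ).size) e fun γ => encodeProp (∃ v ∈ (ω γ).L,
      (ω γ).G.infoset v = some (K γ) ∧ (u γ <:+ v ∨ v <:+ u γ)) := by
  have hlen' : PolyBounded (fun x : ListExt fun γ => (ω γ).L => (ω x.1).size)
      fun x => x.2.1.length := polyBounded_of_le fun x => (ω x.1).length_node_le x.2.2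
  exact exists_mem (β := fun γ => List (Fin (ω γ).k)) (eβ := fun γ => (ω γ).encodeNode)
    (p := fun γ v => (ω γ).G.infoset v = some (K γ) ∧ (u γ <:+ v ∨ v <:+ u γ)) he.nodes
    (polyBounded_of_le fun γ => (ω γ).length_nodes_le)
    ((infoset_eq (ω := fun x : ListExt fun γ => (ω γ).L => ω x.1)
      (o := fun x => (ω x.1).G.infoset x.2.1) var.snd hK.weaken).and
      ((suffix (β := fun x : ListExt fun γ => (ω γ).L => Fin (ω x.1).k) (eβ := fun _ => encodeFin)
        (fun _ => encodeFin_injective) hu.weaken var.fst (hlen.comp _) hlen' .self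
        fun x a => (size_encodeFin_le a).trans (ω x.1).k_le).or
      (suffix (β := fun x : ListExt fun γ => (ω γ).L => Fin (ω x.1).k) (eβ := fun _ => encodeFin)
        (fun _ => encodeFin_injective) var.fst hu.weaken hlen' (hlen.comp _) .self
        fun x a => (size_encodeFin_le a).trans (ω x.1).k_le)))

/-- The nodes witnessing a connection carry information sets, so a search through the table finds
them. -/
theorem connected (he : Comp (fun γ => (ω γ).size) e fun γ => (ω γ).encode)
    {J K : ∀ γ, Fin (ω γ).m}
    (hJ : Comp (fun γ => (ω γ).size) e fun γ => encodeFin (J γ))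
    (hK : Comp (fun γ => (ω γ).size) e fun γ => encodeFin (K γ)) :
    Comp (fun γ => (ω γ).size) e fun γ => encodeProp ((ω γ).G.Connected (J γ) (K γ)) := by
  have h₁ := exists_mem (β := fun γ => List (Fin (ω γ).k)) (eβ := fun γ => (ω γ).encodeNode)
    (p := fun γ u => (ω γ).G.infoset u = some (J γ) ∧ ∃ v ∈ (ω γ).L,
      (ω γ).G.infoset v = some (K γ) ∧ (u <:+ v ∨ v <:+ u)) he.nodes
    (polyBounded_of_le fun γ => (ω γ).length_nodes_le)
    ((infoset_eq (ω := fun x : ListExt fun γ => (ω γ).L => ω x.1)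
      (o := fun x => (ω x.1).G.infoset x.2.1) var.snd hJ.weaken).and
      (connected_node (ω := fun x : ListExt fun γ => (ω γ).L => ω x.1) he.weaken
        (u := fun x => x.2.1) var.fst
        (polyBounded_of_le fun x => (ω x.1).length_node_le x.2.2) hK.weaken))
  refine h₁.congr fun γ => ?_
  congr 1
  refine propext ⟨?_, ?_⟩
  · rintro ⟨u, -, hu, v, -, hv, h⟩
    exact ⟨u, v, hu, hv, h⟩
  · rintro ⟨u, v, hu, hv, h⟩
    exact ⟨u, (ω γ).mem_nodes_of_infoset hu, hu, v, (ω γ).mem_nodes_of_infoset hv, hv, h⟩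

theorem seqInfosetRelevant (he : Comp (fun γ => (ω γ).size) e fun γ => (ω γ).encode)
    {σ : ∀ γ, Sequence (Fin (ω γ).m) (Fin (ω γ).k)} {J : ∀ γ, Fin (ω γ).m}
    (hσ : Comp (fun γ => (ω γ).size) e fun γ => encodeSequence (σ γ))
    (hJ : Comp (fun γ => (ω γ).size) e fun γ => encodeFin (J γ)) :
    Comp (fun γ => (ω γ).size) e fun γ =>
      encodeProp ((ω γ).G.SeqInfosetRelevant (σ γ) (J γ)) :=
  (forall_mem (β := fun γ => Fin (ω γ).m × Fin (ω γ).k) (eβ := fun γ => (ω γ).encodeStep)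
    (l := fun γ => (σ γ).toList) (p := fun γ q => (ω γ).G.Connected q.1 (J γ)) (toList hσ)
    ((PolyBounded.const 1).mono fun _ => length_toList_le _)
    (he.weaken.connected var.fst hJ.weaken)).congr fun γ => by
      rcases σ γ with _ | ⟨K, a⟩ <;> simp [EFG.SeqInfosetRelevant]

theorem critical (he : Comp (fun γ => (ω γ).size) e fun γ => (ω γ).encode) {i : Γ → Player}
    {s t : ∀ γ, Sequence (Fin (ω γ).m) (Fin (ω γ).k)} {J : ∀ γ, Fin (ω γ).m}
    (hi : Comp (fun γ => (ω γ).size) e fun γ => encodePlayer (i γ))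
    (hs : Comp (fun γ => (ω γ).size) e fun γ => encodeSequence (s γ))
    (ht : Comp (fun γ => (ω γ).size) e fun γ => encodeSequence (t γ))
    (hJ : Comp (fun γ => (ω γ).size) e fun γ => encodeFin (J γ)) :
    Comp (fun γ => (ω γ).size) e fun γ =>
      encodeProp ((ω γ).G.Critical (i γ) (s γ) (t γ) (J γ)) :=
  ((he.player hJ).eq_player hi |>.and (((he.parentSeq hJ).eq_sequence hs).and
    (exists_mem (β := fun γ => Fin (ω γ).m) (eβ := fun _ => encodeFin)
      (p := fun γ K => (ω γ).G.player K = (i γ).opp ∧ (ω γ).G.parentSeq K = t γ ∧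
        (ω γ).G.Connected (J γ) K) he.infosets
      (polyBounded_of_le fun γ => by simpa using (ω γ).m_le)
      ((he.weaken.player var).eq_player hi.opp.weaken |>.and
        (((he.weaken.parentSeq var).eq_sequence ht.weaken).and
          (he.weaken.connected hJ.weaken var)))))).congr fun γ => by
    simp [EFG.Critical]

end Comp

/-- Encoding of operations. -/
def encodeOperation {m k : ℕ} : Operation (Fin m) (Fin k) → Data
  | .call p => .cons .nil (encodePair p)
  | .split source new =>
    .cons (.cons .nil .nil) (.cons (encodePair source) (encodeList encodePair new))
  | .sum sources new =>
    .cons (.cons (.cons .nil .nil) .nil) (.cons (encodeList encodePair sources) (encodePair new))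

theorem GameInput.length_nodes (x : GameInput) : x.L.length = x.G.nodes.card := by
  classical
  rw [← List.toFinset_card_of_nodup x.isNodeList.1]
  congr 1
  ext h
  rw [List.mem_toFinset, x.isNodeList.2]

theorem length_opponentTasks_le (x : GameInput) (i : Player) (s : Sequence (Fin x.m) (Fin x.k))
    (star : Option (Fin x.m)) (K : Fin x.m) :
    (opponentTasks x.G x.ord i s star K).length ≤ x.size + 1 := by
  have := x.length_ord_le K
  rcases star with _ | J
  · simp [opponentTasks]
  · simp only [opponentTasks]
    split_ifs
    · simpa using this.trans (Nat.le_succ _)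
    · simp

/-- Treats the optional critical information set as a list of length at most one, so that the
programs for lists replace the case distinction. -/
theorem opponentTasks_eq {I A : Type*} (G : EFG I A) (ord : I → List A) (i : Player)
    (s : Sequence I A) (star : Option I) (K : I) [Decidable (∃ J ∈ star.toList, G.Connected J K)] :
    opponentTasks G ord i s star K = if ∃ J ∈ star.toList, G.Connected J K then
      star.toList.flatMap fun J => (ord K).map fun b =>
        .sum ((ord J).map fun a => mkPair i (some (J, a)) (some (K, b))) (mkPair i s (some (K, b)))
    else [.split (mkPair i s (G.parentSeq K)) ((ord K).map fun b => mkPair i s (some (K, b)))] := by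
  rcases star with _ | J
  · simp [opponentTasks]
  · by_cases h : G.Connected J K <;> simp [opponentTasks, h]

/-! ### Computing the operations of a call -/

namespace Comp

variable {Γ : Type} {ω : Γ → GameInput} {e : Γ → Data} {i : Γ → Player}
  {s t : ∀ γ, Sequence (Fin (ω γ).m) (Fin (ω γ).k)} {J K : ∀ γ, Fin (ω γ).m}

theorem length_infosets : PolyBounded (fun γ => (ω γ).size)
    fun γ => (List.finRange (ω γ).m).length :=
  polyBounded_of_le fun γ => by simpa using (ω γ).m_le

theorem criticalList (he : Comp (fun γ => (ω γ).size) e fun γ => (ω γ).encode)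
    (hi : Comp (fun γ => (ω γ).size) e fun γ => encodePlayer (i γ))
    (hs : Comp (fun γ => (ω γ).size) e fun γ => encodeSequence (s γ))
    (ht : Comp (fun γ => (ω γ).size) e fun γ => encodeSequence (t γ)) :
    Comp (fun γ => (ω γ).size) e fun γ => encodeList encodeFin
      (_root_.criticalList (ω γ).G (List.finRange (ω γ).m) (i γ) (s γ) (t γ)) := by
  classical
  refine (filter (β := fun γ => Fin (ω γ).m) (eβ := fun _ => encodeFin)
    (p := fun γ J => decide ((ω γ).G.Critical (i γ) (s γ) (t γ) J)) he.infosets length_infosets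
    ((he.weaken.critical hi.weaken hs.weaken ht.weaken var).congr fun x => by
      rw [decide_eq_true_eq])).congr fun γ => ?_
  rw [_root_.criticalList]

theorem ownList (he : Comp (fun γ => (ω γ).size) e fun γ => (ω γ).encode)
    (hi : Comp (fun γ => (ω γ).size) e fun γ => encodePlayer (i γ))
    (hs : Comp (fun γ => (ω γ).size) e fun γ => encodeSequence (s γ))
    (ht : Comp (fun γ => (ω γ).size) e fun γ => encodeSequence (t γ)) :
    Comp (fun γ => (ω γ).size) e fun γ => encodeList encodeFin
      (_root_.ownList (ω γ).G (List.finRange (ω γ).m) (i γ) (s γ) (t γ)) := by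
  classical
  refine (filter (β := fun γ => Fin (ω γ).m) (eβ := fun _ => encodeFin)
    (p := fun γ J => decide ((ω γ).G.player J = i γ ∧ (ω γ).G.parentSeq J = s γ ∧
      (ω γ).G.SeqInfosetRelevant (t γ) J)) he.infosets length_infosets
    (((he.weaken.player var).eq_player hi.weaken |>.and
      (((he.weaken.parentSeq var).eq_sequence hs.weaken).and
        (he.weaken.seqInfosetRelevant ht.weaken var))).congr fun x => by
      rw [decide_eq_true_eq])).congr fun γ => ?_
  rw [_root_.ownList]
  exact congrArg _ (List.filter_congr fun J _ => by rw [decide_eq_decide])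

open Classical in
/-- The information sets that the second loop of a call treats at one level. -/
theorem opponentLevel (he : Comp (fun γ => (ω γ).size) e fun γ => (ω γ).encode) {d : Γ → ℕ}
    (hd : Comp (fun γ => (ω γ).size) e fun γ => encodeNat (d γ))
    (hi : Comp (fun γ => (ω γ).size) e fun γ => encodePlayer (i γ))
    (hs : Comp (fun γ => (ω γ).size) e fun γ => encodeSequence (s γ))
    (ht : Comp (fun γ => (ω γ).size) e fun γ => encodeSequence (t γ)) :
    Comp (fun γ => (ω γ).size) e fun γ => encodeList encodeFin
      ((List.finRange (ω γ).m).filter fun K => ((ω γ).G.hist K).length = d γ ∧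
        (ω γ).G.player K = (i γ).opp ∧ (ω γ).G.Descends ((ω γ).G.parentSeq K) (t γ) ∧
        (ω γ).G.SeqInfosetRelevant (s γ) K) := by
  have hlen : PolyBounded (fun x : ListExt fun γ => List.finRange (ω γ).m => (ω x.1).size)
      fun x => ((ω x.1).G.hist x.2.1).length := polyBounded_of_le fun x => (ω x.1).length_hist_le _
  refine (filter (β := fun γ => Fin (ω γ).m) (eβ := fun _ => encodeFin)
    (p := fun γ K => decide (((ω γ).G.hist K).length = d γ ∧
        (ω γ).G.player K = (i γ).opp ∧ (ω γ).G.Descends ((ω γ).G.parentSeq K) (t γ) ∧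
        (ω γ).G.SeqInfosetRelevant (s γ) K)) he.infosets length_infosets
    (((Comp.eq (β := fun _ => ℕ) (eβ := fun _ => encodeNat) (fun _ => encodeNat_injective)
      ((he.weaken.hist var).length hlen) hd.weaken (by simpa using hlen)).and
      ((he.weaken.player var).eq_player hi.opp.weaken |>.and
      ((he.weaken.descends (he.weaken.parentSeq var) ht.weaken).and
        (he.weaken.seqInfosetRelevant hs.weaken var)))).congr fun x => by
      rw [decide_eq_true_eq])).congr fun γ => ?_
  congr! 2

theorem length_opponentList : PolyBounded (fun γ => (ω γ).size) fun γ =>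
    (_root_.opponentList (ω γ).G (List.finRange (ω γ).m) (i γ) (s γ) (t γ)).length := by
  classical
  refine (((PolyBounded.self.add (.const 1)).mul .self).mono fun γ => ?_)
  rw [_root_.opponentList, List.length_flatMap]
  refine (List.sum_le_card_nsmul _ (ω γ).m ?_).trans ?_
  · simp only [List.mem_map]
    rintro _ ⟨d, -, rfl⟩
    exact (List.length_filter_le _ _).trans (by simp)
  · simpa using Nat.mul_le_mul (Nat.succ_le_succ (ω γ).card_nodes_le) (ω γ).m_le

theorem opponentList (he : Comp (fun γ => (ω γ).size) e fun γ => (ω γ).encode)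
    (hi : Comp (fun γ => (ω γ).size) e fun γ => encodePlayer (i γ))
    (hs : Comp (fun γ => (ω γ).size) e fun γ => encodeSequence (s γ))
    (ht : Comp (fun γ => (ω γ).size) e fun γ => encodeSequence (t γ)) :
    Comp (fun γ => (ω γ).size) e fun γ => encodeList encodeFin
      (_root_.opponentList (ω γ).G (List.finRange (ω γ).m) (i γ) (s γ) (t γ)) := by
  classical
  have h₁ : Comp (fun γ => (ω γ).size) e fun γ => encodeNat ((ω γ).G.nodes.card + 1) :=
    nil.pair ((he.nodes.length (polyBounded_of_le fun γ => (ω γ).length_nodes_le)).congr fun γ => by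
      rw [(ω γ).length_nodes])
  have hB : PolyBounded (fun γ => (ω γ).size) fun γ => (ω γ).G.nodes.card + 1 :=
    (polyBounded_of_le fun γ => (ω γ).card_nodes_le).add (.const 1)
  refine (flatMap (β := fun _ => ℕ) (eβ := fun _ => encodeNat)
    (δ := fun γ => Fin (ω γ).m) (eδ := fun _ => encodeFin)
    (g := fun γ d => (List.finRange (ω γ).m).filter fun K => ((ω γ).G.hist K).length = d ∧
        (ω γ).G.player K = (i γ).opp ∧ (ω γ).G.Descends ((ω γ).G.parentSeq K) (t γ) ∧
        (ω γ).G.SeqInfosetRelevant (s γ) K) (h₁.range hB) (by simpa using hB)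
    ((he.weaken.opponentLevel var hi.weaken hs.weaken ht.weaken).congr fun x => by congr! 2)
    (polyBounded_of_le fun x => ((List.length_filter_le _ _).trans
      (by simp)).trans (ω x.1).m_le)).congr fun γ => ?_
  rw [_root_.opponentList]

theorem ownTasks (he : Comp (fun γ => (ω γ).size) e fun γ => (ω γ).encode)
    (hi : Comp (fun γ => (ω γ).size) e fun γ => encodePlayer (i γ))
    (hs : Comp (fun γ => (ω γ).size) e fun γ => encodeSequence (s γ))
    (ht : Comp (fun γ => (ω γ).size) e fun γ => encodeSequence (t γ))
    (hJ : Comp (fun γ => (ω γ).size) e fun γ => encodeFin (J γ)) :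
    Comp (fun γ => (ω γ).size) e fun γ => encodeList encodeOperation
      (_root_.ownTasks (ω γ).ord (i γ) (s γ) (t γ) (J γ)) := by
  have hlen : PolyBounded (fun γ => (ω γ).size) fun γ => ((ω γ).ord (J γ)).length :=
    polyBounded_of_le fun γ => (ω γ).length_ord_le _
  have h₁ : Comp (fun x : ListExt fun γ => (ω γ).ord (J γ) => (ω x.1).size)
      (fun x => .cons (e x.1) (encodeFin x.2.1))
      fun x => encodePair (_root_.mkPair (i x.1) (some (J x.1, x.2.1)) (t x.1)) :=
    mkPair hi.weaken (some_sequence hJ.weaken var) ht.weaken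
  have h₂ := map (β := fun γ => Fin (ω γ).k) (eβ := fun _ => encodeFin)
    (δ := fun γ => SeqPair (Fin (ω γ).m) (Fin (ω γ).k)) (eδ := fun _ => encodePair)
    (g := fun γ a => _root_.mkPair (i γ) (some (J γ, a)) (t γ)) (he.ord hJ) hlen h₁
  have h₃ := map (β := fun γ => Fin (ω γ).k) (eβ := fun _ => encodeFin)
    (δ := fun γ => Operation (Fin (ω γ).m) (Fin (ω γ).k)) (eδ := fun _ => encodeOperation)
    (g := fun γ a => .call (_root_.mkPair (i γ) (some (J γ, a)) (t γ))) (he.ord hJ) hlen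
    (nil.pair h₁)
  exact ((const (.cons .nil .nil)).pair ((mkPair hi hs ht).pair h₂)).pair h₃

theorem sumTask (he : Comp (fun γ => (ω γ).size) e fun γ => (ω γ).encode)
    {b : ∀ γ, Fin (ω γ).k}
    (hi : Comp (fun γ => (ω γ).size) e fun γ => encodePlayer (i γ))
    (hs : Comp (fun γ => (ω γ).size) e fun γ => encodeSequence (s γ))
    (hJ : Comp (fun γ => (ω γ).size) e fun γ => encodeFin (J γ))
    (hK : Comp (fun γ => (ω γ).size) e fun γ => encodeFin (K γ))
    (hb : Comp (fun γ => (ω γ).size) e fun γ => encodeFin (b γ)) :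
    Comp (fun γ => (ω γ).size) e fun γ => encodeOperation
      (.sum (((ω γ).ord (J γ)).map fun a =>
        _root_.mkPair (i γ) (some (J γ, a)) (some (K γ, b γ)))
        (_root_.mkPair (i γ) (s γ) (some (K γ, b γ)))) :=
  (const (.cons (.cons .nil .nil) .nil)).pair
    ((map (β := fun γ => Fin (ω γ).k) (eβ := fun _ => encodeFin)
      (δ := fun γ => SeqPair (Fin (ω γ).m) (Fin (ω γ).k)) (eδ := fun _ => encodePair)
      (g := fun γ a => _root_.mkPair (i γ) (some (J γ, a)) (some (K γ, b γ))) (he.ord hJ)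
      (polyBounded_of_le fun γ => (ω γ).length_ord_le _)
      (mkPair hi.weaken (some_sequence hJ.weaken var) (some_sequence hK hb).weaken)).pair
      (mkPair hi hs (some_sequence hK hb)))

theorem sumTasks (he : Comp (fun γ => (ω γ).size) e fun γ => (ω γ).encode)
    (hi : Comp (fun γ => (ω γ).size) e fun γ => encodePlayer (i γ))
    (hs : Comp (fun γ => (ω γ).size) e fun γ => encodeSequence (s γ))
    (hJ : Comp (fun γ => (ω γ).size) e fun γ => encodeFin (J γ))
    (hK : Comp (fun γ => (ω γ).size) e fun γ => encodeFin (K γ)) :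
    Comp (fun γ => (ω γ).size) e fun γ => encodeList encodeOperation
      (((ω γ).ord (K γ)).map fun b => .sum (((ω γ).ord (J γ)).map fun a =>
        _root_.mkPair (i γ) (some (J γ, a)) (some (K γ, b)))
        (_root_.mkPair (i γ) (s γ) (some (K γ, b)))) :=
  map (β := fun γ => Fin (ω γ).k) (eβ := fun _ => encodeFin)
    (δ := fun γ => Operation (Fin (ω γ).m) (Fin (ω γ).k)) (eδ := fun _ => encodeOperation)
    (g := fun γ b => .sum (((ω γ).ord (J γ)).map fun a =>
        _root_.mkPair (i γ) (some (J γ, a)) (some (K γ, b)))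
        (_root_.mkPair (i γ) (s γ) (some (K γ, b)))) (he.ord hK)
    (polyBounded_of_le fun γ => (ω γ).length_ord_le _)
    (he.weaken.sumTask hi.weaken hs.weaken hJ.weaken hK.weaken var)

theorem opponentTasks (he : Comp (fun γ => (ω γ).size) e fun γ => (ω γ).encode)
    {star : ∀ γ, Option (Fin (ω γ).m)}
    (hi : Comp (fun γ => (ω γ).size) e fun γ => encodePlayer (i γ))
    (hs : Comp (fun γ => (ω γ).size) e fun γ => encodeSequence (s γ))
    (hstar : Comp (fun γ => (ω γ).size) e fun γ => encodeOption encodeFin (star γ))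
    (hK : Comp (fun γ => (ω γ).size) e fun γ => encodeFin (K γ)) :
    Comp (fun γ => (ω γ).size) e fun γ => encodeList encodeOperation
      (_root_.opponentTasks (ω γ).G (ω γ).ord (i γ) (s γ) (star γ) (K γ)) := by
  classical
  have h₁ := exists_mem (β := fun γ => Fin (ω γ).m) (eβ := fun _ => encodeFin)
    (p := fun γ J => (ω γ).G.Connected J (K γ)) hstar.toList
    ((PolyBounded.const 1).mono fun _ => length_toList_le _)
    (he.weaken.connected var hK.weaken)
  have h₂ := flatMap (β := fun γ => Fin (ω γ).m) (eβ := fun _ => encodeFin)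
    (δ := fun γ => Operation (Fin (ω γ).m) (Fin (ω γ).k)) (eδ := fun _ => encodeOperation)
    (g := fun γ J => ((ω γ).ord (K γ)).map fun b => .sum (((ω γ).ord J).map fun a =>
        _root_.mkPair (i γ) (some (J, a)) (some (K γ, b)))
        (_root_.mkPair (i γ) (s γ) (some (K γ, b)))) hstar.toList
    ((PolyBounded.const 1).mono fun _ => length_toList_le _)
    (he.weaken.sumTasks hi.weaken hs.weaken var hK.weaken)
    (polyBounded_of_le fun x => by simpa using (ω x.1).length_ord_le (K x.1))
  have h₃ := map (β := fun γ => Fin (ω γ).k) (eβ := fun _ => encodeFin)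
    (δ := fun γ => SeqPair (Fin (ω γ).m) (Fin (ω γ).k)) (eδ := fun _ => encodePair)
    (g := fun γ b => _root_.mkPair (i γ) (s γ) (some (K γ, b))) (he.ord hK)
    (polyBounded_of_le fun γ => (ω γ).length_ord_le _)
    (mkPair hi.weaken hs.weaken (some_sequence hK.weaken var))
  refine (ite h₁ h₂ (((const (.cons .nil .nil)).pair
    ((mkPair hi hs (he.parentSeq hK)).pair h₃)).pair nil)).congr fun γ => ?_
  rw [opponentTasks_eq]
  split_ifs <;> rfl

theorem length_playerBody : PolyBounded (fun γ => (ω γ).size) fun γ =>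
    (_root_.playerBody (ω γ).G (ω γ).ord (List.finRange (ω γ).m) (i γ) (s γ) (t γ)).length := by
  have h₁ : PolyBounded (fun γ => (ω γ).size) fun γ =>
      (_root_.ownList (ω γ).G (List.finRange (ω γ).m) (i γ) (s γ) (t γ)).length :=
    length_infosets.mono fun γ => List.length_filter_le _ _
  have h₂ := (h₁.flatMap (g := fun γ J => _root_.ownTasks (ω γ).ord (i γ) (s γ) (t γ) J)
    ((PolyBounded.self.add (.const 1)).mono fun x => by
      simpa [_root_.ownTasks] using (ω x.1).length_ord_le _))
  have h₃ := (length_opponentList (i := i) (s := s) (t := t)).flatMap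
    (g := fun γ K => _root_.opponentTasks (ω γ).G (ω γ).ord (i γ) (s γ)
      (_root_.criticalList (ω γ).G (List.finRange (ω γ).m) (i γ) (s γ) (t γ)).head? K)
    ((PolyBounded.self.add (.const 1)).mono fun x => length_opponentTasks_le _ _ _ _ _)
  exact (h₂.add h₃).mono fun γ => by simp [_root_.playerBody, callBody]

theorem playerBody (he : Comp (fun γ => (ω γ).size) e fun γ => (ω γ).encode)
    (hi : Comp (fun γ => (ω γ).size) e fun γ => encodePlayer (i γ))
    (hs : Comp (fun γ => (ω γ).size) e fun γ => encodeSequence (s γ))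
    (ht : Comp (fun γ => (ω γ).size) e fun γ => encodeSequence (t γ)) :
    Comp (fun γ => (ω γ).size) e fun γ => encodeList encodeOperation
      (_root_.playerBody (ω γ).G (ω γ).ord (List.finRange (ω γ).m) (i γ) (s γ) (t γ)) := by
  have h₁ : PolyBounded (fun γ => (ω γ).size) fun γ =>
      (_root_.ownList (ω γ).G (List.finRange (ω γ).m) (i γ) (s γ) (t γ)).length :=
    length_infosets.mono fun γ => List.length_filter_le _ _
  have h₂ : PolyBounded (fun x : ListExt fun γ => _root_.ownList (ω γ).G (List.finRange (ω γ).m)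
      (i γ) (s γ) (t γ) => (ω x.1).size) fun x =>
      (_root_.ownTasks (ω x.1).ord (i x.1) (s x.1) (t x.1) x.2.1).length :=
    (PolyBounded.self.add (.const 1)).mono fun x => by
      simpa [_root_.ownTasks] using (ω x.1).length_ord_le _
  have h₃ := flatMap (β := fun γ => Fin (ω γ).m) (eβ := fun _ => encodeFin)
    (δ := fun γ => Operation (Fin (ω γ).m) (Fin (ω γ).k)) (eδ := fun _ => encodeOperation)
    (g := fun γ J => _root_.ownTasks (ω γ).ord (i γ) (s γ) (t γ) J) (he.ownList hi hs ht) h₁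
    (he.weaken.ownTasks hi.weaken hs.weaken ht.weaken var) h₂
  have h₄ := flatMap (β := fun γ => Fin (ω γ).m) (eβ := fun _ => encodeFin)
    (δ := fun γ => Operation (Fin (ω γ).m) (Fin (ω γ).k)) (eδ := fun _ => encodeOperation)
    (g := fun γ K => _root_.opponentTasks (ω γ).G (ω γ).ord (i γ) (s γ)
      (_root_.criticalList (ω γ).G (List.finRange (ω γ).m) (i γ) (s γ) (t γ)).head? K)
    (he.opponentList hi hs ht) length_opponentList
    (he.weaken.opponentTasks hi.weaken hs.weaken (he.criticalList hi hs ht).list_head?.weaken var)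
    ((PolyBounded.self.add (.const 1)).mono fun x => length_opponentTasks_le _ _ _ _ _)
  exact h₃.append (h₁.flatMap h₂) h₄

theorem canonicalBody (he : Comp (fun γ => (ω γ).size) e fun γ => (ω γ).encode)
    {p : ∀ γ, SeqPair (Fin (ω γ).m) (Fin (ω γ).k)}
    (hp : Comp (fun γ => (ω γ).size) e fun γ => encodePair (p γ)) :
    Comp (fun γ => (ω γ).size) e fun γ => encodeList encodeOperation
      (_root_.canonicalBody (ω γ).G (ω γ).ord (List.finRange (ω γ).m) (p γ)) := by
  refine (ite (he.criticalList (i := fun _ => .one) nil hp.fst hp.snd).list_tail.list_eq_nil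
    (he.playerBody (i := fun _ => .one) nil hp.fst hp.snd)
    (he.playerBody (i := fun _ => .two) (const (.cons .nil .nil)) hp.snd hp.fst)).congr fun γ => ?_
  rw [_root_.canonicalBody]
  split_ifs <;> rfl

theorem length_canonicalBody {p : ∀ γ, SeqPair (Fin (ω γ).m) (Fin (ω γ).k)} :
    PolyBounded (fun γ => (ω γ).size) fun γ =>
      (_root_.canonicalBody (ω γ).G (ω γ).ord (List.finRange (ω γ).m) (p γ)).length := by
  refine ((length_playerBody (i := fun _ => .one) (s := fun γ => (p γ).1)
    (t := fun γ => (p γ).2)).add (length_playerBody (i := fun _ => .two) (s := fun γ => (p γ).2)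
    (t := fun γ => (p γ).1))).mono fun γ => ?_
  rw [_root_.canonicalBody]
  split_ifs
  · exact Nat.le_add_right _ _
  · exact Nat.le_add_left _ _

end Comp

/-! ## The algorithm runs in polynomial time -/

namespace Comp

variable {Γ : Type} {ω : Γ → GameInput} {e : Γ → Data}
  {D : ∀ γ, IndexedChain (Fin (ω γ).m) (Fin (ω γ).k)}

open Classical in
theorem indicator {c : ∀ γ, SeqPair (Fin (ω γ).m) (Fin (ω γ).k) → Prop}
    (hD : Comp (fun γ => (ω γ).size) e fun γ => encodeIndexedChain (D γ))
    (hdim : PolyBounded (fun γ => (ω γ).size) fun γ => (D γ).dim)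
    (hc : Comp (fun x : ListExt fun γ => List.ofFn (D γ).index => (ω x.1).size)
      (fun x => .cons (e x.1) (encodePair x.2.1)) fun x => encodeProp (c x.1 x.2.1)) :
    Comp (fun γ => (ω γ).size) e fun γ =>
      encodeList encodeNat (List.ofFn fun j => if c γ ((D γ).index j) then 1 else 0) := by
  refine (map (β := fun γ => SeqPair (Fin (ω γ).m) (Fin (ω γ).k)) (eβ := fun _ => encodePair)
    (δ := fun _ => ℕ) (eδ := fun _ => encodeNat) (l := fun γ => List.ofFn (D γ).index)
    (g := fun γ q => if c γ q then 1 else 0) hD.fst (by simpa using hdim)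
    ((ite hc (const (.cons .nil .nil)) nil).congr fun x => ?_)).congr fun γ => ?_
  · split_ifs <;> rfl
  · rw [List.map_ofFn]
    rfl

theorem mem_pair {q : ∀ γ, SeqPair (Fin (ω γ).m) (Fin (ω γ).k)}
    {l : ∀ γ, List (SeqPair (Fin (ω γ).m) (Fin (ω γ).k))}
    (hq : Comp (fun γ => (ω γ).size) e fun γ => encodePair (q γ))
    (hl : Comp (fun γ => (ω γ).size) e fun γ => encodeList encodePair (l γ))
    (hlen : PolyBounded (fun γ => (ω γ).size) fun γ => (l γ).length) :
    Comp (fun γ => (ω γ).size) e fun γ => encodeProp (q γ ∈ l γ) :=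
  (exists_mem (β := fun γ => SeqPair (Fin (ω γ).m) (Fin (ω γ).k)) (eβ := fun _ => encodePair)
    (p := fun γ r => q γ = r) hl hlen
    (eq_pair (ω := fun x : ListExt l => ω x.1) (q := fun x => x.2.1) hq.weaken var)).congr
      fun γ => by simp

theorem split (hD : Comp (fun γ => (ω γ).size) e fun γ => encodeIndexedChain (D γ))
    {source : ∀ γ, SeqPair (Fin (ω γ).m) (Fin (ω γ).k)}
    {new : ∀ γ, List (SeqPair (Fin (ω γ).m) (Fin (ω γ).k))}
    (hsource : Comp (fun γ => (ω γ).size) e fun γ => encodePair (source γ))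
    (hnew : Comp (fun γ => (ω γ).size) e fun γ => encodeList encodePair (new γ))
    (hdim : PolyBounded (fun γ => (ω γ).size) fun γ => (D γ).dim)
    (hlen : PolyBounded (fun γ => (ω γ).size) fun γ => (new γ).length) :
    Comp (fun γ => (ω γ).size) e fun γ =>
      encodeIndexedChain ((D γ).split (source γ) (new γ)) := by
  have h₁ := append (β := fun γ => SeqPair (Fin (ω γ).m) (Fin (ω γ).k))
    (eβ := fun _ => encodePair) (l := fun γ => List.ofFn (D γ).index) hD.fst (by simpa using hdim)
    hnew
  have h₂ := indicator (c := fun γ q => q = source γ) hD hdim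
    (eq_pair (ω := fun x : ListExt fun γ => List.ofFn (D γ).index => ω x.1) (p := fun x => x.2.1)
      var hsource.weaken)
  refine (h₁.pair ((h₂.pair (nil.pair (length (β := fun γ => SeqPair (Fin (ω γ).m) (Fin (ω γ).k))
    (eβ := fun _ => encodePair) hnew hlen))).pair hD.snd)).congr fun γ => ?_
  rw [← IndexedChain.ofFn_index_split (D γ) (source γ)]
  dsimp only [encodeIndexedChain, IndexedChain.split, encodeChain]
  -- What remains are the different decision procedures for the same indicator.
  congr!

theorem sum (hD : Comp (fun γ => (ω γ).size) e fun γ => encodeIndexedChain (D γ))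
    {sources : ∀ γ, List (SeqPair (Fin (ω γ).m) (Fin (ω γ).k))}
    {new : ∀ γ, SeqPair (Fin (ω γ).m) (Fin (ω γ).k)}
    (hsources : Comp (fun γ => (ω γ).size) e fun γ => encodeList encodePair (sources γ))
    (hnew : Comp (fun γ => (ω γ).size) e fun γ => encodePair (new γ))
    (hdim : PolyBounded (fun γ => (ω γ).size) fun γ => (D γ).dim)
    (hlen : PolyBounded (fun γ => (ω γ).size) fun γ => (sources γ).length) :
    Comp (fun γ => (ω γ).size) e fun γ =>
      encodeIndexedChain ((D γ).sum (sources γ) (new γ)) := by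
  have h₁ := append (β := fun γ => SeqPair (Fin (ω γ).m) (Fin (ω γ).k))
    (eβ := fun _ => encodePair) (l := fun γ => List.ofFn (D γ).index) (l' := fun γ => [new γ])
    hD.fst (by simpa using hdim) (hnew.pair nil)
  have h₂ := indicator (c := fun γ q => q ∈ sources γ) hD hdim
    (mem_pair (ω := fun x : ListExt fun γ => List.ofFn (D γ).index => ω x.1) (q := fun x => x.2.1)
      (l := fun x => sources x.1) var hsources.weaken (hlen.comp _))
  refine (h₁.pair ((h₂.pair nil).pair hD.snd)).congr fun γ => ?_
  rw [← IndexedChain.ofFn_index_sum (D γ) (sources γ)]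
  dsimp only [encodeIndexedChain, IndexedChain.sum, encodeChain]
  congr!

end Comp

/-- The encoding of the states of the stack machine. -/
def encodeState (x : GameInput)
    (s : List (Operation (Fin x.m) (Fin x.k)) × IndexedChain (Fin x.m) (Fin x.k)) : Data :=
  .cons x.encode (.cons (encodeList encodeOperation s.1) (encodeIndexedChain s.2))

/-- The size of a state of the stack machine is bounded by `n`. -/
structure StateBound {I A : Type*} (n : ℕ) (s : List (Operation I A) × IndexedChain I A) :
    Prop where
  dim_le : s.2.dim ≤ n
  new_le : ∀ source new, .split source new ∈ s.1 → new.length ≤ n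
  sources_le : ∀ sources new, .sum sources new ∈ s.1 → sources.length ≤ n

/-- The operations of a call at `p`. -/
noncomputable def GameInput.body (x : GameInput) (p : SeqPair (Fin x.m) (Fin x.k)) :
    List (Operation (Fin x.m) (Fin x.k)) :=
  canonicalBody x.G x.ord (List.finRange x.m) p

theorem GameInput.isBody_body (x : GameInput) (p : SeqPair (Fin x.m) (Fin x.k)) :
    IsBody x.G x.ord p (x.body p) :=
  isBody_canonicalBody x.perfectRecall (List.nodup_finRange _) List.mem_finRange p

namespace Comp

variable {Γ : Type} {ω : Γ → GameInput} {e : Γ → Data}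

theorem state_sum {sources : ∀ γ, List (SeqPair (Fin (ω γ).m) (Fin (ω γ).k))}
    {new : ∀ γ, SeqPair (Fin (ω γ).m) (Fin (ω γ).k)}
    {ts : ∀ γ, List (Operation (Fin (ω γ).m) (Fin (ω γ).k))}
    {D : ∀ γ, IndexedChain (Fin (ω γ).m) (Fin (ω γ).k)}
    (hs : Comp (fun γ => (ω γ).size) e fun γ =>
      encodeState (ω γ) (.sum (sources γ) (new γ) :: ts γ, D γ))
    (hdim : PolyBounded (fun γ => (ω γ).size) fun γ => (D γ).dim)
    (hlen : PolyBounded (fun γ => (ω γ).size) fun γ => (sources γ).length) :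
    Comp (fun γ => (ω γ).size) e fun γ =>
      encodeState (ω γ) (ts γ, (D γ).sum (sources γ) (new γ)) :=
  hs.fst.pair (hs.snd.fst.snd.pair
    (sum hs.snd.snd hs.snd.fst.fst.snd.fst hs.snd.fst.fst.snd.snd hdim hlen))

theorem state_split {source : ∀ γ, SeqPair (Fin (ω γ).m) (Fin (ω γ).k)}
    {new : ∀ γ, List (SeqPair (Fin (ω γ).m) (Fin (ω γ).k))}
    {ts : ∀ γ, List (Operation (Fin (ω γ).m) (Fin (ω γ).k))}
    {D : ∀ γ, IndexedChain (Fin (ω γ).m) (Fin (ω γ).k)}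
    (hs : Comp (fun γ => (ω γ).size) e fun γ =>
      encodeState (ω γ) (.split (source γ) (new γ) :: ts γ, D γ))
    (hdim : PolyBounded (fun γ => (ω γ).size) fun γ => (D γ).dim)
    (hlen : PolyBounded (fun γ => (ω γ).size) fun γ => (new γ).length) :
    Comp (fun γ => (ω γ).size) e fun γ =>
      encodeState (ω γ) (ts γ, (D γ).split (source γ) (new γ)) :=
  hs.fst.pair (hs.snd.fst.snd.pair
    (split hs.snd.snd hs.snd.fst.fst.snd.fst hs.snd.fst.fst.snd.snd hdim hlen))

theorem state_call {p : ∀ γ, SeqPair (Fin (ω γ).m) (Fin (ω γ).k)}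
    {ts : ∀ γ, List (Operation (Fin (ω γ).m) (Fin (ω γ).k))}
    {D : ∀ γ, IndexedChain (Fin (ω γ).m) (Fin (ω γ).k)}
    (hs : Comp (fun γ => (ω γ).size) e fun γ => encodeState (ω γ) (.call (p γ) :: ts γ, D γ)) :
    Comp (fun γ => (ω γ).size) e fun γ => encodeState (ω γ) ((ω γ).body (p γ) ++ ts γ, D γ) :=
  hs.fst.pair ((append (β := fun γ => Operation (Fin (ω γ).m) (Fin (ω γ).k))
    (eβ := fun _ => encodeOperation) (l := fun γ => (ω γ).body (p γ)) (l' := ts)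
    (canonicalBody hs.fst hs.snd.fst.fst.snd) length_canonicalBody hs.snd.fst.snd).pair hs.snd.snd)

/-- The size bounds are assumed for the states in question only; `StateBound` provides them for the
states that the machine reaches. -/
theorem machineStep {op : ∀ γ, Operation (Fin (ω γ).m) (Fin (ω γ).k)}
    {ts : ∀ γ, List (Operation (Fin (ω γ).m) (Fin (ω γ).k))}
    {D : ∀ γ, IndexedChain (Fin (ω γ).m) (Fin (ω γ).k)} {B : ℕ → ℕ}
    (hs : Comp (fun γ => (ω γ).size) e fun γ => encodeState (ω γ) (op γ :: ts γ, D γ))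
    (hB : PolyBounded (fun γ => (ω γ).size) fun γ => B (ω γ).size)
    (hbound : ∀ γ, StateBound (B (ω γ).size) (op γ :: ts γ, D γ)) :
    Comp (fun γ => (ω γ).size) e fun γ =>
      encodeState (ω γ) (_root_.machineStep (ω γ).body (op γ :: ts γ, D γ)) := by
  have htag : Comp (fun γ => (ω γ).size) e fun γ => (encodeOperation (op γ)).head :=
    hs.snd.fst.fst.head
  -- The tag is `nil` for a call, has head `nil` for a split and a nonempty head for a sum, so two
  -- tests identify the operation.
  refine htag.cases ((htag.head.reindex Subtype.val).cases ?_ ?_) ?_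
  · have h : ∀ γ : {γ : {γ // (encodeOperation (op γ)).head ≠ .nil} //
        (encodeOperation (op γ.1)).head.head ≠ .nil}, ∃ sources new,
        op γ.1.1 = .sum sources new := by
      rintro ⟨⟨γ, h₁⟩, h₂⟩
      rcases h : op γ with p | ⟨source, new⟩ | ⟨sources, new⟩
      · simp [h, encodeOperation, Data.head] at h₁
      · simp [h, encodeOperation, Data.head] at h₂
      · exact ⟨_, _, rfl⟩
    choose sources new h using h
    refine (state_sum (ω := fun γ : {γ : {γ // (encodeOperation (op γ)).head ≠ .nil} //
      (encodeOperation (op γ.1)).head.head ≠ .nil} => ω γ.1.1) (sources := sources) (new := new)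
      (ts := fun γ => ts γ.1.1) (D := fun γ => D γ.1.1)
      ((hs.reindex _).congr fun γ => by rw [h]) ((hB.comp _).mono fun γ => (hbound γ.1.1).dim_le)
      ((hB.comp _).mono fun γ => (hbound γ.1.1).sources_le _ (new γ) (by simp [h]))).congr
        fun γ => ?_
    rw [h]
    rfl
  · have h : ∀ γ : {γ : {γ // (encodeOperation (op γ)).head ≠ .nil} //
        (encodeOperation (op γ.1)).head.head = .nil}, ∃ source new,
        op γ.1.1 = .split source new := by
      rintro ⟨⟨γ, h₁⟩, h₂⟩
      rcases h : op γ with p | ⟨source, new⟩ | ⟨sources, new⟩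
      · simp [h, encodeOperation, Data.head] at h₁
      · exact ⟨_, _, rfl⟩
      · simp [h, encodeOperation, Data.head] at h₂
    choose source new h using h
    refine (state_split (ω := fun γ : {γ : {γ // (encodeOperation (op γ)).head ≠ .nil} //
      (encodeOperation (op γ.1)).head.head = .nil} => ω γ.1.1) (source := source) (new := new)
      (ts := fun γ => ts γ.1.1) (D := fun γ => D γ.1.1)
      ((hs.reindex _).congr fun γ => by rw [h]) ((hB.comp _).mono fun γ => (hbound γ.1.1).dim_le)
      ((hB.comp _).mono fun γ => (hbound γ.1.1).new_le (source γ) _ (by simp [h]))).congr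
        fun γ => ?_
    rw [h]
    rfl
  · have h : ∀ γ : {γ // (encodeOperation (op γ)).head = .nil}, ∃ p, op γ.1 = .call p := by
      rintro ⟨γ, h₁⟩
      rcases h : op γ with p | ⟨source, new⟩ | ⟨sources, new⟩
      · exact ⟨_, rfl⟩
      · simp [h, encodeOperation, Data.head] at h₁
      · simp [h, encodeOperation, Data.head] at h₁
    choose p h using h
    refine (state_call (ω := fun γ : {γ // (encodeOperation (op γ)).head = .nil} => ω γ.1) (p := p)
      (ts := fun γ => ts γ.1) (D := fun γ => D γ.1)
      ((hs.reindex _).congr fun γ => by rw [h])).congr fun γ => ?_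
    rw [h]
    rfl

end Comp

theorem IsBody.sources_length {I A : Type*} {G : EFG I A} {ord : I → List A} {p : SeqPair I A}
    {body : List (Operation I A)} (h : IsBody G ord p body) {sources : List (SeqPair I A)}
    {new : SeqPair I A} (hmem : .sum sources new ∈ body) :
    ∃ J, sources.length = (ord J).length := by
  obtain ⟨i, s, t, star, Js, Ks, -, -, -, -, -, -, -, rfl⟩ := h
  rw [List.mem_append, List.mem_flatMap, List.mem_flatMap] at hmem
  rcases hmem with ⟨J, -, hJ⟩ | ⟨K, -, hK⟩
  · simp [ownTasks] at hJ
  · rcases star with _ | J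
    · simp [opponentTasks] at hK
    · simp only [opponentTasks] at hK
      split_ifs at hK
      · simp only [List.mem_map, Operation.sum.injEq] at hK
        obtain ⟨b, -, rfl, -⟩ := hK
        exact ⟨J, by simp⟩
      · simp at hK

namespace GameInput

variable (x : GameInput)

/-- The initial state of the stack machine. -/
def initialState : List (Operation (Fin x.m) (Fin x.k)) × IndexedChain (Fin x.m) (Fin x.k) :=
  ([.call (none, none)], IndexedChain.init _ _)

/-- Coordinates and pending new entries are counted by the invariant, hence at most `size ^ 2` in
number. The sources of a sum are not entries to be filled in; they are as many as the actions of one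
information set, which accounts for the summand `size`. -/
theorem stateBound_iterate (n : ℕ) :
    StateBound (x.size ^ 2 + x.size) ((machineStep x.body)^[n] x.initialState) := by
  have hinv := machineInvariant_iterate x.perfectRecall x.isActionOrder_ord x.isBody_body n
  have hle := (length_none_cons_belowList_le x.perfectRecall).trans
    (Nat.pow_le_pow_left x.card_nodes_le 2)
  have hdim := hinv.dim
  refine ⟨?_, fun source new h => ?_, ?_⟩
  · simp only [initialState]
    omega
  · have : new.length ≤ (((machineStep x.body)^[n] x.initialState).1.flatMap
        (Operation.fill x.G)).length := by
      rw [List.length_flatMap]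
      exact List.single_le_sum (by simp) _ (List.mem_map.2 ⟨_, h, rfl⟩)
    simp only [initialState] at this
    omega
  · induction n with
    | zero => simp [initialState]
    | succ n ih =>
      have hn := machineInvariant_iterate x.perfectRecall x.isActionOrder_ord x.isBody_body n
      have ih := ih hn hn.dim
      rw [Function.iterate_succ_apply']
      clear hinv hdim hn
      revert ih
      rcases (machineStep x.body)^[n] x.initialState with
        ⟨_ | ⟨p | ⟨source, new⟩ | ⟨sources, new⟩, ts⟩, D⟩
      · simp [machineStep]
      · intro ih sources new h
        rcases List.mem_append.1 h with h | h
        · obtain ⟨J, hJ⟩ := (x.isBody_body p).sources_length h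
          rw [hJ]
          exact (x.length_ord_le J).trans (Nat.le_add_left _ _)
        · exact ih _ _ (List.mem_cons_of_mem _ h)
      · exact fun ih _ _ h => ih _ _ (List.mem_cons_of_mem _ h)
      · exact fun ih _ _ h => ih _ _ (List.mem_cons_of_mem _ h)

theorem exists_halts : ∃ n ≤ 2 * x.size ^ 2 + 2,
    ¬ ((machineStep x.body)^[n] x.initialState).1 ≠ [] := by
  obtain ⟨n, hn, h⟩ := exists_machine_halts x.perfectRecall x.isActionOrder_ord x.isBody_body
  refine ⟨n, hn.trans ?_, not_not.2 h⟩
  have hle := (length_none_cons_belowList_le x.perfectRecall).trans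
    (Nat.pow_le_pow_left x.card_nodes_le 2)
  simp only [Operation.weight, List.length_cons] at hle ⊢
  omega

end GameInput

theorem exists_comp_decompose : ∃ D : ∀ x : GameInput, IndexedChain (Fin x.m) (Fin x.k),
    (∀ x, DecomposeResult x.G (D x)) ∧
      Comp GameInput.size GameInput.encode fun x => encodeIndexedChain (D x) := by
  obtain ⟨n, hn, h⟩ := Comp.whileLoop (N := GameInput.size) (e := GameInput.encode)
    (eσ := encodeState) (F := fun x => machineStep x.body) (init := GameInput.initialState)
    (c := fun _ s => s.1 ≠ [])
    -- The initial stack and chain mention no information set and no action, so their encoding is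
    -- the same tree for all games and may be written down over `Fin 0`.
    ((Comp.refl _ _).pair ((Comp.const (encodeList encodeOperation
      [(.call (none, none) : Operation (Fin 0) (Fin 0))])).pair
      (Comp.const (encodeIndexedChain (IndexedChain.init (Fin 0) (Fin 0))))))
    ((Comp.refl _ _).snd.fst.encodeProp_ne_nil.congr fun x => by rw [encodeList_ne_nil])
    (by
      have hx : ∀ y : {y : Σ x : GameInput, List (Operation (Fin x.m) (Fin x.k)) ×
          IndexedChain (Fin x.m) (Fin x.k) // y.2.1 ≠ [] ∧
          ∃ j, (machineStep y.1.body)^[j] y.1.initialState = y.2}, ∃ op ts D,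
          y.1.2 = (op :: ts, D) := fun y =>
        ⟨_, _, y.1.2.2, Prod.ext (List.cons_head_tail y.2.1).symm rfl⟩
      choose op ts D hy using hx
      refine (Comp.machineStep (B := fun n => n ^ 2 + n) (op := op) (ts := ts) (D := D)
        ((Comp.refl _ _).congr fun y => by rw [hy])
        ⟨Polynomial.X ^ 2 + Polynomial.X, by simp⟩ fun y => ?_).congr fun y => by rw [hy]
      obtain ⟨j, hj⟩ := y.2.2
      rw [← hy, ← hj]
      exact y.1.1.stateBound_iterate j)
    (B := fun x => 2 * x.size ^ 2 + 2) ⟨2 * Polynomial.X ^ 2 + 2, by simp⟩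
    GameInput.exists_halts
  exact ⟨_, fun x => ⟨x.ord, x.isActionOrder_ord,
    executes_of_machineStep x.isBody_body (not_not.1 (hn x))⟩, h.snd.snd⟩

theorem mainTheorem1 :
    -- the decomposition, and the correctness of `Decompose`
    (∀ (I A : Type*) (G : EFG I A), G.PerfectRecall →
      (∃ D : IndexedChain I A, IsDecomposition G D) ∧
      (∃ D : IndexedChain I A, DecomposeResult G D) ∧
      (∀ D : IndexedChain I A, DecomposeResult G D → IsDecomposition G D)) ∧
    -- `Decompose` can be carried out exactly in polynomial time
    (∃ (prog : Prog) (P : Polynomial ℕ),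
      ∀ (m k : ℕ) (G : EFG (Fin m) (Fin k)) (L : List (List (Fin k))),
        G.PerfectRecall → IsNodeList G L →
          ∃ (D : IndexedChain (Fin m) (Fin k)) (t : ℕ),
            Eval prog (encodeGame G L) (encodeIndexedChain D) t ∧
            t ≤ P.eval (G.nodes.card + k) ∧
            DecomposeResult G D ∧ IsDecomposition G D) := by
  refine ⟨fun I A G hG => ?_, ?_⟩
  · obtain ⟨D, hD⟩ := exists_decomposeResult hG
    exact ⟨⟨D, hD.isDecomposition hG⟩, ⟨D, hD⟩, fun D hD => hD.isDecomposition hG⟩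
  · obtain ⟨D, hD, prog, P, h⟩ := exists_comp_decompose
    refine ⟨prog, P, fun m k G L hG hL => ?_⟩
    obtain ⟨t, ht, h⟩ := h ⟨m, k, G, L, hG, hL⟩
    exact ⟨_, t, h, ht, hD ⟨m, k, G, L, hG, hL⟩, (hD ⟨m, k, G, L, hG, hL⟩).isDecomposition hG⟩
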